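/- Fix $m,\varepsilon>0$ and $0<\delta<1$. On the set $\{(x,t)\in\mathbb{R}^2: 2x/\varepsilon,\,2t/\varepsilon,\,(x+t)/\varepsilon\in\mathbb{Z}\}$ consider pairs of complex-valued functions $A_k(x,t)=A_k(x,t,m,\varepsilon,\delta)$, $k\in\{1,2\}$, satisfying the following three axioms. Axiom 1: for $2x/\varepsilon$ and $2t/\varepsilon$ even, $$A_1(x,t)=\tfrac{1}{\sqrt{1+m^2\varepsilon^2}}\left(A_1(x+\tfrac\varepsilon2,t-\tfrac\varepsilon2)+m\varepsilon A_2(x+\tfrac\varepsilon2,t-\tfrac\varepsilon2)\right),$$ $$A_2(x,t)=\tfrac{1}{\sqrt{1+m^2\varepsilon^2}}\left(A_2(x-\tfrac\varepsilon2,t-\tfrac\varepsilon2)-m\varepsilon A_1(x-\tfrac\varepsilon2,t-\tfrac\varepsilon2)\right)+2\delta_{x0}\delta_{t0}.$$ Axiom 2: for $2x/\varepsilon$ and $2t/\varepsilon$ odd, $$A_1(x,t)=\tfrac{1}{\sqrt{1-\delta^2}}\left(A_1(x+\tfrac\varepsilon2,t-\tfrac\varepsilon2)-i\delta A_2(x+\tfrac\varepsilon2,t-\tfrac\varepsilon2)\right),$$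 $$A_2(x,t)=\tfrac{1}{\sqrt{1-\delta^2}}\left(A_2(x-\tfrac\varepsilon2,t-\tfrac\varepsilon2)+i\delta A_1(x-\tfrac\varepsilon2,t-\tfrac\varepsilon2)\right).$$ Axiom 3: $\sum_{(x,t)\in\varepsilon\mathbb{Z}^2}\left(|A_1(x,t)|^2+|A_2(x,t)|^2\right)<\infty$. (Here $\delta_{xy}$ is the Kronecker delta.) For $(x,t)\in\varepsilon\mathbb{Z}^2$ put $$\widetilde A_k(x,t,m,\varepsilon):=\lim_{\delta\searrow0}A_k(x,t,m,\varepsilon,\delta).$$ These objects are well defined: for all $m,\varepsilon>0$ and $0<\delta<1$ there is exactly one pair satisfying Axioms 1-3, and the limit exists for every $(x,t)\in\varepsilon\mathbb{Z}^2$ and $k\in\{1,2\}$. **Theorem (Large-time asymptotic formula between the peaks).** For each $\Delta>0$ there are $C_\Delta>0$ and $C(\Delta)>0$, depending only on $\Delta$, such that for all $m,\varepsilon>0$ and all $(x,t)\in\varepsilon\mathbb{Z}^2$ satisfying $$|x|/t<1/\sqrt{1+m^2\varepsilon^2}-\Delta,\qquad \varepsilon\le 1/m,\qquad t>C_\Delta/m,$$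 we have $$\widetilde A_1(x,t,m,\varepsilon)=\begin{cases} \varepsilon\sqrt{\frac{2m}{\pi}}\,\frac{\sin(\theta(x,t,m,\varepsilon)+\pi/4)}{(t^2-(1+m^2\varepsilon^2)x^2)^{1/4}}+R_1, & (x+t)/\varepsilon\text{ odd},\\[4pt] i\varepsilon\sqrt{\frac{2m}{\pi}}\,\frac{\cos(\theta(x,t,m,\varepsilon)+\pi/4)}{(t^2-(1+m^2\varepsilon^2)x^2)^{1/4}}+R_1, & (x+t)/\varepsilon\text{ even}, \end{cases}$$ $$\widetilde A_2(x,t,m,\varepsilon)=\begin{cases} \varepsilon\sqrt{\frac{2m}{\pi}}\sqrt{\frac{t+x}{t-x}}\,\frac{\cos(\theta(x,t,m,\varepsilon)+\pi/4)}{(t^2-(1+m^2\varepsilon^2)x^2)^{1/4}}+R_2, & (x+t)/\varepsilon\text{ even},\\[4pt] -i\varepsilon\sqrt{\frac{2m}{\pi}}\sqrt{\frac{t+x}{t-x}}\,\frac{\sin(\theta(x,t,m,\varepsilon)+\pi/4)}{(t^2-(1+m^2\varepsilon^2)x^2)^{1/4}}+R_2, & (x+t)/\varepsilon\text{ odd},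 \end{cases}$$ where $|R_k|\le C(\Delta)\,\dfrac{\varepsilon}{m^{1/2}t^{3/2}}$ for $k=1,2$ and $$\theta(x,t,m,\varepsilon):=\frac{t}{\varepsilon}\arcsin\frac{m\varepsilon t}{\sqrt{(1+m^2\varepsilon^2)(t^2-x^2)}}-\frac{x}{\varepsilon}\arcsin\frac{m\varepsilon x}{\sqrt{t^2-x^2}}.$$ -/

import Mathlib

open Filter Topology

namespace FeynmanAnticheckers

/-- Axioms 1-3 for a pair `A = (A₁, A₂)` of complex-valued functions on the union of the lattice
`εℤ²` and its dual, with lattice step `ε`, mass `m` and small imaginary mass `δ`.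
A point `(x, t)` with `2x/ε, 2t/ε, (x+t)/ε ∈ ℤ` is encoded by the pair of integers
`(a, b) = (2x/ε, 2t/ε)`, which has `a + b` even; a shift by `ε/2` is a shift by `1` of `a` or `b`.
The points with `a`, `b` even form `εℤ²`, the points with `a`, `b` odd form the dual lattice.
Pairs with `a + b` odd are not points of the domain; the field `off_domain` fixes the value `0`
there, so that a function on the domain corresponds to exactly one function on `ℤ × ℤ`. -/
structure IsRegularizedPropagator (m ε δ : ℝ) (A : (ℤ → ℤ → ℂ) × (ℤ → ℤ → ℂ)) : Prop where
  off_domain : ∀ a b : ℤ, Odd (a + b) → A.1 a b = 0 ∧ A.2 a b = 0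
  axiom1_fst : ∀ a b : ℤ, Even a → Even b →
    A.1 a b = 1 / (Real.sqrt (1 + m ^ 2 * ε ^ 2) : ℂ) *
      (A.1 (a + 1) (b - 1) + (m : ℂ) * (ε : ℂ) * A.2 (a + 1) (b - 1))
  axiom1_snd : ∀ a b : ℤ, Even a → Even b →
    A.2 a b = 1 / (Real.sqrt (1 + m ^ 2 * ε ^ 2) : ℂ) *
      (A.2 (a - 1) (b - 1) - (m : ℂ) * (ε : ℂ) * A.1 (a - 1) (b - 1))
      + 2 * (if a = 0 then 1 else 0) * (if b = 0 then 1 else 0)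
  axiom2_fst : ∀ a b : ℤ, Odd a → Odd b →
    A.1 a b = 1 / (Real.sqrt (1 - δ ^ 2) : ℂ) *
      (A.1 (a + 1) (b - 1) - Complex.I * (δ : ℂ) * A.2 (a + 1) (b - 1))
  axiom2_snd : ∀ a b : ℤ, Odd a → Odd b →
    A.2 a b = 1 / (Real.sqrt (1 - δ ^ 2) : ℂ) *
      (A.2 (a - 1) (b - 1) + Complex.I * (δ : ℂ) * A.1 (a - 1) (b - 1))
  axiom3 : Summable fun p : ℤ × ℤ =>
    ‖A.1 (2 * p.1) (2 * p.2)‖ ^ 2 + ‖A.2 (2 * p.1) (2 * p.2)‖ ^ 2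

/-- The pair `(A₁, A₂)` determined by axioms 1-3, in the coordinates `(2x/ε, 2t/ε)`. -/
noncomputable def regularizedPropagator (m ε δ : ℝ) : (ℤ → ℤ → ℂ) × (ℤ → ℤ → ℂ) :=
  Classical.epsilon (IsRegularizedPropagator m ε δ)

/-- The lattice propagator `Ã₁(x, t, m, ε)` at the point `(x, t) = (ε j, ε l)` of `εℤ²`. -/
noncomputable def latticePropagator₁ (j l : ℤ) (m ε : ℝ) : ℂ :=
  limUnder (𝓝[>] (0 : ℝ)) fun δ => (regularizedPropagator m ε δ).1 (2 * j) (2 * l)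

/-- The lattice propagator `Ã₂(x, t, m, ε)` at the point `(x, t) = (ε j, ε l)` of `εℤ²`. -/
noncomputable def latticePropagator₂ (j l : ℤ) (m ε : ℝ) : ℂ :=
  limUnder (𝓝[>] (0 : ℝ)) fun δ => (regularizedPropagator m ε δ).2 (2 * j) (2 * l)

/-- The lattice propagator is well defined: axioms 1-3 have exactly one solution for every
`0 < δ < 1`, and both components converge as `δ ↘ 0` at every point of `εℤ²`. -/
def WellDefined (m ε : ℝ) : Prop :=
  (∀ δ : ℝ, 0 < δ → δ < 1 → ∃! A : (ℤ → ℤ → ℂ) × (ℤ → ℤ → ℂ), IsRegularizedPropagator m ε δ A) ∧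
  ∀ j l : ℤ,
    Tendsto (fun δ => (regularizedPropagator m ε δ).1 (2 * j) (2 * l)) (𝓝[>] (0 : ℝ))
      (𝓝 (latticePropagator₁ j l m ε)) ∧
    Tendsto (fun δ => (regularizedPropagator m ε δ).2 (2 * j) (2 * l)) (𝓝[>] (0 : ℝ))
      (𝓝 (latticePropagator₂ j l m ε))

/-- The function `θ(x, t, m, ε)`; minus this function is the lattice action. -/
noncomputable def theta (x t m ε : ℝ) : ℝ :=
  t / ε * Real.arcsin (m * ε * t / Real.sqrt ((1 + m ^ 2 * ε ^ 2) * (t ^ 2 - x ^ 2)))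
    - x / ε * Real.arcsin (m * ε * x / Real.sqrt (t ^ 2 - x ^ 2))

end FeynmanAnticheckers

/-! The axioms are solved exactly by a Fourier integral, and the integral is then evaluated by the
method of stationary phase with constants uniform in all parameters. Write μ = mε, (x, t) = (εj,
εl), v = x/t.

Eliminating the dual lattice leaves a first-order recurrence on `εℤ²`. Each component of the
difference of two solutions satisfies a lattice Klein–Gordon equation perturbed by the imaginary
constant 2iμδ; pairing with the conjugate in ℓ² and taking imaginary parts makes it vanish
(`eq_zero_of_kleinGordon`). For existence, a Fourier transform in space turns the recurrence into a
2×2 transfer matrix of determinant 1. For δ > 0 one eigenvalue λ lies strictly inside the unit disc,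
and the solution proportional to λ^|l|, along different eigenvectors before and after the source, is
square summable (`symbol_recurrence`, `exists_symbol_bound`). The symbols stay continuous down to δ
= 0, where λ = exp(-iω(p)) with cos ω = cos p / √(1+μ²). With D = √(μ² + sin² p) and l ≥ 0, the
limits are the integrals over a period of exp(i(pj - ωl)) times iμ/(2πD), respectively (1 + sin p /
D)/(2π).

The reflection p ↦ π - p conjugates the exponential up to the sign (-1)^(j-l), so only the real or
the imaginary part of the integral over [-π/2, π/2] matters. There the phase has a single stationary
point. Put sin p = μ sinh η, D = μ cosh η, and let y be the hyperbolic sine of η minus the rapidity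
of v. The phase then has differential -Λ y dp/D with Λ = lμ√(1-v²), and dp/D = G(y) dy. For |y| ≤
Δ²/8 the function G and two of its derivatives are bounded in terms of Δ alone, and
`StationaryPhase.half_line` compares the integral with a Fresnel integral through the Morse
coordinate √(2Φ). Elsewhere `norm_far_le` integrates by parts twice; the variation of the amplitude
is controlled by the integral of dy/y², so nothing is lost as μ → 0 although y then reaches size
1/μ. The terms from ±π/2 have order 1/Λ, larger than the admissible Λ^(-3/2), but have the wrong
parity: they drop out of the real or imaginary part that is kept. Finally μΛ^(-3/2) is at most a
constant depending on Δ times ε / (m^(1/2) t^(3/2)). -/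

namespace FeynmanAnticheckers

/-! ### Uniqueness of the regularized propagator. -/

/-- A square-summable lattice function annihilated by a self-adjoint difference operator minus a
nonzero imaginary constant vanishes. -/
theorem eq_zero_of_kleinGordon {N κ : ℝ} (hκ : κ ≠ 0) (d : ℤ × ℤ → ℂ)
    (hd : Summable fun p => ‖d p‖ ^ 2)
    (h : ∀ p : ℤ × ℤ, (N : ℂ) * (d (p + (0, 1)) + d (p - (0, 1))) =
      d (p + (1, 0)) + d (p - (1, 0)) + 2 * Complex.I * κ * d p) (p : ℤ × ℤ) : d p = 0 := by
  have hshift : ∀ v : ℤ × ℤ, Summable fun p => ‖d (p + v)‖ ^ 2 := fun v =>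
    (Equiv.addRight v).summable_iff.mpr hd
  have hprod : ∀ v : ℤ × ℤ, Summable fun p => (starRingEnd ℂ) (d p) * d (p + v) := fun v => by
    refine Summable.of_norm_bounded (hd.add (hshift v)) fun p => ?_
    rw [norm_mul, Complex.norm_conj]
    nlinarith [sq_nonneg (‖d p‖ - ‖d (p + v)‖), sq_nonneg ‖d p‖, sq_nonneg ‖d (p + v)‖]
  -- Reindexing by v turns the correlation at shift -v into the conjugate of the one at shift v, so
  -- the sum over ±v is real.
  have hneg : ∀ v : ℤ × ℤ, ∑' p, (starRingEnd ℂ) (d p) * d (p - v) =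
      (starRingEnd ℂ) (∑' p, (starRingEnd ℂ) (d p) * d (p + v)) := fun v => by
    rw [Complex.conj_tsum, ← (Equiv.addRight v).tsum_eq]
    refine tsum_congr fun p => ?_
    simp [mul_comm]
  have hsub : ∀ v : ℤ × ℤ, Summable fun p => (starRingEnd ℂ) (d p) * d (p - v) := fun v => by
    simpa [sub_eq_add_neg] using hprod (-v)
  have h0 : Summable fun p => (starRingEnd ℂ) (d p) * d p := by simpa using hprod 0
  have key : (N : ℂ) * (∑' p, (starRingEnd ℂ) (d p) * d (p + (0, 1)) +
        ∑' p, (starRingEnd ℂ) (d p) * d (p - (0, 1))) =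
      ∑' p, (starRingEnd ℂ) (d p) * d (p + (1, 0)) + ∑' p, (starRingEnd ℂ) (d p) * d (p - (1, 0))
        + 2 * Complex.I * κ * ∑' p, (starRingEnd ℂ) (d p) * d p := by
    rw [← (hprod _).tsum_add (hsub _), ← (hprod _).tsum_add (hsub _), ← tsum_mul_left,
      ← tsum_mul_left, ← ((hprod _).add (hsub _)).tsum_add (h0.mul_left _)]
    exact tsum_congr fun p => by linear_combination (starRingEnd ℂ) (d p) * h p
  rw [hneg, hneg, Complex.add_conj, Complex.add_conj] at key
  have hsq : ∑' p, (starRingEnd ℂ) (d p) * d p = ((∑' p, ‖d p‖ ^ 2 : ℝ) : ℂ) := by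
    rw [Complex.ofReal_tsum]
    exact tsum_congr fun p => by rw [Complex.conj_mul']; push_cast; rfl
  rw [hsq] at key
  -- Everything except the term with κ is real, so the imaginary part reads 2κ ‖d‖² = 0.
  have him := congrArg Complex.im key
  have hz : ∑' p, ‖d p‖ ^ 2 = 0 := by
    simpa [hκ, mul_assoc] using him
  have := (hasSum_zero_iff_of_nonneg (fun p => sq_nonneg ‖d p‖)).1 (hz ▸ hd.hasSum)
  have := congrFun this p
  simpa using this

/-- The axioms restricted to the even sublattice, with `N = √(1 + μ²) √(1 - δ²)`. -/
structure EvenRecurrence (N μ δ : ℝ) (s : ℤ → ℤ → ℂ) (d₁ d₂ : ℤ → ℤ → ℂ) : Prop where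
  fst : ∀ j l, (N : ℂ) * d₁ j (l + 1) = d₁ (j + 1) l + Complex.I * μ * δ * d₁ j l
    + μ * d₂ j l - Complex.I * δ * d₂ (j + 1) l
  snd : ∀ j l, (N : ℂ) * d₂ j (l + 1) = d₂ (j - 1) l + Complex.I * μ * δ * d₂ j l
    + Complex.I * δ * d₁ (j - 1) l - μ * d₁ j l + N * s j (l + 1)

theorem EvenRecurrence.sub {N μ δ : ℝ} {s a₁ a₂ b₁ b₂ : ℤ → ℤ → ℂ}
    (ha : EvenRecurrence N μ δ s a₁ a₂) (hb : EvenRecurrence N μ δ s b₁ b₂) :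
    EvenRecurrence N μ δ 0 (a₁ - b₁) (a₂ - b₂) where
  fst j l := by
    have h := ha.fst j l
    have h' := hb.fst j l
    simp only [Pi.sub_apply]
    linear_combination h - h'
  snd j l := by
    have h := ha.snd j l
    have h' := hb.snd j l
    simp only [Pi.sub_apply, Pi.zero_apply]
    linear_combination h - h'

/-- Combining the first-order system at two consecutive times eliminates the other component. Both
components then satisfy the same second-order equation, with κ = μδ nonzero; this is where δ > 0
enters. -/
theorem EvenRecurrence.eq_zero {N μ δ : ℝ} (hμ : 0 < μ) (hδ : 0 < δ) (hN : 0 < N)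
    (hN2 : N ^ 2 = (1 + μ ^ 2) * (1 - δ ^ 2)) {d₁ d₂ : ℤ → ℤ → ℂ}
    (h : EvenRecurrence N μ δ 0 d₁ d₂)
    (h₁ : Summable fun p : ℤ × ℤ => ‖d₁ p.1 p.2‖ ^ 2)
    (h₂ : Summable fun p : ℤ × ℤ => ‖d₂ p.1 p.2‖ ^ 2) (j l : ℤ) : d₁ j l = 0 ∧ d₂ j l = 0 := by
  have hNc : (N : ℂ) ≠ 0 := by exact_mod_cast hN.ne'
  have hN2c : (N : ℂ) ^ 2 = (1 + μ ^ 2) * (1 - δ ^ 2) := by exact_mod_cast hN2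
  have hI := Complex.I_sq
  have hκ : μ * δ ≠ 0 := (mul_pos hμ hδ).ne'
  have e : ∀ l : ℤ, l - 1 + 1 = l := fun l => by ring
  have e' : ∀ l : ℤ, l + 1 - 1 = l := fun l => by ring
  constructor
  · refine eq_zero_of_kleinGordon (N := N) (κ := μ * δ) hκ (fun p => d₁ p.1 p.2) h₁ (fun p => ?_)
      (j, l)
    obtain ⟨j, l⟩ := p
    simp only [Prod.mk_add_mk, Prod.mk_sub_mk, add_zero, sub_zero]
    apply mul_left_cancel₀ hNc
    have a0 := h.fst j l
    have a1 := h.fst j (l - 1)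
    have a2 := h.fst (j - 1) (l - 1)
    have a3 := h.snd j (l - 1)
    have a4 := h.snd (j + 1) (l - 1)
    simp only [e, e', Pi.zero_apply] at a1 a2 a3 a4
    push_cast
    linear_combination N * a0 - a2 - Complex.I * μ * δ * a1 + μ * a3 - Complex.I * δ * a4
      + d₁ j (l - 1) * hN2c - (d₁ j (l - 1) * μ ^ 2 * δ ^ 2 + d₁ j (l - 1) * δ ^ 2) * hI
  · refine eq_zero_of_kleinGordon (N := N) (κ := μ * δ) hκ (fun p => d₂ p.1 p.2) h₂ (fun p => ?_)
      (j, l)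
    obtain ⟨j, l⟩ := p
    simp only [Prod.mk_add_mk, Prod.mk_sub_mk, add_zero, sub_zero]
    apply mul_left_cancel₀ hNc
    have a0 := h.snd j l
    have a1 := h.snd j (l - 1)
    have a2 := h.snd (j + 1) (l - 1)
    have a3 := h.fst j (l - 1)
    have a4 := h.fst (j - 1) (l - 1)
    simp only [e, e', Pi.zero_apply] at a0 a1 a2 a3 a4
    push_cast
    linear_combination N * a0 - a2 - Complex.I * μ * δ * a1 - μ * a3 + Complex.I * δ * a4
      + d₂ j (l - 1) * hN2c - (d₂ j (l - 1) * μ ^ 2 * δ ^ 2 + d₂ j (l - 1) * δ ^ 2) * hI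

/-- The normalization constant `√(1 + μ²) √(1 - δ²)` of two consecutive half-steps. -/
noncomputable def stepNorm (μ δ : ℝ) : ℝ := Real.sqrt (1 + μ ^ 2) * Real.sqrt (1 - δ ^ 2)

theorem stepNorm_sq {μ δ : ℝ} (hδ : δ ^ 2 < 1) :
    stepNorm μ δ ^ 2 = (1 + μ ^ 2) * (1 - δ ^ 2) := by
  rw [stepNorm, mul_pow, Real.sq_sqrt (by positivity), Real.sq_sqrt (by linarith)]

theorem stepNorm_pos {μ δ : ℝ} (hδ : δ ^ 2 < 1) : 0 < stepNorm μ δ :=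
  mul_pos (Real.sqrt_pos.2 (by positivity)) (Real.sqrt_pos.2 (by linarith))

/-- The point source of the lattice Dirac equation. -/
noncomputable def pointSource (j l : ℤ) : ℂ := 2 * (if j = 0 then 1 else 0) * (if l = 0 then 1 else 0)

/-- Axiom 2 is substituted into Axiom 1, which removes the dual lattice and multiplies the two
normalizations. -/
theorem IsRegularizedPropagator.evenRecurrence {m ε δ : ℝ} (hδ : δ ^ 2 < 1)
    {A : (ℤ → ℤ → ℂ) × (ℤ → ℤ → ℂ)} (hA : IsRegularizedPropagator m ε δ A) :
    EvenRecurrence (stepNorm (m * ε) δ) (m * ε) δ pointSource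
      (fun j l => A.1 (2 * j) (2 * l)) (fun j l => A.2 (2 * j) (2 * l)) := by
  have hn : ((Real.sqrt (1 + m ^ 2 * ε ^ 2) : ℝ) : ℂ) ≠ 0 := by
    exact_mod_cast (Real.sqrt_pos.2 (by positivity)).ne'
  have hs : ((Real.sqrt (1 - δ ^ 2) : ℝ) : ℂ) ≠ 0 := by
    exact_mod_cast (Real.sqrt_pos.2 (by linarith)).ne'
  have hI := Complex.I_sq
  constructor
  · intro j l
    have h0 := hA.axiom1_fst (2 * j) (2 * (l + 1)) (by simp) (by simp)
    have h1 := hA.axiom2_fst (2 * j + 1) (2 * (l + 1) - 1) (by simp) ⟨l, by ring⟩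
    have h2 := hA.axiom2_snd (2 * j + 1) (2 * (l + 1) - 1) (by simp) ⟨l, by ring⟩
    rw [show 2 * j + 1 + 1 = 2 * (j + 1) by ring, show 2 * (l + 1) - 1 - 1 = 2 * l by ring] at h1
    rw [show 2 * j + 1 - 1 = 2 * j by ring, show 2 * (l + 1) - 1 - 1 = 2 * l by ring] at h2
    rw [h0, h1, h2, stepNorm, mul_pow]
    push_cast
    field_simp
    ring
  · intro j l
    have h0 := hA.axiom1_snd (2 * j) (2 * (l + 1)) (by simp) (by simp)
    have h1 := hA.axiom2_fst (2 * j - 1) (2 * (l + 1) - 1) ⟨j - 1, by ring⟩ ⟨l, by ring⟩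
    have h2 := hA.axiom2_snd (2 * j - 1) (2 * (l + 1) - 1) ⟨j - 1, by ring⟩ ⟨l, by ring⟩
    rw [show 2 * j - 1 + 1 = 2 * j by ring, show 2 * (l + 1) - 1 - 1 = 2 * l by ring] at h1
    rw [show 2 * j - 1 - 1 = 2 * (j - 1) by ring, show 2 * (l + 1) - 1 - 1 = 2 * l by ring] at h2
    have e1 : (2 * j = 0) = (j = 0) := by simp
    have e2 : (2 * (l + 1) = 0) = (l + 1 = 0) := by simp
    simp only [e1, e2] at h0
    simp only [pointSource]
    rw [h0, h1, h2, stepNorm, mul_pow]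
    push_cast
    field_simp
    ring

theorem IsRegularizedPropagator.summable {m ε δ : ℝ} {A : (ℤ → ℤ → ℂ) × (ℤ → ℤ → ℂ)}
    (hA : IsRegularizedPropagator m ε δ A) :
    (Summable fun p : ℤ × ℤ => ‖A.1 (2 * p.1) (2 * p.2)‖ ^ 2) ∧
      Summable fun p : ℤ × ℤ => ‖A.2 (2 * p.1) (2 * p.2)‖ ^ 2 :=
  ⟨hA.axiom3.of_nonneg_of_le (fun _ => by positivity) fun _ => le_add_of_nonneg_right (by positivity),
    hA.axiom3.of_nonneg_of_le (fun _ => by positivity) fun _ => le_add_of_nonneg_left (by positivity)⟩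

theorem summable_sub_sq {ι : Type*} {f g : ι → ℂ} (hf : Summable fun i => ‖f i‖ ^ 2)
    (hg : Summable fun i => ‖g i‖ ^ 2) : Summable fun i => ‖f i - g i‖ ^ 2 := by
  refine ((hf.mul_left 2).add (hg.mul_left 2)).of_nonneg_of_le (fun _ => by positivity) fun i => ?_
  nlinarith [norm_sub_le (f i) (g i), sq_nonneg (‖f i‖ - ‖g i‖), norm_nonneg (f i - g i),
    norm_nonneg (f i), norm_nonneg (g i)]

/-- Square summability is available only on the even sublattice, so the ℓ² argument runs there.
Axiom 2 then gives the dual sites and `off_domain` the remaining pairs. -/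
theorem IsRegularizedPropagator.unique {m ε δ : ℝ} (hm : 0 < m) (hε : 0 < ε) (hδ : 0 < δ)
    (hδ1 : δ < 1) {A B : (ℤ → ℤ → ℂ) × (ℤ → ℤ → ℂ)} (hA : IsRegularizedPropagator m ε δ A)
    (hB : IsRegularizedPropagator m ε δ B) : A = B := by
  have hδ2 : δ ^ 2 < 1 := by nlinarith
  have heven : ∀ j l : ℤ, A.1 (2 * j) (2 * l) = B.1 (2 * j) (2 * l) ∧
      A.2 (2 * j) (2 * l) = B.2 (2 * j) (2 * l) := fun j l => by
    have := EvenRecurrence.eq_zero (mul_pos hm hε) hδ (stepNorm_pos hδ2) (stepNorm_sq hδ2)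
      ((hA.evenRecurrence hδ2).sub (hB.evenRecurrence hδ2))
      (summable_sub_sq hA.summable.1 hB.summable.1) (summable_sub_sq hA.summable.2 hB.summable.2) j l
    exact ⟨sub_eq_zero.1 this.1, sub_eq_zero.1 this.2⟩
  have hall : ∀ a b : ℤ, A.1 a b = B.1 a b ∧ A.2 a b = B.2 a b := fun a b => by
    rcases Int.even_or_odd (a + b) with hab | hab
    · rcases Int.even_or_odd b with hb | hb
      · obtain ⟨j, rfl⟩ : Even a := by simpa [Int.even_add, hb] using hab
        obtain ⟨l, rfl⟩ := hb
        simpa only [two_mul] using heven j l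
      · have ha : Odd a := by
          rw [← Int.not_even_iff_odd] at hb ⊢
          rwa [Int.even_add, iff_false_right hb] at hab
        rw [hA.axiom2_fst a b ha hb, hB.axiom2_fst a b ha hb, hA.axiom2_snd a b ha hb,
          hB.axiom2_snd a b ha hb]
        obtain ⟨j, rfl⟩ := ha
        obtain ⟨l, rfl⟩ := hb
        have h1 := heven (j + 1) l
        have h2 := heven j l
        rw [show 2 * j + 1 + 1 = 2 * (j + 1) by ring, show 2 * j + 1 - 1 = 2 * j by ring,
          show 2 * l + 1 - 1 = 2 * l by ring, h1.1, h1.2, h2.1, h2.2]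
        exact ⟨rfl, rfl⟩
    · exact ⟨(hA.off_domain a b hab).1.trans (hB.off_domain a b hab).1.symm,
        (hA.off_domain a b hab).2.trans (hB.off_domain a b hab).2.symm⟩
  exact Prod.ext (funext₂ fun a b => (hall a b).1) (funext₂ fun a b => (hall a b).2)

/-! ### Extension from the even sublattice to the whole lattice. -/

/-- The pair of functions on the whole lattice determined by its values on the even sublattice
through Axiom 2. -/
noncomputable def extendEven (δ : ℝ) (a₁ a₂ : ℤ → ℤ → ℂ) : (ℤ → ℤ → ℂ) × (ℤ → ℤ → ℂ) :=
  (fun a b => if Odd (a + b) then 0 else if Even b then a₁ (a / 2) (b / 2) else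
      1 / (Real.sqrt (1 - δ ^ 2) : ℂ) * (a₁ ((a + 1) / 2) ((b - 1) / 2)
        - Complex.I * (δ : ℂ) * a₂ ((a + 1) / 2) ((b - 1) / 2)),
   fun a b => if Odd (a + b) then 0 else if Even b then a₂ (a / 2) (b / 2) else
      1 / (Real.sqrt (1 - δ ^ 2) : ℂ) * (a₂ ((a - 1) / 2) ((b - 1) / 2)
        + Complex.I * (δ : ℂ) * a₁ ((a - 1) / 2) ((b - 1) / 2)))

theorem extendEven_even (δ : ℝ) (a₁ a₂ : ℤ → ℤ → ℂ) (j l : ℤ) :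
    (extendEven δ a₁ a₂).1 (2 * j) (2 * l) = a₁ j l ∧
      (extendEven δ a₁ a₂).2 (2 * j) (2 * l) = a₂ j l := by
  have h : ¬ Odd (2 * j + 2 * l) := by rw [← mul_add]; simp
  simp [extendEven, h]

theorem extendEven_odd (δ : ℝ) (a₁ a₂ : ℤ → ℤ → ℂ) (j l : ℤ) :
    (extendEven δ a₁ a₂).1 (2 * j + 1) (2 * l + 1) = 1 / (Real.sqrt (1 - δ ^ 2) : ℂ) *
        (a₁ (j + 1) l - Complex.I * (δ : ℂ) * a₂ (j + 1) l) ∧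
      (extendEven δ a₁ a₂).2 (2 * j + 1) (2 * l + 1) = 1 / (Real.sqrt (1 - δ ^ 2) : ℂ) *
        (a₂ j l + Complex.I * (δ : ℂ) * a₁ j l) := by
  have h : ¬ Odd (2 * j + 1 + (2 * l + 1)) := by
    rw [show 2 * j + 1 + (2 * l + 1) = 2 * (j + l + 1) by ring]; simp
  have h' : ¬ Even (2 * l + 1) := by simp
  have e : (2 * j + 1 + 1) / 2 = j + 1 := by omega
  simp [extendEven, h, h', e]

theorem isRegularizedPropagator_extendEven {m ε δ : ℝ} (hδ : δ ^ 2 < 1) {a₁ a₂ : ℤ → ℤ → ℂ}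
    (h : EvenRecurrence (stepNorm (m * ε) δ) (m * ε) δ pointSource a₁ a₂)
    (h₁ : Summable fun p : ℤ × ℤ => ‖a₁ p.1 p.2‖ ^ 2)
    (h₂ : Summable fun p : ℤ × ℤ => ‖a₂ p.1 p.2‖ ^ 2) :
    IsRegularizedPropagator m ε δ (extendEven δ a₁ a₂) := by
  have hn : ((Real.sqrt (1 + m ^ 2 * ε ^ 2) : ℝ) : ℂ) ≠ 0 := by
    exact_mod_cast (Real.sqrt_pos.2 (by positivity)).ne'
  have hs : ((Real.sqrt (1 - δ ^ 2) : ℝ) : ℂ) ≠ 0 := by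
    exact_mod_cast (Real.sqrt_pos.2 (by linarith)).ne'
  have hI := Complex.I_sq
  refine ⟨fun a b hab => by simp [extendEven, hab], ?_, ?_, ?_, ?_, ?_⟩
  · rintro a b ⟨j, rfl⟩ ⟨l, rfl⟩
    have h0 := h.fst j (l - 1)
    have e := (extendEven_even δ a₁ a₂ j l).1
    have e' := extendEven_odd δ a₁ a₂ j (l - 1)
    rw [← two_mul, ← two_mul, show 2 * l - 1 = 2 * (l - 1) + 1 by ring, e, e'.1, e'.2]
    rw [sub_add_cancel, stepNorm, mul_pow] at h0
    push_cast at h0 ⊢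
    field_simp
    linear_combination h0
  · rintro a b ⟨j, rfl⟩ ⟨l, rfl⟩
    have h0 := h.snd j (l - 1)
    have e := (extendEven_even δ a₁ a₂ j l).2
    have e' := extendEven_odd δ a₁ a₂ (j - 1) (l - 1)
    have e1 : (2 * j = 0) = (j = 0) := by simp
    have e2 : (2 * l = 0) = (l = 0) := by simp
    rw [← two_mul, ← two_mul, show 2 * l - 1 = 2 * (l - 1) + 1 by ring,
      show 2 * j - 1 = 2 * (j - 1) + 1 by ring, e, e'.1, e'.2]
    simp only [e1, e2]
    rw [sub_add_cancel, stepNorm, mul_pow, pointSource] at h0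
    rw [sub_add_cancel]
    push_cast at h0 ⊢
    generalize (2 * (if j = 0 then 1 else 0) * (if l = 0 then 1 else 0) : ℂ) = s at h0 ⊢
    field_simp
    linear_combination h0
  · rintro a b ⟨j, rfl⟩ ⟨l, rfl⟩
    rw [(extendEven_odd δ a₁ a₂ j l).1, show 2 * j + 1 + 1 = 2 * (j + 1) by ring,
      add_sub_cancel_right, (extendEven_even δ a₁ a₂ _ l).1, (extendEven_even δ a₁ a₂ _ l).2]
  · rintro a b ⟨j, rfl⟩ ⟨l, rfl⟩
    rw [(extendEven_odd δ a₁ a₂ j l).2, add_sub_cancel_right,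
      add_sub_cancel_right, (extendEven_even δ a₁ a₂ _ l).1, (extendEven_even δ a₁ a₂ _ l).2]
  · refine (h₁.add h₂).congr fun p => ?_
    rw [(extendEven_even δ a₁ a₂ _ _).1, (extendEven_even δ a₁ a₂ _ _).2]

/-! ### Fourier series in the space variable. -/

/-- The inverse Fourier transform on the lattice `ℤ`. -/
noncomputable def invFourier (f : ℝ → ℂ) (j : ℤ) : ℂ :=
  1 / (2 * Real.pi) * ∫ p in (-Real.pi)..Real.pi, f p * Complex.exp (Complex.I * p * j)

/-- The index is negated because `invFourier` carries the exponential with a plus sign. -/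
theorem invFourier_eq_fourierCoeffOn (f : ℝ → ℂ) (j : ℤ) :
    invFourier f j = fourierCoeffOn (neg_lt_self Real.pi_pos) f (-j) := by
  rw [invFourier, fourierCoeffOn_eq_integral, neg_neg, sub_neg_eq_add, ← two_mul, Complex.real_smul]
  congr 1
  · push_cast; rfl
  · refine intervalIntegral.integral_congr fun p _ => ?_
    simp only [smul_eq_mul]
    rw [fourier_coe_apply, mul_comm]
    congr 2
    have : (Real.pi : ℂ) ≠ 0 := by exact_mod_cast Real.pi_ne_zero
    push_cast
    field_simp

theorem hasSum_sq_invFourier {f : ℝ → ℂ} (hf : Continuous f) :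
    HasSum (fun j => ‖invFourier f j‖ ^ 2)
      ((2 * Real.pi)⁻¹ * ∫ p in (-Real.pi)..Real.pi, ‖f p‖ ^ 2) := by
  have hmem : MeasureTheory.MemLp f 2
      (MeasureTheory.volume.restrict (Set.Ioc (-Real.pi) Real.pi)) := by
    have hb := (isCompact_Icc (a := -Real.pi) (b := Real.pi)).bddAbove_image
      (f := fun p => ‖f p‖) (by fun_prop)
    obtain ⟨C, hC⟩ := hb
    refine MeasureTheory.MemLp.of_bound hf.aestronglyMeasurable C ?_
    refine (MeasureTheory.ae_restrict_iff' measurableSet_Ioc).2 (.of_forall fun p hp => ?_)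
    exact hC ⟨p, Set.Ioc_subset_Icc_self hp, rfl⟩
  have h := hasSum_sq_fourierCoeffOn (neg_lt_self Real.pi_pos) hmem
  rw [sub_neg_eq_add, ← two_mul, smul_eq_mul] at h
  have h2 := (Equiv.neg ℤ).hasSum_iff.2 h
  convert h2 using 2 with j
  simp [invFourier_eq_fourierCoeffOn]

theorem summable_pow_natAbs {r : ℝ} (h0 : 0 ≤ r) (h1 : r < 1) :
    Summable fun l : ℤ => r ^ l.natAbs :=
  Summable.of_nat_of_neg (by simpa using summable_geometric_of_lt_one h0 h1)
    (by simpa using summable_geometric_of_lt_one h0 h1)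

/-- Parseval converts the sum over space into an L² norm at each time, and the geometric decay in
|l| sums these norms. -/
theorem summable_sq_invFourier {f : ℤ → ℝ → ℂ} (hf : ∀ l, Continuous (f l)) {K r : ℝ}
    (hr0 : 0 ≤ r) (hr : r < 1)
    (hb : ∀ l, ∀ p ∈ Set.Icc (-Real.pi) Real.pi, ‖f l p‖ ≤ K * r ^ l.natAbs) :
    Summable fun q : ℤ × ℤ => ‖invFourier (f q.2) q.1‖ ^ 2 := by
  rw [← (Equiv.prodComm ℤ ℤ).summable_iff]
  refine (summable_prod_of_nonneg fun _ => sq_nonneg _).2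
    ⟨fun l => (hasSum_sq_invFourier (hf l)).summable, ?_⟩
  refine ((summable_pow_natAbs (sq_nonneg r) (by nlinarith)).mul_left (K ^ 2)).of_nonneg_of_le
    (fun l => tsum_nonneg fun _ => sq_nonneg _) fun l => ?_
  have hs : ∑' j, ‖invFourier (f l) j‖ ^ 2 = _ := (hasSum_sq_invFourier (hf l)).tsum_eq
  change ∑' j, ‖invFourier (f l) j‖ ^ 2 ≤ _
  rw [hs]
  have hpi := Real.pi_pos
  have hint : ∫ p in (-Real.pi)..Real.pi, ‖f l p‖ ^ 2 ≤
      ∫ p in (-Real.pi)..Real.pi, K ^ 2 * (r ^ 2) ^ l.natAbs := by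
    refine intervalIntegral.integral_mono_on (by linarith)
      (((hf l).norm.pow 2).intervalIntegrable _ _) (by simp) fun p hp => ?_
    have := pow_le_pow_left₀ (norm_nonneg _) (hb l p hp) 2
    rwa [mul_pow, ← pow_mul, mul_comm l.natAbs, pow_mul] at this
  rw [intervalIntegral.integral_const, smul_eq_mul] at hint
  rw [inv_mul_le_iff₀ (by positivity)]
  linarith

theorem invFourier_add {f g : ℝ → ℂ} (hf : Continuous f) (hg : Continuous g) (j : ℤ) :
    invFourier (fun p => f p + g p) j = invFourier f j + invFourier g j := by
  simp only [invFourier, add_mul]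
  rw [intervalIntegral.integral_add (Continuous.intervalIntegrable (by fun_prop) _ _)
    (Continuous.intervalIntegrable (by fun_prop) _ _), mul_add]

theorem invFourier_mul_left (c : ℂ) (f : ℝ → ℂ) (j : ℤ) :
    invFourier (fun p => c * f p) j = c * invFourier f j := by
  simp only [invFourier, mul_assoc, intervalIntegral.integral_const_mul]
  ring

theorem invFourier_exp_mul (k : ℤ) (f : ℝ → ℂ) (j : ℤ) :
    invFourier (fun p => Complex.exp (Complex.I * p * k) * f p) j = invFourier f (j + k) := by
  simp only [invFourier]
  congr 1
  refine intervalIntegral.integral_congr fun p _ => ?_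
  push_cast
  rw [mul_add, Complex.exp_add]
  ring

theorem invFourier_one (j : ℤ) : invFourier (fun _ => 1) j = if j = 0 then 1 else 0 := by
  have hpi : (Real.pi : ℂ) ≠ 0 := by exact_mod_cast Real.pi_ne_zero
  simp only [invFourier, one_mul]
  split_ifs with h
  · subst h
    simp
    field_simp
    norm_num
  · have hj : (Complex.I * j) ≠ 0 := by simp [h]
    have := integral_exp_mul_complex (a := -Real.pi) (b := Real.pi) hj
    have h2 : ∀ p : ℝ, Complex.I * p * j = Complex.I * j * p := fun p => by ring
    simp only [h2]
    rw [this]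
    have h3 : Complex.exp (Complex.I * j * ((-Real.pi : ℝ) : ℂ)) =
        Complex.exp (Complex.I * j * (Real.pi : ℝ)) := by
      rw [Complex.exp_eq_exp_iff_exists_int]
      exact ⟨-j, by push_cast; ring⟩
    rw [h3]; simp

theorem tendsto_invFourier {f : ℝ → ℝ → ℂ}
    (hf : ContinuousOn (Function.uncurry f) (Set.Ico 0 1 ×ˢ Set.univ)) (j : ℤ) :
    Tendsto (fun δ => invFourier (f δ) j) (𝓝[>] 0) (𝓝 (invFourier (f 0) j)) := by
  -- Clamping δ to [0, 1/2] produces a globally continuous integrand that agrees with f for small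
  -- positive δ and at 0.
  set c : ℝ → ℝ := fun δ => max 0 (min δ (1 / 2)) with hc
  have hcont : Continuous fun q : ℝ × ℝ => f (c q.1) q.2 := by
    refine ContinuousOn.comp_continuous (f := fun q : ℝ × ℝ => (c q.1, q.2)) hf ?_ ?_
    · fun_prop
    · intro q
      refine ⟨⟨le_max_left _ _, ?_⟩, trivial⟩
      exact max_lt (by norm_num) ((min_le_right _ _).trans_lt (by norm_num))
  have hI : Continuous fun δ => invFourier (f (c δ)) j := by
    refine continuous_const.mul ?_
    refine intervalIntegral.continuous_parametric_intervalIntegral_of_continuous' ?_ _ _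
    refine hcont.mul ?_
    fun_prop
  have h := (hI.tendsto 0).mono_left (nhdsWithin_le_nhds (s := Set.Ioi 0))
  have h0 : c 0 = 0 := by simp [hc]
  rw [h0] at h
  refine h.congr' ?_
  filter_upwards [Ioo_mem_nhdsGT (show (0 : ℝ) < 1 / 2 by norm_num)] with δ hδ
  have : c δ = δ := by simp only [hc]; rw [min_eq_left hδ.2.le, max_eq_right hδ.1.le]
  rw [this]

/-! ### Spectrum of the transfer matrix. -/

/-- Half the trace of the transfer matrix at momentum `p`. -/
noncomputable def halfTrace (μ δ p : ℝ) : ℂ :=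
  ((Real.cos p : ℝ) + Complex.I * μ * δ) / (stepNorm μ δ : ℝ)

/-- The square root of `1 - halfTrace ^ 2` with positive real part. -/
noncomputable def sineRoot (μ δ p : ℝ) : ℂ := (1 - halfTrace μ δ p ^ 2) ^ (((2 : ℕ) : ℂ)⁻¹)

/-- The eigenvalue of the transfer matrix of modulus less than one. -/
noncomputable def smallEigenvalue (μ δ p : ℝ) : ℂ := halfTrace μ δ p - Complex.I * sineRoot μ δ p

theorem continuousOn_stepNorm (μ : ℝ) :
    Continuous (fun q : ℝ × ℝ => stepNorm μ q.1) := by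
  unfold stepNorm; fun_prop

theorem sq_lt_one_of_mem {δ : ℝ} (hδ : δ ∈ Set.Ico (0 : ℝ) 1) : δ ^ 2 < 1 := by
  nlinarith [hδ.1, hδ.2]

theorem stepNorm_ne_zero {μ δ : ℝ} (hδ : δ ∈ Set.Ico (0 : ℝ) 1) : (stepNorm μ δ : ℂ) ≠ 0 := by
  exact_mod_cast (stepNorm_pos (sq_lt_one_of_mem hδ)).ne'

theorem continuousOn_halfTrace (μ : ℝ) :
    ContinuousOn (fun q : ℝ × ℝ => halfTrace μ q.1 q.2) (Set.Ico 0 1 ×ˢ Set.univ) := by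
  unfold halfTrace
  refine ContinuousOn.div (by fun_prop) ?_ fun q hq => stepNorm_ne_zero hq.1
  exact (Complex.continuous_ofReal.comp (continuousOn_stepNorm μ)).continuousOn

theorem halfTrace_re (μ δ p : ℝ) : (halfTrace μ δ p).re = Real.cos p / stepNorm μ δ := by
  simp [halfTrace, Complex.div_ofReal_re, -Complex.ofReal_cos]

theorem halfTrace_im (μ δ p : ℝ) : (halfTrace μ δ p).im = μ * δ / stepNorm μ δ := by
  simp [halfTrace, Complex.div_ofReal_im, -Complex.ofReal_cos]

/-- Keeps the principal square root continuous, including at δ = 0. If δ > 0 and cos p ≠ 0 the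
imaginary part is nonzero; otherwise the number is a positive real, which for δ = 0 uses μ > 0. -/
theorem one_sub_halfTrace_sq_mem_slitPlane {μ δ : ℝ} (hμ : 0 < μ) (hδ : δ ∈ Set.Ico (0 : ℝ) 1)
    (p : ℝ) : 1 - halfTrace μ δ p ^ 2 ∈ Complex.slitPlane := by
  have hN := stepNorm_pos (μ := μ) (sq_lt_one_of_mem hδ)
  have hre : (1 - halfTrace μ δ p ^ 2).re =
      1 - (Real.cos p / stepNorm μ δ) ^ 2 + (μ * δ / stepNorm μ δ) ^ 2 := by
    rw [← halfTrace_re, ← halfTrace_im]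
    simp [sq]
    ring
  have him : (1 - halfTrace μ δ p ^ 2).im =
      -2 * (Real.cos p / stepNorm μ δ) * (μ * δ / stepNorm μ δ) := by
    rw [← halfTrace_re, ← halfTrace_im]
    simp [sq]
    ring
  rw [Complex.mem_slitPlane_iff, hre, him]
  by_cases hc : Real.cos p = 0
  · left
    rw [hc, zero_div]
    linarith [sq_nonneg (μ * δ / stepNorm μ δ)]
  · rcases hδ.1.eq_or_lt with h | h
    · left
      subst h
      have hN2 := stepNorm_sq (μ := μ) (δ := 0) (by norm_num)
      have : (Real.cos p / stepNorm μ 0) ^ 2 < 1 := by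
        rw [div_pow, div_lt_one (by exact pow_pos hN 2), hN2]
        nlinarith [Real.cos_sq_add_sin_sq p, sq_nonneg (Real.sin p), sq_pos_of_pos hμ]
      simp only [mul_zero, zero_div]
      linarith
    · right
      have : μ * δ / stepNorm μ δ ≠ 0 := by positivity
      have : Real.cos p / stepNorm μ δ ≠ 0 := div_ne_zero hc hN.ne'
      simp_all

theorem sineRoot_sq (μ δ p : ℝ) : sineRoot μ δ p ^ 2 = 1 - halfTrace μ δ p ^ 2 :=
  Complex.cpow_nat_inv_pow _ two_ne_zero

theorem sineRoot_re_pos {μ δ : ℝ} (hμ : 0 < μ) (hδ : δ ∈ Set.Ico (0 : ℝ) 1) (p : ℝ) :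
    0 < (sineRoot μ δ p).re := by
  have h := one_sub_halfTrace_sq_mem_slitPlane hμ hδ p
  have h0 := Complex.slitPlane_ne_zero h
  have harg := Complex.mem_slitPlane_iff_arg.1 h
  rw [sineRoot, Complex.cpow_def_of_ne_zero h0, Complex.exp_re]
  refine mul_pos (Real.exp_pos _) (Real.cos_pos_of_mem_Ioo ?_)
  have him : (Complex.log (1 - halfTrace μ δ p ^ 2) * ((2 : ℕ) : ℂ)⁻¹).im =
      Complex.arg (1 - halfTrace μ δ p ^ 2) / 2 := by
    rw [show (((2 : ℕ) : ℂ)⁻¹) = (((2 : ℝ)⁻¹ : ℝ) : ℂ) by push_cast; rfl, Complex.im_mul_ofReal,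
      Complex.log_im]
    ring
  rw [him]
  have h1 := Complex.neg_pi_lt_arg (1 - halfTrace μ δ p ^ 2)
  have h2 := lt_of_le_of_ne (Complex.arg_le_pi (1 - halfTrace μ δ p ^ 2)) harg.1
  constructor <;> linarith

theorem sineRoot_ne_zero {μ δ : ℝ} (hμ : 0 < μ) (hδ : δ ∈ Set.Ico (0 : ℝ) 1) (p : ℝ) :
    sineRoot μ δ p ≠ 0 := fun h => by
  have := sineRoot_re_pos hμ hδ p
  rw [h] at this; simp at this

theorem continuousOn_sineRoot {μ : ℝ} (hμ : 0 < μ) :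
    ContinuousOn (fun q : ℝ × ℝ => sineRoot μ q.1 q.2) (Set.Ico 0 1 ×ˢ Set.univ) := by
  unfold sineRoot
  exact (continuousOn_const.sub ((continuousOn_halfTrace μ).pow 2)).cpow_const
    fun q hq => one_sub_halfTrace_sq_mem_slitPlane hμ hq.1 q.2

theorem continuousOn_smallEigenvalue {μ : ℝ} (hμ : 0 < μ) :
    ContinuousOn (fun q : ℝ × ℝ => smallEigenvalue μ q.1 q.2) (Set.Ico 0 1 ×ˢ Set.univ) :=
  (continuousOn_halfTrace μ).sub (continuousOn_const.mul (continuousOn_sineRoot hμ))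

/-- The eigenvalues C ± iR have product 1, so it suffices that C - iR is strictly the smaller in
modulus. The squared moduli differ by 4(Im C Re R - Re C Im R), whose sign is that of Im C > 0. -/
theorem norm_smallEigenvalue_lt_one {μ δ : ℝ} (hμ : 0 < μ) (hδ : δ ∈ Set.Ioo (0 : ℝ) 1) (p : ℝ) :
    ‖smallEigenvalue μ δ p‖ < 1 := by
  have hδ' := Set.Ioo_subset_Ico_self hδ
  have hN := stepNorm_pos (μ := μ) (sq_lt_one_of_mem hδ')
  have hR := sineRoot_re_pos hμ hδ' p
  have hC : 0 < (halfTrace μ δ p).im := by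
    rw [halfTrace_im]; exact div_pos (mul_pos hμ hδ.1) hN
  have hsq := sineRoot_sq μ δ p
  set C := halfTrace μ δ p
  set R := sineRoot μ δ p
  have hprod : (C - Complex.I * R) * (C + Complex.I * R) = 1 := by
    linear_combination hsq - R ^ 2 * Complex.I_sq
  have him : 2 * R.re * R.im = -2 * C.re * C.im := by
    have := congrArg Complex.im hsq
    simp [sq] at this
    linarith
  have hlt : ‖C - Complex.I * R‖ ^ 2 < ‖C + Complex.I * R‖ ^ 2 := by
    rw [Complex.sq_norm, Complex.sq_norm, Complex.normSq_apply, Complex.normSq_apply]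
    simp only [Complex.sub_re, Complex.sub_im, Complex.add_re, Complex.add_im, Complex.mul_re,
      Complex.mul_im, Complex.I_re, Complex.I_im]
    have : 0 < R.re * (C.im * R.re - C.re * R.im) := by
      have : R.re * (C.im * R.re - C.re * R.im) = C.im * (R.re ^ 2 + C.re ^ 2) := by
        linear_combination (-C.re / 2) * him
      rw [this]; positivity
    have := pos_of_mul_pos_right this hR.le
    nlinarith
  have h1 : ‖C - Complex.I * R‖ * ‖C + Complex.I * R‖ = 1 := by
    rw [← norm_mul, hprod, norm_one]
  have h2 := lt_of_pow_lt_pow_left₀ 2 (norm_nonneg _) hlt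
  change ‖C - Complex.I * R‖ < 1
  nlinarith [norm_nonneg (C - Complex.I * R)]

theorem smallEigenvalue_sq (μ δ p : ℝ) :
    smallEigenvalue μ δ p ^ 2 = 2 * halfTrace μ δ p * smallEigenvalue μ δ p - 1 := by
  have h := sineRoot_sq μ δ p
  have hI := Complex.I_sq
  unfold smallEigenvalue
  linear_combination (sineRoot μ δ p ^ 2) * hI - h

/-! ### Fourier symbols and existence of the regularized propagator. -/

/-- The Fourier transform of the first component of the regularized propagator in the space
variable. -/
noncomputable def symbol₁ (μ δ : ℝ) (l : ℤ) (p : ℝ) : ℂ :=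
  Complex.I * smallEigenvalue μ δ p ^ l.natAbs * (μ - Complex.I * δ * Complex.exp (Complex.I * p))
    / ((stepNorm μ δ : ℝ) * sineRoot μ δ p)

/-- The Fourier transform of the second component of the regularized propagator in the space
variable. -/
noncomputable def symbol₂ (μ δ : ℝ) (l : ℤ) (p : ℝ) : ℂ :=
  smallEigenvalue μ δ p ^ l.natAbs *
    ((Real.sin p : ℝ) / ((stepNorm μ δ : ℝ) * sineRoot μ δ p) + if 0 ≤ l then 1 else -1)

theorem continuousOn_symbol₁ {μ : ℝ} (hμ : 0 < μ) (l : ℤ) :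
    ContinuousOn (fun q : ℝ × ℝ => symbol₁ μ q.1 l q.2) (Set.Ico 0 1 ×ˢ Set.univ) := by
  unfold symbol₁
  refine ContinuousOn.div ?_ ?_ fun q hq =>
    mul_ne_zero (stepNorm_ne_zero hq.1) (sineRoot_ne_zero hμ hq.1 _)
  · exact (continuousOn_const.mul ((continuousOn_smallEigenvalue hμ).pow _)).mul (by fun_prop)
  · exact (Complex.continuous_ofReal.comp (continuousOn_stepNorm μ)).continuousOn.mul
      (continuousOn_sineRoot hμ)

theorem continuousOn_symbol₂ {μ : ℝ} (hμ : 0 < μ) (l : ℤ) :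
    ContinuousOn (fun q : ℝ × ℝ => symbol₂ μ q.1 l q.2) (Set.Ico 0 1 ×ˢ Set.univ) := by
  unfold symbol₂
  refine ((continuousOn_smallEigenvalue hμ).pow _).mul (ContinuousOn.add ?_ continuousOn_const)
  refine ContinuousOn.div (by fun_prop) ?_ fun q hq =>
    mul_ne_zero (stepNorm_ne_zero hq.1) (sineRoot_ne_zero hμ hq.1 _)
  exact (Complex.continuous_ofReal.comp (continuousOn_stepNorm μ)).continuousOn.mul
    (continuousOn_sineRoot hμ)

theorem continuous_slice {E : Type*} [TopologicalSpace E] {f : ℝ → ℝ → E}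
    (hf : ContinuousOn (fun q : ℝ × ℝ => f q.1 q.2) (Set.Ico 0 1 ×ˢ Set.univ)) {δ : ℝ}
    (hδ : δ ∈ Set.Ico (0 : ℝ) 1) : Continuous (f δ) :=
  hf.comp_continuous (f := fun p : ℝ => (δ, p)) (by fun_prop) fun _ => ⟨hδ, trivial⟩

theorem exp_I_mul_eq (p : ℝ) :
    Complex.exp (Complex.I * p) = (Real.cos p : ℝ) + Complex.I * (Real.sin p : ℝ) := by
  rw [mul_comm, Complex.exp_mul_I]; push_cast; ring

theorem exp_neg_I_mul_eq (p : ℝ) :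
    Complex.exp (-(Complex.I * p)) = (Real.cos p : ℝ) - Complex.I * (Real.sin p : ℝ) := by
  have := exp_I_mul_eq (-p)
  rw [Real.cos_neg, Real.sin_neg] at this
  push_cast at this ⊢
  rw [← mul_neg, this]; ring

theorem cos_sq_add_sin_sq_ofReal (p : ℝ) :
    ((Real.cos p : ℝ) : ℂ) ^ 2 + ((Real.sin p : ℝ) : ℂ) ^ 2 = 1 := by
  exact_mod_cast Real.cos_sq_add_sin_sq p

/-- For l ≥ 0 the vector of symbols is λ^l times an eigenvector of the transfer matrix for λ; for l
< 0 it is the same power law along an eigenvector for 1/λ. The two eigenvectors are scaled to differ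
by (0, 2), which is exactly the point source at time 0. -/
theorem symbol_recurrence {μ δ : ℝ} (hμ : 0 < μ) (hδ : δ ∈ Set.Ico (0 : ℝ) 1) (l : ℤ) (p : ℝ) :
    (stepNorm μ δ : ℂ) * symbol₁ μ δ (l + 1) p =
      Complex.exp (Complex.I * p) * symbol₁ μ δ l p + Complex.I * μ * δ * symbol₁ μ δ l p
        + μ * symbol₂ μ δ l p - Complex.I * δ * (Complex.exp (Complex.I * p) * symbol₂ μ δ l p) ∧
    (stepNorm μ δ : ℂ) * symbol₂ μ δ (l + 1) p =
      Complex.exp (-(Complex.I * p)) * symbol₂ μ δ l p + Complex.I * μ * δ * symbol₂ μ δ l p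
        + Complex.I * δ * (Complex.exp (-(Complex.I * p)) * symbol₁ μ δ l p)
        - μ * symbol₁ μ δ l p + stepNorm μ δ * (2 * (if l + 1 = 0 then 1 else 0)) := by
  have hN := stepNorm_ne_zero (μ := μ) hδ
  have hR := sineRoot_ne_zero hμ hδ p
  have hsq := sineRoot_sq μ δ p
  have hlam := smallEigenvalue_sq μ δ p
  have hlamdef : smallEigenvalue μ δ p = halfTrace μ δ p - Complex.I * sineRoot μ δ p := rfl
  have hN2 : (stepNorm μ δ : ℂ) ^ 2 = (1 + μ ^ 2) * (1 - δ ^ 2) := by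
    exact_mod_cast stepNorm_sq (μ := μ) (sq_lt_one_of_mem hδ)
  have hC : (stepNorm μ δ : ℂ) * halfTrace μ δ p = (Real.cos p : ℝ) + Complex.I * μ * δ := by
    rw [halfTrace]; field_simp
  have hcs := cos_sq_add_sin_sq_ofReal p
  have hI := Complex.I_sq
  simp only [symbol₁, symbol₂, exp_I_mul_eq, exp_neg_I_mul_eq]
  have hinv : smallEigenvalue μ δ p * (halfTrace μ δ p + Complex.I * sineRoot μ δ p) = 1 := by
    rw [hlamdef]; linear_combination hsq - sineRoot μ δ p ^ 2 * hI
  generalize halfTrace μ δ p = C at *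
  generalize sineRoot μ δ p = R at *
  generalize smallEigenvalue μ δ p = lam at *
  generalize ((Real.cos p : ℝ) : ℂ) = c at *
  generalize ((Real.sin p : ℝ) : ℂ) = s at *
  generalize (stepNorm μ δ : ℂ) = N at *
  have hNR : N ^ 2 * R ^ 2 = N ^ 2 - (c + Complex.I * μ * δ) ^ 2 := by
    rw [hsq, ← hC]; ring
  have hNl : N * lam = c + Complex.I * μ * δ - Complex.I * (N * R) := by
    rw [hlamdef]; linear_combination hC
  have hNl' : N * (C + Complex.I * R) = c + Complex.I * μ * δ + Complex.I * (N * R) := by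
    linear_combination hC
  -- Up to sign, this is the product of the off-diagonal entries of N times the transfer matrix; it
  -- is what the second row of the eigenvector equation needs.
  have hdet : (μ - Complex.I * δ * (c - Complex.I * s)) * (μ - Complex.I * δ * (c + Complex.I * s))
      = N ^ 2 * R ^ 2 - s ^ 2 := by
    rw [hNR, hN2]
    linear_combination (δ ^ 2 * c ^ 2 + μ ^ 2 * δ ^ 2 - δ ^ 2 * s ^ 2 * Complex.I ^ 2
      + δ ^ 2 * s ^ 2) * hI + (1 - δ ^ 2) * hcs
  rcases le_or_gt 0 l with hl | hl
  · have h1 : (l + 1).natAbs = l.natAbs + 1 := by omega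
    have h2 : ¬ (l + 1 = 0) := by omega
    have h3 : 0 ≤ l + 1 := by omega
    simp only [h1, h2, h3, hl, if_true, if_false, pow_succ]
    generalize lam ^ l.natAbs = L
    constructor
    · field_simp
      linear_combination
        (Complex.I * L * (μ - Complex.I * δ * (c + Complex.I * s))) * hNl
          - L * (μ - Complex.I * δ * (c + Complex.I * s)) * (s + N * R) * hI
    · field_simp
      linear_combination L * (s + N * R) * hNl + Complex.I * L * hdet
  · have h1 : l.natAbs = (l + 1).natAbs + 1 := by omega
    have h2 : ¬ 0 ≤ l := by omega
    -- The step from l = -1 to 0 crosses the sign change in `symbol₂`; the indicator is kept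
    -- symbolic so that all negative l are treated together.
    have h3 : (if 0 ≤ l + 1 then (1 : ℂ) else -1) = -1 + 2 * (if l + 1 = 0 then 1 else 0) := by
      split_ifs with h4 h5 h5
      · norm_num
      · omega
      · omega
      · norm_num
    have h4 : lam ^ (l + 1).natAbs * (if l + 1 = 0 then (1 : ℂ) else 0) =
        if l + 1 = 0 then (1 : ℂ) else 0 := by
      split_ifs with h4
      · rw [h4]; simp
      · simp
    simp only [h1, h2, h3, if_false, pow_succ]
    generalize lam ^ (l + 1).natAbs = L at *
    generalize (if l + 1 = 0 then (1 : ℂ) else 0) = z at *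
    constructor
    · field_simp
      linear_combination (-Complex.I * L * (μ - Complex.I * δ * (c + Complex.I * s)) * N) * hinv
        + (lam * L * (μ - Complex.I * δ * (c + Complex.I * s)) * Complex.I) * hNl'
        - (lam * L * (μ - Complex.I * δ * (c + Complex.I * s)) * (s - N * R)) * hI
    · field_simp
      linear_combination (-N * L * (s - N * R)) * hinv + lam * L * (s - N * R) * hNl'
        + Complex.I * lam * L * hdet + 2 * N ^ 2 * R * h4

/-- By compactness in p the maximum of |λ| is attained, hence is below 1. This fails at δ = 0, where
|λ| = 1. -/
theorem exists_symbol_bound {μ δ : ℝ} (hμ : 0 < μ) (hδ : δ ∈ Set.Ioo (0 : ℝ) 1) :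
    ∃ K r : ℝ, 0 ≤ r ∧ r < 1 ∧ ∀ l : ℤ, ∀ p ∈ Set.Icc (-Real.pi) Real.pi,
      ‖symbol₁ μ δ l p‖ ≤ K * r ^ l.natAbs ∧ ‖symbol₂ μ δ l p‖ ≤ K * r ^ l.natAbs := by
  have hδ' := Set.Ioo_subset_Ico_self hδ
  have hne : (Set.Icc (-Real.pi) Real.pi).Nonempty := ⟨0, by simp [Real.pi_pos.le]⟩
  have hlam := continuous_slice (continuousOn_smallEigenvalue hμ) hδ'
  have hR := continuous_slice (continuousOn_sineRoot hμ) hδ'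
  have hNR : ∀ p, (stepNorm μ δ : ℂ) * sineRoot μ δ p ≠ 0 := fun p =>
    mul_ne_zero (stepNorm_ne_zero hδ') (sineRoot_ne_zero hμ hδ' p)
  obtain ⟨p₀, -, hp₀⟩ := isCompact_Icc.exists_isMaxOn hne hlam.norm.continuousOn
  have hc₁ : Continuous fun p : ℝ => Complex.I *
      (μ - Complex.I * δ * Complex.exp (Complex.I * p)) / ((stepNorm μ δ : ℝ) * sineRoot μ δ p) :=
    Continuous.div (by fun_prop) (by fun_prop) hNR
  have hc₂ : Continuous fun p : ℝ =>
      ((Real.sin p : ℝ) : ℂ) / ((stepNorm μ δ : ℝ) * sineRoot μ δ p) :=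
    Continuous.div (by fun_prop) (by fun_prop) hNR
  obtain ⟨p₁, -, hp₁⟩ := isCompact_Icc.exists_isMaxOn hne hc₁.norm.continuousOn
  obtain ⟨p₂, -, hp₂⟩ := isCompact_Icc.exists_isMaxOn hne hc₂.norm.continuousOn
  set K₁ := ‖Complex.I * (μ - Complex.I * δ * Complex.exp (Complex.I * p₁)) /
    ((stepNorm μ δ : ℝ) * sineRoot μ δ p₁)‖
  set K₂ := ‖((Real.sin p₂ : ℝ) : ℂ) / ((stepNorm μ δ : ℝ) * sineRoot μ δ p₂)‖
  have hK₁ : 0 ≤ K₁ := norm_nonneg _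
  have hK₂ : 0 ≤ K₂ := norm_nonneg _
  refine ⟨K₁ + K₂ + 1, ‖smallEigenvalue μ δ p₀‖, norm_nonneg _,
    norm_smallEigenvalue_lt_one hμ hδ p₀, fun l p hp => ?_⟩
  have hpow : ‖smallEigenvalue μ δ p ^ l.natAbs‖ ≤ ‖smallEigenvalue μ δ p₀‖ ^ l.natAbs := by
    rw [norm_pow]
    exact pow_le_pow_left₀ (norm_nonneg _) (hp₀ hp) _
  constructor
  · have e : symbol₁ μ δ l p = (Complex.I * (μ - Complex.I * δ * Complex.exp (Complex.I * p)) /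
        ((stepNorm μ δ : ℝ) * sineRoot μ δ p)) * smallEigenvalue μ δ p ^ l.natAbs := by
      rw [symbol₁]; ring
    rw [e, norm_mul]
    have h : _ ≤ K₁ := hp₁ hp
    exact mul_le_mul (by linarith) hpow (norm_nonneg _) (by linarith)
  · rw [symbol₂, norm_mul, mul_comm]
    have h : _ ≤ K₂ := hp₂ hp
    refine mul_le_mul ?_ hpow (norm_nonneg _) (by linarith)
    refine (norm_add_le _ _).trans ?_
    have : ‖(if 0 ≤ l then (1 : ℂ) else -1)‖ = 1 := by split_ifs <;> simp
    linarith

/-- Shifts of j are multiplications by exp(±ip) under the integral, and the source is the inverse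
transform of a constant. -/
theorem evenRecurrence_invFourier {μ δ : ℝ} (hμ : 0 < μ) (hδ : δ ∈ Set.Ico (0 : ℝ) 1) :
    EvenRecurrence (stepNorm μ δ) μ δ pointSource (fun j l => invFourier (symbol₁ μ δ l) j)
      (fun j l => invFourier (symbol₂ μ δ l) j) := by
  have c₁ : ∀ l, Continuous (symbol₁ μ δ l) := fun l =>
    continuous_slice (f := fun δ p => symbol₁ μ δ l p) (continuousOn_symbol₁ hμ l) hδ
  have c₂ : ∀ l, Continuous (symbol₂ μ δ l) := fun l =>
    continuous_slice (f := fun δ p => symbol₂ μ δ l p) (continuousOn_symbol₂ hμ l) hδ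
  have hexp : Continuous fun p : ℝ => Complex.exp (Complex.I * p) := by fun_prop
  have hexp' : Continuous fun p : ℝ => Complex.exp (-(Complex.I * p)) := by fun_prop
  have e₁ : ∀ (f : ℝ → ℂ) (j : ℤ), invFourier (fun p => Complex.exp (Complex.I * p) * f p) j =
      invFourier f (j + 1) := fun f j => by
    simpa using invFourier_exp_mul 1 f j
  have e₂ : ∀ (f : ℝ → ℂ) (j : ℤ), invFourier (fun p => Complex.exp (-(Complex.I * p)) * f p) j =
      invFourier f (j - 1) := fun f j => by
    simpa [sub_eq_add_neg] using invFourier_exp_mul (-1) f j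
  constructor
  · intro j l
    rw [← invFourier_mul_left, ← e₁, ← e₁, ← invFourier_mul_left, ← invFourier_mul_left,
      ← invFourier_mul_left, sub_eq_add_neg, neg_eq_neg_one_mul, ← invFourier_mul_left,
      ← invFourier_add, ← invFourier_add, ← invFourier_add]
    · congr 1
      funext p
      rw [(symbol_recurrence hμ hδ l p).1]
      ring
    all_goals fun_prop
  · intro j l
    have hs : pointSource j (l + 1) =
        invFourier (fun _ => (2 * (if l + 1 = 0 then 1 else 0)) * 1) j := by
      rw [invFourier_mul_left, invFourier_one, pointSource]; ring
    rw [hs, ← invFourier_mul_left, ← e₂, ← e₂, ← invFourier_mul_left, ← invFourier_mul_left,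
      ← invFourier_mul_left, ← invFourier_mul_left, sub_eq_add_neg, neg_eq_neg_one_mul,
      ← invFourier_mul_left,
      ← invFourier_add, ← invFourier_add, ← invFourier_add, ← invFourier_add]
    · congr 1
      funext p
      rw [(symbol_recurrence hμ hδ l p).2]
      ring
    all_goals fun_prop

theorem isRegularizedPropagator_invFourier {m ε δ : ℝ} (hm : 0 < m) (hε : 0 < ε)
    (hδ : δ ∈ Set.Ioo (0 : ℝ) 1) :
    IsRegularizedPropagator m ε δ (extendEven δ (fun j l => invFourier (symbol₁ (m * ε) δ l) j)
      (fun j l => invFourier (symbol₂ (m * ε) δ l) j)) := by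
  have hμ := mul_pos hm hε
  have hδ' := Set.Ioo_subset_Ico_self hδ
  obtain ⟨K, r, hr0, hr1, hb⟩ := exists_symbol_bound hμ hδ
  exact isRegularizedPropagator_extendEven (sq_lt_one_of_mem hδ')
    (evenRecurrence_invFourier hμ hδ')
    (summable_sq_invFourier (fun l =>
      continuous_slice (f := fun δ p => symbol₁ (m * ε) δ l p) (continuousOn_symbol₁ hμ l) hδ')
      hr0 hr1 fun l p hp => (hb l p hp).1)
    (summable_sq_invFourier (fun l =>
      continuous_slice (f := fun δ p => symbol₂ (m * ε) δ l p) (continuousOn_symbol₂ hμ l) hδ')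
      hr0 hr1 fun l p hp => (hb l p hp).2)

/-! ### Identification of the propagator and the limit δ ↘ 0. -/

theorem regularizedPropagator_eq {m ε δ : ℝ} (hm : 0 < m) (hε : 0 < ε)
    (hδ : δ ∈ Set.Ioo (0 : ℝ) 1) :
    regularizedPropagator m ε δ = extendEven δ (fun j l => invFourier (symbol₁ (m * ε) δ l) j)
      (fun j l => invFourier (symbol₂ (m * ε) δ l) j) :=
  IsRegularizedPropagator.unique hm hε hδ.1 hδ.2
    (Classical.epsilon_spec ⟨_, isRegularizedPropagator_invFourier hm hε hδ⟩)
    (isRegularizedPropagator_invFourier hm hε hδ)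

theorem tendsto_regularizedPropagator {m ε : ℝ} (hm : 0 < m) (hε : 0 < ε) (j l : ℤ) :
    Tendsto (fun δ => (regularizedPropagator m ε δ).1 (2 * j) (2 * l)) (𝓝[>] (0 : ℝ))
      (𝓝 (invFourier (symbol₁ (m * ε) 0 l) j)) ∧
    Tendsto (fun δ => (regularizedPropagator m ε δ).2 (2 * j) (2 * l)) (𝓝[>] (0 : ℝ))
      (𝓝 (invFourier (symbol₂ (m * ε) 0 l) j)) := by
  have hμ := mul_pos hm hε
  have hmem : Set.Ioo (0 : ℝ) 1 ∈ 𝓝[>] (0 : ℝ) := Ioo_mem_nhdsGT one_pos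
  constructor
  · refine (tendsto_invFourier (f := fun δ => symbol₁ (m * ε) δ l)
      (continuousOn_symbol₁ hμ l) j).congr' ?_
    filter_upwards [hmem] with δ hδ
    rw [regularizedPropagator_eq hm hε hδ, (extendEven_even _ _ _ _ _).1]
  · refine (tendsto_invFourier (f := fun δ => symbol₂ (m * ε) δ l)
      (continuousOn_symbol₂ hμ l) j).congr' ?_
    filter_upwards [hmem] with δ hδ
    rw [regularizedPropagator_eq hm hε hδ, (extendEven_even _ _ _ _ _).2]

theorem latticePropagator₁_eq {m ε : ℝ} (hm : 0 < m) (hε : 0 < ε) (j l : ℤ) :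
    latticePropagator₁ j l m ε = invFourier (symbol₁ (m * ε) 0 l) j :=
  (tendsto_regularizedPropagator hm hε j l).1.limUnder_eq

theorem latticePropagator₂_eq {m ε : ℝ} (hm : 0 < m) (hε : 0 < ε) (j l : ℤ) :
    latticePropagator₂ j l m ε = invFourier (symbol₂ (m * ε) 0 l) j :=
  (tendsto_regularizedPropagator hm hε j l).2.limUnder_eq

theorem wellDefined {m ε : ℝ} (hm : 0 < m) (hε : 0 < ε) : WellDefined m ε := by
  refine ⟨fun δ h0 h1 => ⟨_, isRegularizedPropagator_invFourier hm hε ⟨h0, h1⟩, fun B hB =>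
    hB.unique hm hε h0 h1 (isRegularizedPropagator_invFourier hm hε ⟨h0, h1⟩)⟩, fun j l => ?_⟩
  rw [latticePropagator₁_eq hm hε, latticePropagator₂_eq hm hε]
  exact tendsto_regularizedPropagator hm hε j l

/-! ### Incomplete Gaussian and Fresnel integrals. -/

/-- Two integrations by parts for the incomplete Gaussian integral. -/
theorem norm_integral_gaussian_add_le {b : ℂ} (hb : 0 ≤ b.re) (hb0 : b ≠ 0) {s T : ℝ} (hs : 0 < s)
    (hT : s ≤ T) :
    ‖(∫ x in s..T, Complex.exp (-b * x ^ 2)) +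
        Complex.exp (-b * s ^ 2) * (-1 / (2 * b * s) + 1 / (4 * b ^ 2 * s ^ 3)) -
        Complex.exp (-b * T ^ 2) * (-1 / (2 * b * T) + 1 / (4 * b ^ 2 * T ^ 3))‖ ≤
      1 / (4 * ‖b‖ ^ 2 * s ^ 3) := by
  have hpos : ∀ x ∈ Set.uIcc s T, 0 < x := fun x hx => by
    rw [Set.uIcc_of_le hT] at hx; exact hs.trans_le hx.1
  -- The first two terms of the asymptotic series serve as an approximate antiderivative; the defect
  -- 3/(4b²x⁴) has an elementary convergent integral.
  have hder : ∀ x ∈ Set.uIcc s T, HasDerivAt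
      (fun x : ℝ => Complex.exp (-b * x ^ 2) * (-1 / (2 * b * x) + 1 / (4 * b ^ 2 * x ^ 3)))
      (Complex.exp (-b * x ^ 2) * (1 - 3 / (4 * b ^ 2 * x ^ 4))) x := fun x hx => by
    have hx0 : (x : ℂ) ≠ 0 := by exact_mod_cast (hpos x hx).ne'
    have h1 : HasDerivAt (fun z : ℂ => Complex.exp (-b * z ^ 2) *
        (-1 / (2 * b * z) + 1 / (4 * b ^ 2 * z ^ 3)))
        (Complex.exp (-b * (x : ℂ) ^ 2) * (1 - 3 / (4 * b ^ 2 * (x : ℂ) ^ 4))) (x : ℂ) := by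
      have e1 := ((((hasDerivAt_id (x : ℂ)).pow 2).const_mul (-b))).cexp
      have e2 := (hasDerivAt_const (x : ℂ) (-1 : ℂ)).div ((hasDerivAt_id (x : ℂ)).const_mul (2 * b))
        (by simp [hb0, hx0])
      have e3 := (hasDerivAt_const (x : ℂ) (1 : ℂ)).div
        (((hasDerivAt_id (x : ℂ)).pow 3).const_mul (4 * b ^ 2)) (by simp [hb0, hx0])
      refine (e1.mul (e2.add e3)).congr_deriv ?_
      simp only [id, Pi.add_apply, Pi.div_apply, Pi.pow_apply]
      field_simp
      ring
    exact h1.comp_ofReal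
  have hcont : ContinuousOn
      (fun x : ℝ => Complex.exp (-b * x ^ 2) * (1 - 3 / (4 * b ^ 2 * x ^ 4))) (Set.uIcc s T) := by
    refine ContinuousOn.mul (by fun_prop) (continuousOn_const.sub (ContinuousOn.div (by fun_prop)
      (by fun_prop) fun x hx => ?_))
    have hx0 : (x : ℂ) ≠ 0 := by exact_mod_cast (hpos x hx).ne'
    simp [hb0, hx0]
  have hcont2 : ContinuousOn
      (fun x : ℝ => Complex.exp (-b * x ^ 2) * (3 / (4 * b ^ 2 * x ^ 4))) (Set.uIcc s T) := by
    refine ContinuousOn.mul (by fun_prop) (ContinuousOn.div (by fun_prop)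
      (by fun_prop) fun x hx => ?_)
    have hx0 : (x : ℂ) ≠ 0 := by exact_mod_cast (hpos x hx).ne'
    simp [hb0, hx0]
  have hFTC := intervalIntegral.integral_eq_sub_of_hasDerivAt hder hcont.intervalIntegrable
  have hsplit : (∫ x in s..T, Complex.exp (-b * x ^ 2)) =
      (∫ x in s..T, Complex.exp (-b * x ^ 2) * (1 - 3 / (4 * b ^ 2 * x ^ 4))) +
      ∫ x in s..T, Complex.exp (-b * x ^ 2) * (3 / (4 * b ^ 2 * x ^ 4)) := by
    rw [← intervalIntegral.integral_add hcont.intervalIntegrable hcont2.intervalIntegrable]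
    exact intervalIntegral.integral_congr fun x _ => by ring
  rw [hsplit, hFTC]
  have hderR : ∀ x ∈ Set.uIcc s T, HasDerivAt (fun x : ℝ => -(1 / (4 * ‖b‖ ^ 2)) * (x ^ 3)⁻¹)
      (3 / (4 * ‖b‖ ^ 2 * x ^ 4)) x := fun x hx => by
    have hx0 := (hpos x hx).ne'
    refine ((((hasDerivAt_id x).pow 3).inv (pow_ne_zero 3 hx0)).const_mul
      (-(1 / (4 * ‖b‖ ^ 2)))).congr_deriv ?_
    have : ‖b‖ ≠ 0 := norm_ne_zero_iff.2 hb0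
    simp only [id, Pi.pow_apply]
    field_simp
    push_cast
    ring
  have hcontR : ContinuousOn (fun x : ℝ => 3 / (4 * ‖b‖ ^ 2 * x ^ 4)) (Set.uIcc s T) := by
    refine ContinuousOn.div (by fun_prop) (by fun_prop) fun x hx => ?_
    have hx0 := (hpos x hx).ne'
    have : ‖b‖ ≠ 0 := norm_ne_zero_iff.2 hb0
    positivity
  have hbound : ‖∫ x in s..T, Complex.exp (-b * x ^ 2) * (3 / (4 * b ^ 2 * x ^ 4))‖ ≤
      ∫ x in s..T, 3 / (4 * ‖b‖ ^ 2 * x ^ 4) := by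
    refine intervalIntegral.norm_integral_le_of_norm_le hT (.of_forall fun x hx => ?_)
      hcontR.intervalIntegrable
    have hx0 : 0 < x := hs.trans hx.1
    rw [norm_mul, Complex.norm_exp]
    have h1 : (-b * (x : ℂ) ^ 2).re ≤ 0 := by
      rw [← Complex.ofReal_pow, Complex.re_mul_ofReal]
      simp only [Complex.neg_re]
      nlinarith [mul_nonneg hb (sq_nonneg x)]
    have h2 : ‖(3 : ℂ) / (4 * b ^ 2 * (x : ℂ) ^ 4)‖ = 3 / (4 * ‖b‖ ^ 2 * x ^ 4) := by
      simp [abs_of_pos hx0]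
    rw [h2]
    exact mul_le_of_le_one_left (by positivity) (Real.exp_le_one_iff.2 h1)
  rw [intervalIntegral.integral_eq_sub_of_hasDerivAt hderR hcontR.intervalIntegrable] at hbound
  have hfin : -(1 / (4 * ‖b‖ ^ 2)) * (T ^ 3)⁻¹ - -(1 / (4 * ‖b‖ ^ 2)) * (s ^ 3)⁻¹ ≤
      1 / (4 * ‖b‖ ^ 2 * s ^ 3) := by
    have h0 : 0 ≤ 1 / (4 * ‖b‖ ^ 2) * (T ^ 3)⁻¹ := by
      have := hs.trans_le hT
      positivity
    have : 1 / (4 * ‖b‖ ^ 2 * s ^ 3) = 1 / (4 * ‖b‖ ^ 2) * (s ^ 3)⁻¹ := by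
      rw [one_div, one_div, mul_inv]
    linarith
  refine le_trans (le_of_eq ?_) (hbound.trans hfin)
  congr 1
  ring

/-- Letting T → ∞ makes the terms at T vanish and brings in the complete Gaussian integral, which
needs Re b > 0. -/
theorem norm_gaussian_sub_integral_le {b : ℂ} (hb : 0 < b.re) {s : ℝ} (hs : 0 < s) :
    ‖(Real.pi / b) ^ (1 / 2 : ℂ) / 2 - (∫ x in (0)..s, Complex.exp (-b * x ^ 2)) +
        Complex.exp (-b * s ^ 2) * (-1 / (2 * b * s) + 1 / (4 * b ^ 2 * s ^ 3))‖ ≤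
      1 / (4 * ‖b‖ ^ 2 * s ^ 3) := by
  have hb0 : b ≠ 0 := fun h => by simp [h] at hb
  have hint := MeasureTheory.intervalIntegral_tendsto_integral_Ioi (0 : ℝ)
    (integrable_cexp_neg_mul_sq hb).integrableOn tendsto_id
  rw [integral_gaussian_complex_Ioi hb] at hint
  have hT : Tendsto (fun T : ℝ =>
      Complex.exp (-b * T ^ 2) * (-1 / (2 * b * T) + 1 / (4 * b ^ 2 * T ^ 3))) atTop (𝓝 0) := by
    have hinv : Tendsto (fun T : ℝ => ((T : ℂ))⁻¹) atTop (𝓝 0) := by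
      have := (Complex.continuous_ofReal.tendsto 0).comp (tendsto_inv_atTop_zero (𝕜 := ℝ))
      simpa [Function.comp_def] using this
    have h2 : Tendsto (fun T : ℝ => -1 / (2 * b * T) + 1 / (4 * b ^ 2 * T ^ 3)) atTop (𝓝 0) := by
      have := (hinv.const_mul (-1 / (2 * b))).add ((hinv.pow 3).const_mul (1 / (4 * b ^ 2)))
      simp only [mul_zero, ne_eq, OfNat.ofNat_ne_zero, not_false_eq_true, zero_pow, add_zero] at this
      refine this.congr fun T => ?_
      simp only [div_eq_mul_inv, mul_inv, inv_pow]
      ring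
    refine squeeze_zero_norm (fun T => ?_) (norm_zero (E := ℂ) ▸ h2.norm)
    rw [norm_mul, Complex.norm_exp]
    refine mul_le_of_le_one_left (norm_nonneg _) (Real.exp_le_one_iff.2 ?_)
    rw [← Complex.ofReal_pow, Complex.re_mul_ofReal]
    simp only [Complex.neg_re]
    nlinarith [mul_nonneg hb.le (sq_nonneg T)]
  have hlim := ((((hint.sub_const (∫ x in (0)..s, Complex.exp (-b * x ^ 2))).add_const
    (Complex.exp (-b * s ^ 2) * (-1 / (2 * b * s) + 1 / (4 * b ^ 2 * s ^ 3)))).sub hT)).norm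
  rw [sub_zero] at hlim
  refine le_of_tendsto hlim ?_
  filter_upwards [eventually_ge_atTop s] with T hsT
  refine le_trans (le_of_eq ?_) (norm_integral_gaussian_add_le hb.le hb0 hs hsT)
  have hc : Continuous fun x : ℝ => Complex.exp (-b * x ^ 2) := by fun_prop
  rw [id, ← intervalIntegral.integral_add_adjacent_intervals (hc.intervalIntegrable 0 s)
    (hc.intervalIntegrable s T)]
  congr 1
  ring

theorem neg_I_cpow_half : (-Complex.I) ^ (1 / 2 : ℂ) = Complex.exp (-(Complex.I * (Real.pi / 4))) := by
  rw [Complex.cpow_def_of_ne_zero (by simp), Complex.log_neg_I]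
  congr 1
  ring

/-- The Fresnel integral up to two terms. -/
theorem norm_fresnel_sub_le {Λ s : ℝ} (hΛ : 0 < Λ) (hs : 0 < s) :
    ‖(∫ x in (0)..s, Complex.exp (-(Complex.I * Λ * (x ^ 2 / 2)))) -
        Real.sqrt (2 * Real.pi / Λ) / 2 * Complex.exp (-(Complex.I * (Real.pi / 4))) -
        Complex.I / Λ * Complex.exp (-(Complex.I * Λ * (s ^ 2 / 2))) / s‖ ≤
      2 / (Λ ^ 2 * s ^ 3) := by
  set b₀ : ℂ := Complex.I * Λ / 2 with hb₀
  have hΛc : (Λ : ℂ) ≠ 0 := by exact_mod_cast hΛ.ne'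
  have hsc : (s : ℂ) ≠ 0 := by exact_mod_cast hs.ne'
  have hb₀0 : b₀ ≠ 0 := by simp [hb₀, hΛc]
  have hnorm : ‖b₀‖ = Λ / 2 := by simp [hb₀, abs_of_pos hΛ]
  have hpib : (Real.pi : ℂ) / b₀ = ((2 * Real.pi / Λ : ℝ) : ℂ) * (-Complex.I) := by
    rw [hb₀]; push_cast; field_simp; rw [Complex.I_sq]; ring
  have hgauss : ((Real.pi : ℂ) / b₀) ^ (1 / 2 : ℂ) =
      Real.sqrt (2 * Real.pi / Λ) * Complex.exp (-(Complex.I * (Real.pi / 4))) := by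
    have h0 : 0 < 2 * Real.pi / Λ := by positivity
    have h0c : ((2 * Real.pi / Λ : ℝ) : ℂ) ≠ 0 := by exact_mod_cast h0.ne'
    rw [hpib, Complex.cpow_def_of_ne_zero (mul_ne_zero h0c (by simp)),
      Complex.log_ofReal_mul h0 (by simp), add_mul, Complex.exp_add, Complex.ofReal_log h0.le,
      ← Complex.cpow_def_of_ne_zero h0c, ← Complex.cpow_def_of_ne_zero (by simp), neg_I_cpow_half,
      Real.sqrt_eq_rpow, Complex.ofReal_cpow h0.le]
    push_cast
    rfl
  have hcont : ContinuousAt (fun b : ℂ => ((Real.pi : ℂ) / b) ^ (1 / 2 : ℂ)) b₀ := by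
    refine (ContinuousAt.div continuousAt_const continuousAt_id hb₀0).cpow continuousAt_const ?_
    change (Real.pi : ℂ) / b₀ ∈ _
    rw [hpib, Complex.mem_slitPlane_iff]
    right
    simp [Real.pi_ne_zero, hΛ.ne']
  have hF : Continuous fun b : ℂ => ∫ x in (0)..s, Complex.exp (-b * (x : ℂ) ^ 2) :=
    intervalIntegral.continuous_parametric_intervalIntegral_of_continuous' (by fun_prop) _ _
  have hH : ContinuousAt (fun b : ℂ =>
      Complex.exp (-b * s ^ 2) * (-1 / (2 * b * s) + 1 / (4 * b ^ 2 * s ^ 3))) b₀ := by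
    refine ContinuousAt.mul (by fun_prop) (ContinuousAt.add (ContinuousAt.div (by fun_prop)
      (by fun_prop) ?_) (ContinuousAt.div (by fun_prop) (by fun_prop) ?_)) <;>
    simp [hb₀0, hsc]
  have hR : ContinuousAt (fun b : ℂ => 1 / (4 * ‖b‖ ^ 2 * s ^ 3)) b₀ := by
    refine ContinuousAt.div (by fun_prop) (by fun_prop) ?_
    rw [hnorm]; positivity
  -- Here Re b₀ = 0, so the Gaussian bound does not apply directly. Every term in it is continuous
  -- in b at b₀, and the bound passes to the limit along b₀ + η with η ↘ 0.
  have hpath : Tendsto (fun η : ℝ => b₀ + η) (𝓝[>] 0) (𝓝 b₀) := by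
    have : Continuous fun η : ℝ => b₀ + (η : ℂ) := by fun_prop
    have := this.tendsto 0
    simp only [Complex.ofReal_zero, add_zero] at this
    exact this.mono_left nhdsWithin_le_nhds
  have hmain := le_of_tendsto_of_tendsto
    ((((hcont.tendsto.comp hpath).div_const 2).sub ((hF.tendsto b₀).comp hpath)).add
      (hH.tendsto.comp hpath)).norm (hR.tendsto.comp hpath) (by
      filter_upwards [self_mem_nhdsWithin] with η hη
      exact norm_gaussian_sub_integral_le (by simpa [hb₀] using hη) hs)
  rw [hgauss, hnorm] at hmain
  have e : ∀ x : ℝ, -b₀ * (x : ℂ) ^ 2 = -(Complex.I * Λ * (x ^ 2 / 2)) := fun x => by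
    rw [hb₀]; ring
  simp only [e] at hmain
  have hexp : ‖Complex.exp (-(Complex.I * Λ * (s ^ 2 / 2)))‖ = 1 := by
    rw [show -(Complex.I * Λ * ((s : ℂ) ^ 2 / 2)) = ((-(Λ * (s ^ 2 / 2)) : ℝ) : ℂ) * Complex.I by
      push_cast; ring, Complex.norm_exp_ofReal_mul_I]
  have hsplit : (∫ x in (0)..s, Complex.exp (-(Complex.I * Λ * (x ^ 2 / 2)))) -
        Real.sqrt (2 * Real.pi / Λ) / 2 * Complex.exp (-(Complex.I * (Real.pi / 4))) -
        Complex.I / Λ * Complex.exp (-(Complex.I * Λ * (s ^ 2 / 2))) / s =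
      -(Real.sqrt (2 * Real.pi / Λ) * Complex.exp (-(Complex.I * (Real.pi / 4))) / 2 -
        (∫ x in (0)..s, Complex.exp (-(Complex.I * Λ * (x ^ 2 / 2)))) +
        Complex.exp (-(Complex.I * Λ * (s ^ 2 / 2))) *
          (-1 / (2 * b₀ * s) + 1 / (4 * b₀ ^ 2 * s ^ 3))) +
      Complex.exp (-(Complex.I * Λ * (s ^ 2 / 2))) * (-1 / (Λ ^ 2 * s ^ 3)) := by
    generalize (∫ x in (0)..s, Complex.exp (-(Complex.I * Λ * (x ^ 2 / 2)))) = F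
    generalize Complex.exp (-(Complex.I * Λ * (s ^ 2 / 2))) = E
    rw [hb₀]
    field_simp
    rw [Complex.I_sq]
    ring
  rw [hsplit]
  refine (norm_add_le _ _).trans ?_
  rw [norm_neg, norm_mul, hexp, one_mul]
  -- The second asymptotic term is moved into the error; together with the Gaussian remainder this
  -- accounts for the constant 2.
  have h2 : ‖(-1 : ℂ) / (Λ ^ 2 * s ^ 3)‖ = 1 / (Λ ^ 2 * s ^ 3) := by
    simp [abs_of_pos hs]
  rw [h2]
  refine (add_le_add_left hmain _).trans (le_of_eq ?_)
  field_simp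
  norm_num

/-! ### Integration by parts for oscillatory integrals. -/

theorem abs_sub_le_of_hasDerivAt {f f' : ℝ → ℝ} {a b M : ℝ} (hab : a ≤ b)
    (hf : ∀ x ∈ Set.Icc a b, HasDerivAt f (f' x) x) (hM : ∀ x ∈ Set.Icc a b, |f' x| ≤ M) :
    |f b - f a| ≤ M * (b - a) := by
  have := (convex_Icc a b).norm_image_sub_le_of_norm_hasDerivWithin_le
    (fun x hx => (hf x hx).hasDerivWithinAt) hM (Set.left_mem_Icc.2 hab) (Set.right_mem_Icc.2 hab)
  rwa [Real.norm_eq_abs, Real.norm_eq_abs, abs_of_nonneg (sub_nonneg.2 hab)] at this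

theorem hasDerivAt_mul_cexp {g Ψ : ℝ → ℝ} {g' Ψ' x : ℝ} (hg : HasDerivAt g g' x)
    (hΨ : HasDerivAt Ψ Ψ' x) :
    HasDerivAt (fun x => (g x : ℂ) * Complex.exp (Complex.I * Ψ x))
      ((g' : ℂ) * Complex.exp (Complex.I * Ψ x) +
        Complex.I * (((g x * Ψ' : ℝ) : ℂ) * Complex.exp (Complex.I * Ψ x))) x := by
  refine (hg.ofReal_comp.mul (hΨ.ofReal_comp.const_mul Complex.I).cexp).congr_deriv ?_
  push_cast
  ring

theorem integral_mul_deriv_phase {a b : ℝ} {g g' Ψ Ψ' : ℝ → ℝ}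
    (hg : ∀ x ∈ Set.uIcc a b, HasDerivAt g (g' x) x)
    (hΨ : ∀ x ∈ Set.uIcc a b, HasDerivAt Ψ (Ψ' x) x)
    (hg' : ContinuousOn g' (Set.uIcc a b)) (hΨ' : ContinuousOn Ψ' (Set.uIcc a b)) :
    ∫ x in a..b, ((g x * Ψ' x : ℝ) : ℂ) * Complex.exp (Complex.I * Ψ x) =
      -Complex.I * (g b * Complex.exp (Complex.I * Ψ b) - g a * Complex.exp (Complex.I * Ψ a)) +
        Complex.I * ∫ x in a..b, (g' x : ℂ) * Complex.exp (Complex.I * Ψ x) := by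
  have hgc : ContinuousOn g (Set.uIcc a b) := fun x hx => (hg x hx).continuousAt.continuousWithinAt
  have hΨc : ContinuousOn Ψ (Set.uIcc a b) := fun x hx => (hΨ x hx).continuousAt.continuousWithinAt
  have hE : ContinuousOn (fun x => Complex.exp (Complex.I * Ψ x)) (Set.uIcc a b) :=
    (continuousOn_const.mul (Complex.continuous_ofReal.comp_continuousOn hΨc)).cexp
  have h1 : ContinuousOn (fun x => (g' x : ℂ) * Complex.exp (Complex.I * Ψ x)) (Set.uIcc a b) :=
    (Complex.continuous_ofReal.comp_continuousOn hg').mul hE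
  have h2 : ContinuousOn (fun x => ((g x * Ψ' x : ℝ) : ℂ) * Complex.exp (Complex.I * Ψ x))
      (Set.uIcc a b) :=
    (Complex.continuous_ofReal.comp_continuousOn (hgc.mul hΨ')).mul hE
  have h3 : ContinuousOn (fun x => Complex.I * (((g x * Ψ' x : ℝ) : ℂ) *
      Complex.exp (Complex.I * Ψ x))) (Set.uIcc a b) := continuousOn_const.mul h2
  have h := intervalIntegral.integral_eq_sub_of_hasDerivAt
    (fun x hx => hasDerivAt_mul_cexp (hg x hx) (hΨ x hx))
    (h1.intervalIntegrable.add h3.intervalIntegrable)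
  rw [intervalIntegral.integral_add h1.intervalIntegrable
    h3.intervalIntegrable, intervalIntegral.integral_const_mul] at h
  linear_combination (-Complex.I) * h + (∫ x in a..b, ((g x * Ψ' x : ℝ) : ℂ) *
    Complex.exp (Complex.I * Ψ x)) * Complex.I_sq

theorem norm_exp_I_mul (x : ℝ) : ‖Complex.exp (Complex.I * x)‖ = 1 := by
  rw [mul_comm, Complex.norm_exp_ofReal_mul_I]

/-- The first-derivative test for oscillatory integrals, with the variation of the amplitude
controlled by a majorant. -/
theorem norm_integral_mul_deriv_phase_le {a b : ℝ} (hab : a ≤ b) {g g' Ψ Ψ' β β' : ℝ → ℝ}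
    (hg : ∀ x ∈ Set.Icc a b, HasDerivAt g (g' x) x)
    (hΨ : ∀ x ∈ Set.Icc a b, HasDerivAt Ψ (Ψ' x) x)
    (hΨ' : ContinuousOn Ψ' (Set.Icc a b))
    (hβ : ∀ x ∈ Set.Icc a b, HasDerivAt β (β' x) x)
    (hle : ∀ x ∈ Set.Icc a b, |g' x| ≤ β' x) :
    ‖∫ x in a..b, ((g x * Ψ' x : ℝ) : ℂ) * Complex.exp (Complex.I * Ψ x)‖ ≤
      |g a| + |g b| + (β b - β a) := by
  have hgc : ContinuousOn g (Set.Icc a b) := fun x hx => (hg x hx).continuousAt.continuousWithinAt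
  have hΨc : ContinuousOn Ψ (Set.Icc a b) := fun x hx => (hΨ x hx).continuousAt.continuousWithinAt
  have hE : ContinuousOn (fun x => Complex.exp (Complex.I * Ψ x)) (Set.Icc a b) :=
    (continuousOn_const.mul (Complex.continuous_ofReal.comp_continuousOn hΨc)).cexp
  have h2 : ContinuousOn (fun x => ((g x * Ψ' x : ℝ) : ℂ) * Complex.exp (Complex.I * Ψ x))
      (Set.Icc a b) :=
    (Complex.continuous_ofReal.comp_continuousOn (hgc.mul hΨ')).mul hE
  have hint : ∀ x ∈ Set.Icc a b, IntervalIntegrable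
      (fun x => ((g x * Ψ' x : ℝ) : ℂ) * Complex.exp (Complex.I * Ψ x))
      MeasureTheory.volume a x := fun x hx =>
    (h2.mono (by rw [Set.uIcc_of_le hx.1]; exact Set.Icc_subset_Icc_right hx.2)).intervalIntegrable
  set J : ℝ → ℂ := fun y => ∫ x in a..y, ((g x * Ψ' x : ℝ) : ℂ) * Complex.exp (Complex.I * Ψ x)
    with hJ
  -- No integrability of g' is assumed. V is J with the boundary terms of a formal integration by
  -- parts removed; its derivative has modulus |g'| ≤ β', so a mean value inequality replaces the
  -- integral of |g'|.
  set V : ℝ → ℂ := fun y => J y + Complex.I * (g y * Complex.exp (Complex.I * Ψ y)) -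
    Complex.I * (g a * Complex.exp (Complex.I * Ψ a)) with hV
  have hJd : ∀ x ∈ Set.Icc a b, HasDerivWithinAt J
      (((g x * Ψ' x : ℝ) : ℂ) * Complex.exp (Complex.I * Ψ x)) (Set.Icc a b) x := fun x hx => by
    have : Fact (x ∈ Set.Icc a b) := ⟨hx⟩
    exact intervalIntegral.integral_hasDerivWithinAt_right (hint x hx)
      (h2.stronglyMeasurableAtFilter_nhdsWithin measurableSet_Icc x) (h2 x hx)
  have hVd : ∀ x ∈ Set.Icc a b, HasDerivWithinAt V
      (Complex.I * ((g' x : ℂ) * Complex.exp (Complex.I * Ψ x))) (Set.Icc a b) x := fun x hx => by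
    refine (((hJd x hx).add ((hasDerivAt_mul_cexp (hg x hx) (hΨ x hx)).hasDerivWithinAt.const_mul
      Complex.I)).sub_const _).congr_deriv ?_
    linear_combination (((g x * Ψ' x : ℝ) : ℂ) * Complex.exp (Complex.I * Ψ x)) * Complex.I_sq
  have hVa : V a = 0 := by simp [hV, hJ]
  have hmain : ‖V b‖ ≤ β b - β a := by
    refine image_norm_le_of_norm_deriv_right_le_deriv_boundary' (f := V) (a := a) (b := b)
      (f' := fun x => Complex.I * ((g' x : ℂ) * Complex.exp (Complex.I * Ψ x)))
      (B := fun x => β x - β a) (B' := β')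
      (fun x hx => (hVd x hx).continuousWithinAt) (fun x hx => ?_) (by simp [hVa])
      (fun x hx => ((hβ x hx).continuousAt.sub continuousAt_const).continuousWithinAt)
      (fun x hx => ((hβ x (Set.Ico_subset_Icc_self hx)).sub_const _).hasDerivWithinAt)
      (fun x hx => ?_) (Set.right_mem_Icc.2 hab)
    · exact (hVd x (Set.Ico_subset_Icc_self hx)).mono_of_mem_nhdsWithin
        (Icc_mem_nhdsGE_of_mem hx)
    · rw [norm_mul, norm_mul, norm_exp_I_mul, Complex.norm_I, one_mul, mul_one, Complex.norm_real]
      exact hle x (Set.Ico_subset_Icc_self hx)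
  have hdec : J b = V b - Complex.I * (g b * Complex.exp (Complex.I * Ψ b)) +
    Complex.I * (g a * Complex.exp (Complex.I * Ψ a)) := by simp only [hV]; ring
  change ‖J b‖ ≤ _
  rw [hdec]
  have n1 : ∀ y, ‖Complex.I * ((g y : ℂ) * Complex.exp (Complex.I * Ψ y))‖ = |g y| := fun y => by
    rw [norm_mul, norm_mul, norm_exp_I_mul, Complex.norm_I, one_mul, mul_one, Complex.norm_real,
      Real.norm_eq_abs]
  have := norm_add_le (V b - Complex.I * (g b * Complex.exp (Complex.I * Ψ b)))
    (Complex.I * (g a * Complex.exp (Complex.I * Ψ a)))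
  have := norm_sub_le (V b) (Complex.I * (g b * Complex.exp (Complex.I * Ψ b)))
  rw [n1] at *
  linarith

/-! ### Stationary phase: Taylor expansions and the Morse coordinate. -/

/-- A phase on `[0, r]` with a nondegenerate stationary point at `0`, in a coordinate `y` such that
its derivative is `y G(y)`. -/
structure StationaryPhase (r B : ℝ) (Φ G G₁ G₂ : ℝ → ℝ) : Prop where
  one_le : 1 ≤ B
  r_pos : 0 < r
  r_le : r ≤ 1
  zero : Φ 0 = 0
  phase : ∀ y ∈ Set.Icc 0 r, HasDerivAt Φ (y * G y) y
  fst : ∀ y ∈ Set.Icc 0 r, HasDerivAt G (G₁ y) y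
  snd : ∀ y ∈ Set.Icc 0 r, HasDerivAt G₁ (G₂ y) y
  lower : ∀ y ∈ Set.Icc 0 r, 1 / B ≤ G y
  upper : ∀ y ∈ Set.Icc 0 r, G y ≤ B
  upper₁ : ∀ y ∈ Set.Icc 0 r, |G₁ y| ≤ B
  upper₂ : ∀ y ∈ Set.Icc 0 r, |G₂ y| ≤ B

namespace StationaryPhase

variable {r B : ℝ} {Φ G G₁ G₂ : ℝ → ℝ}

theorem taylor_fst (h : StationaryPhase r B Φ G G₁ G₂) {y : ℝ} (hy : y ∈ Set.Icc 0 r) :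
    |G₁ y - G₁ 0| ≤ B * y := by
  have := abs_sub_le_of_hasDerivAt hy.1 (fun x hx => h.snd x ⟨hx.1, hx.2.trans hy.2⟩)
    (fun x hx => h.upper₂ x ⟨hx.1, hx.2.trans hy.2⟩)
  simpa using this

theorem taylor (h : StationaryPhase r B Φ G G₁ G₂) {y : ℝ} (hy : y ∈ Set.Icc 0 r) :
    |G y - G 0 - G₁ 0 * y| ≤ B * y ^ 2 := by
  have := abs_sub_le_of_hasDerivAt (f := fun x => G x - G₁ 0 * x) (f' := fun x => G₁ x - G₁ 0)
    (M := B * y) hy.1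
    (fun x hx => by
      exact ((h.fst x ⟨hx.1, hx.2.trans hy.2⟩).sub
        ((hasDerivAt_id x).const_mul (G₁ 0))).congr_deriv (by simp))
    (fun x hx => (h.taylor_fst ⟨hx.1, hx.2.trans hy.2⟩).trans
      (mul_le_mul_of_nonneg_left hx.2 (zero_le_one.trans h.one_le)))
  calc |G y - G 0 - G₁ 0 * y| = |G y - G₁ 0 * y - (G 0 - G₁ 0 * 0)| := by congr 1; ring
    _ ≤ B * y * (y - 0) := this
    _ = B * y ^ 2 := by ring

theorem taylor_phase (h : StationaryPhase r B Φ G G₁ G₂) {y : ℝ} (hy : y ∈ Set.Icc 0 r) :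
    |Φ y - G 0 * y ^ 2 / 2 - G₁ 0 * y ^ 3 / 3| ≤ B * y ^ 4 := by
  have hB := zero_le_one.trans h.one_le
  have := abs_sub_le_of_hasDerivAt (f := fun x => Φ x - G 0 * x ^ 2 / 2 - G₁ 0 * x ^ 3 / 3)
    (f' := fun x => x * (G x - G 0 - G₁ 0 * x)) (M := B * y ^ 3) hy.1
    (fun x hx => by
      refine (((h.phase x ⟨hx.1, hx.2.trans hy.2⟩).sub
        ((((hasDerivAt_id x).pow 2).const_mul (G 0)).div_const 2)).sub
        ((((hasDerivAt_id x).pow 3).const_mul (G₁ 0)).div_const 3)).congr_deriv ?_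
      simp only [id]; push_cast; ring)
    (fun x hx => by
      rw [abs_mul, abs_of_nonneg hx.1]
      have h1 := h.taylor ⟨hx.1, hx.2.trans hy.2⟩
      have h2 : x ^ 3 ≤ y ^ 3 := pow_le_pow_left₀ hx.1 hx.2 3
      calc x * |G x - G 0 - G₁ 0 * x| ≤ x * (B * x ^ 2) := mul_le_mul_of_nonneg_left h1 hx.1
        _ = B * x ^ 3 := by ring
        _ ≤ B * y ^ 3 := mul_le_mul_of_nonneg_left h2 hB)
  calc |Φ y - G 0 * y ^ 2 / 2 - G₁ 0 * y ^ 3 / 3|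
      = |Φ y - G 0 * y ^ 2 / 2 - G₁ 0 * y ^ 3 / 3 -
          (Φ 0 - G 0 * 0 ^ 2 / 2 - G₁ 0 * 0 ^ 3 / 3)| := by rw [h.zero]; congr 1; ring
    _ ≤ B * y ^ 3 * (y - 0) := this
    _ = B * y ^ 4 := by ring

theorem phase_bounds (h : StationaryPhase r B Φ G G₁ G₂) {y : ℝ} (hy : y ∈ Set.Icc 0 r) :
    y ^ 2 / (2 * B) ≤ Φ y ∧ Φ y ≤ B * y ^ 2 / 2 := by
  have hB : 0 < B := zero_lt_one.trans_le h.one_le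
  have mono : ∀ (f f' : ℝ → ℝ), (∀ x ∈ Set.Icc 0 r, HasDerivAt f (f' x) x) →
      (∀ x ∈ Set.Icc 0 r, 0 ≤ f' x) → f 0 ≤ f y := fun f f' hf hf' =>
    monotoneOn_of_deriv_nonneg (convex_Icc 0 r)
      (fun x hx => (hf x hx).continuousAt.continuousWithinAt)
      (fun x hx => (hf x (interior_subset hx)).differentiableAt.differentiableWithinAt)
      (fun x hx => by rw [(hf x (interior_subset hx)).deriv]; exact hf' x (interior_subset hx))
      (Set.left_mem_Icc.2 h.r_pos.le) hy hy.1
  constructor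
  · have := mono (fun x => Φ x - x ^ 2 / (2 * B)) (fun x => x * (G x - 1 / B))
      (fun x hx => by
        refine ((h.phase x hx).sub (((hasDerivAt_id x).pow 2).div_const (2 * B))).congr_deriv ?_
        simp only [id]; push_cast; field_simp)
      (fun x hx => mul_nonneg hx.1 (sub_nonneg.2 (h.lower x hx)))
    simp only [h.zero] at this
    norm_num at this
    linarith
  · have := mono (fun x => B * x ^ 2 / 2 - Φ x) (fun x => x * (B - G x))
      (fun x hx => by
        refine (((((hasDerivAt_id x).pow 2).const_mul B).div_const 2).sub
          (h.phase x hx)).congr_deriv ?_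
        simp only [id]; push_cast; ring)
      (fun x hx => mul_nonneg hx.1 (sub_nonneg.2 (h.upper x hx)))
    simp only [h.zero] at this
    norm_num at this
    linarith

end StationaryPhase

/-- The Morse coordinate `√(2Φ(y))` divided by `y`. -/
noncomputable def morseRatio (Φ : ℝ → ℝ) (y : ℝ) : ℝ := Real.sqrt (2 * Φ y) / y

namespace StationaryPhase

variable {r B : ℝ} {Φ G G₁ G₂ : ℝ → ℝ}

theorem mem_Icc {y : ℝ} (hy : y ∈ Set.Ioc 0 r) : y ∈ Set.Icc 0 r := Set.Ioc_subset_Icc_self hy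

theorem B_pos (h : StationaryPhase r B Φ G G₁ G₂) : 0 < B := zero_lt_one.trans_le h.one_le

theorem phase_pos (h : StationaryPhase r B Φ G G₁ G₂) {y : ℝ} (hy : y ∈ Set.Ioc 0 r) :
    0 < Φ y := by
  have := (h.phase_bounds (mem_Icc hy)).1
  have hB := h.B_pos
  have hy0 := hy.1
  have : 0 < y ^ 2 / (2 * B) := by positivity
  linarith

theorem morseRatio_sq (h : StationaryPhase r B Φ G G₁ G₂) {y : ℝ} (hy : y ∈ Set.Ioc 0 r) :
    morseRatio Φ y ^ 2 * y ^ 2 = 2 * Φ y := by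
  have hy0 := hy.1.ne'
  rw [morseRatio, div_pow, Real.sq_sqrt (by linarith [h.phase_pos hy])]
  field_simp

/-- Since B ≥ 1, the interval [1/B, B] is stable under square roots, so the same B serves for G,
√G(0) and the Morse ratio. -/
theorem mem_of_sq_mem {x : ℝ} (hB : 1 ≤ B) (hx : 0 ≤ x) (h1 : 1 / B ≤ x ^ 2) (h2 : x ^ 2 ≤ B) :
    1 / B ≤ x ∧ x ≤ B := by
  have hB0 : 0 < B := by linarith
  have h3 : 1 / B ≤ 1 := by rw [div_le_one hB0]; exact hB
  have h4 : 0 < 1 / B := by positivity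
  constructor
  · by_contra hlt
    push Not at hlt
    nlinarith
  · by_contra hlt
    push Not at hlt
    nlinarith

theorem sqrt_mem (h : StationaryPhase r B Φ G G₁ G₂) :
    1 / B ≤ Real.sqrt (G 0) ∧ Real.sqrt (G 0) ≤ B := by
  have h0 : (0 : ℝ) ∈ Set.Icc 0 r := ⟨le_rfl, h.r_pos.le⟩
  have hB := h.B_pos
  have hl := h.lower 0 h0
  have : 0 ≤ G 0 := le_trans (by positivity) hl
  refine mem_of_sq_mem h.one_le (Real.sqrt_nonneg _) ?_ ?_ <;> rw [Real.sq_sqrt this]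
  · exact hl
  · exact h.upper 0 h0

theorem sqrt_sq (h : StationaryPhase r B Φ G G₁ G₂) : Real.sqrt (G 0) ^ 2 = G 0 := by
  have hB := h.B_pos
  exact Real.sq_sqrt (le_trans (by positivity) (h.lower 0 ⟨le_rfl, h.r_pos.le⟩))

theorem morseRatio_mem (h : StationaryPhase r B Φ G G₁ G₂) {y : ℝ} (hy : y ∈ Set.Ioc 0 r) :
    1 / B ≤ morseRatio Φ y ∧ morseRatio Φ y ≤ B := by
  have hB := h.B_pos
  have hy0 := hy.1
  obtain ⟨h1, h2⟩ := h.phase_bounds (mem_Icc hy)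
  have hsq := h.morseRatio_sq hy
  refine mem_of_sq_mem h.one_le (div_nonneg (Real.sqrt_nonneg _) hy0.le) ?_ ?_
  · refine le_of_mul_le_mul_right ?_ (pow_pos hy0 2)
    rw [hsq]
    rw [show 1 / B * y ^ 2 = 2 * (y ^ 2 / (2 * B)) by field_simp]
    linarith
  · refine le_of_mul_le_mul_right ?_ (pow_pos hy0 2)
    rw [hsq]
    linarith

theorem hasDerivAt_radius (h : StationaryPhase r B Φ G G₁ G₂) {y : ℝ} (hy : y ∈ Set.Ioc 0 r) :
    HasDerivAt (fun y => Real.sqrt (2 * Φ y)) (G y / morseRatio Φ y) y := by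
  have hΦ := h.phase_pos hy
  refine (((h.phase y (mem_Icc hy)).const_mul 2).sqrt (by positivity)).congr_deriv ?_
  have : Real.sqrt (2 * Φ y) ≠ 0 := (Real.sqrt_pos.2 (by linarith)).ne'
  rw [morseRatio]
  field_simp

theorem hasDerivAt_morseRatio (h : StationaryPhase r B Φ G G₁ G₂) {y : ℝ} (hy : y ∈ Set.Ioc 0 r) :
    HasDerivAt (morseRatio Φ) ((G y - morseRatio Φ y ^ 2) / (y * morseRatio Φ y)) y := by
  have hy0 := hy.1.ne'
  refine ((h.hasDerivAt_radius hy).div (hasDerivAt_id y) hy0).congr_deriv ?_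
  have hσ : 0 < morseRatio Φ y := lt_of_lt_of_le (by have := h.B_pos; positivity)
    (h.morseRatio_mem hy).1
  have hs : Real.sqrt (2 * Φ y) = morseRatio Φ y * y := by rw [morseRatio]; field_simp
  simp only [id]
  rw [hs]
  field_simp

/-- Twice the cubic expansion of Φ, divided by y². -/
theorem morse_taylor (h : StationaryPhase r B Φ G G₁ G₂) {y : ℝ} (hy : y ∈ Set.Ioc 0 r) :
    |morseRatio Φ y ^ 2 - Real.sqrt (G 0) ^ 2 - 2 / 3 * G₁ 0 * y| ≤ 2 * B * y ^ 2 := by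
  have hy0 := hy.1
  have h1 := h.taylor_phase (mem_Icc hy)
  have hsq := h.morseRatio_sq hy
  rw [h.sqrt_sq]
  refine le_of_mul_le_mul_right ?_ (pow_pos hy0 2)
  rw [← abs_of_pos (pow_pos hy0 2), ← abs_mul, abs_of_pos (pow_pos hy0 2)]
  calc |(morseRatio Φ y ^ 2 - G 0 - 2 / 3 * G₁ 0 * y) * y ^ 2|
      = |2 * (Φ y - G 0 * y ^ 2 / 2 - G₁ 0 * y ^ 3 / 3)| := by
        congr 1; linear_combination hsq
    _ = 2 * |Φ y - G 0 * y ^ 2 / 2 - G₁ 0 * y ^ 3 / 3| := by rw [abs_mul, abs_two]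
    _ ≤ 2 * B * y ^ 2 * y ^ 2 := by linarith

/-- `|σ - c| = O(y)`. -/
theorem abs_morseRatio_sub_le (h : StationaryPhase r B Φ G G₁ G₂) {y : ℝ} (hy : y ∈ Set.Ioc 0 r) :
    |morseRatio Φ y - Real.sqrt (G 0)| ≤ 3 * B ^ 2 * y := by
  have hB := h.B_pos
  have hy1 : y ≤ 1 := hy.2.trans h.r_le
  have hy0 := hy.1
  obtain ⟨h1, h2⟩ := h.morseRatio_mem hy
  obtain ⟨h3, h4⟩ := h.sqrt_mem
  have ht := h.morse_taylor hy
  have ha := h.upper₁ 0 ⟨le_rfl, h.r_pos.le⟩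
  generalize morseRatio Φ y = σ at *
  generalize Real.sqrt (G 0) = c at *
  have hsum : 2 / B ≤ σ + c := by rw [show 2 / B = 1 / B + 1 / B by ring]; linarith
  have h5 : |σ ^ 2 - c ^ 2| ≤ 3 * B * y := by
    have e : σ ^ 2 - c ^ 2 = (σ ^ 2 - c ^ 2 - 2 / 3 * G₁ 0 * y) + 2 / 3 * (G₁ 0 * y) := by ring
    rw [e]
    refine (abs_add_le _ _).trans ?_
    rw [abs_mul, abs_mul, abs_of_pos hy0, abs_of_pos (by norm_num : (0 : ℝ) < 2 / 3)]
    have : B * y ^ 2 ≤ B * y := by nlinarith [mul_pos hB hy0]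
    have : |G₁ 0| * y ≤ B * y := mul_le_mul_of_nonneg_right ha hy0.le
    nlinarith [mul_pos hB hy0]
  have h6 : |σ - c| * (σ + c) ≤ 3 * B * y := by
    have hp : 0 < σ + c := lt_of_lt_of_le (by positivity) hsum
    rw [← abs_of_pos hp, ← abs_mul]
    rwa [show (σ - c) * (σ + c) = σ ^ 2 - c ^ 2 by ring]
  have h7 : |σ - c| * (2 / B) ≤ 3 * B * y :=
    (mul_le_mul_of_nonneg_left hsum (abs_nonneg _)).trans h6
  have h8 : |σ - c| ≤ 3 * B * y * (B / 2) := by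
    have := mul_le_mul_of_nonneg_right h7 (show 0 ≤ B / 2 by positivity)
    rwa [mul_assoc, show 2 / B * (B / 2) = 1 by field_simp, mul_one] at this
  nlinarith [mul_pos hy0 (pow_pos hB 2)]

/-- The linear terms cancel: G = c² + G₁(0)y + O(y²) and σ² = c² + (2/3)G₁(0)y + O(y²), so cG and σ³
both equal c³ + cG₁(0)y to first order. The quadratic vanishing makes the derivative of `1 / y - c /
s(y)` bounded. -/
theorem abs_cubic_le (h : StationaryPhase r B Φ G G₁ G₂) {y : ℝ} (hy : y ∈ Set.Ioc 0 r) :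
    |Real.sqrt (G 0) * G y - morseRatio Φ y ^ 3| ≤ 19 * B ^ 5 * y ^ 2 := by
  have hB := h.B_pos
  have hB1 := h.one_le
  have hy0 := hy.1
  obtain ⟨h1, h2⟩ := h.morseRatio_mem hy
  obtain ⟨h3, h4⟩ := h.sqrt_mem
  have ht := h.morse_taylor hy
  have hg := h.taylor (mem_Icc hy)
  rw [← h.sqrt_sq] at hg
  have hd := h.abs_morseRatio_sub_le hy
  generalize morseRatio Φ y = σ at *
  generalize Real.sqrt (G 0) = c at *
  have hBinv : 0 < 1 / B := by positivity
  have hc0 : 0 < c := by linarith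
  have hσ0 : 0 < σ := by linarith
  have e : c * G y - σ ^ 3 = -((σ - c) ^ 2 * (σ + c / 2)) +
      (-(3 / 2 * c * (σ ^ 2 - c ^ 2 - 2 / 3 * G₁ 0 * y)) + c * (G y - c ^ 2 - G₁ 0 * y)) := by ring
  rw [e]
  have b1 : |(σ - c) ^ 2 * (σ + c / 2)| ≤ (3 * B ^ 2 * y) ^ 2 * (B + B / 2) := by
    rw [abs_mul, abs_pow, abs_of_pos (by positivity : 0 < σ + c / 2)]
    gcongr
  have b2 : |3 / 2 * c * (σ ^ 2 - c ^ 2 - 2 / 3 * G₁ 0 * y)| ≤ 3 / 2 * B * (2 * B * y ^ 2) := by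
    rw [abs_mul, abs_of_pos (by positivity : 0 < 3 / 2 * c)]
    gcongr
  have b3 : |c * (G y - c ^ 2 - G₁ 0 * y)| ≤ B * (B * y ^ 2) := by
    rw [abs_mul, abs_of_pos hc0]
    gcongr
  refine (abs_add_le _ _).trans ?_
  rw [abs_neg]
  have := abs_add_le (-(3 / 2 * c * (σ ^ 2 - c ^ 2 - 2 / 3 * G₁ 0 * y)))
    (c * (G y - c ^ 2 - G₁ 0 * y))
  rw [abs_neg] at this
  have hB5 : B ^ 2 ≤ B ^ 5 := pow_le_pow_right₀ hB1 (by norm_num)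
  have := mul_le_mul_of_nonneg_right hB5 (sq_nonneg y)
  nlinarith [mul_pos (pow_pos hB 5) (pow_pos hy0 2)]

/-- The linear coefficients 1 and 2/3 leave 1/3. Since σ' = (G - σ²)/(yσ), this also bounds σ'. -/
theorem abs_sub_morseRatio_sq_le (h : StationaryPhase r B Φ G G₁ G₂) {y : ℝ}
    (hy : y ∈ Set.Ioc 0 r) :
    |G y - morseRatio Φ y ^ 2 - G₁ 0 / 3 * y| ≤ 3 * B * y ^ 2 := by
  have ht := h.morse_taylor hy
  have hg := h.taylor (mem_Icc hy)
  rw [← h.sqrt_sq] at hg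
  have := abs_sub (G y - Real.sqrt (G 0) ^ 2 - G₁ 0 * y)
    (morseRatio Φ y ^ 2 - Real.sqrt (G 0) ^ 2 - 2 / 3 * G₁ 0 * y)
  calc _ = |(G y - Real.sqrt (G 0) ^ 2 - G₁ 0 * y) -
        (morseRatio Φ y ^ 2 - Real.sqrt (G 0) ^ 2 - 2 / 3 * G₁ 0 * y)| := by congr 1; ring
    _ ≤ _ := by linarith

/-- The value at the stationary point of `1 / y - c / s(y)`. -/
theorem abs_morse_defect_le (h : StationaryPhase r B Φ G G₁ G₂) {y : ℝ} (hy : y ∈ Set.Ioc 0 r) :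
    |(morseRatio Φ y - Real.sqrt (G 0)) / (y * morseRatio Φ y) - G₁ 0 / (3 * G 0)| ≤
      3 * B ^ 8 * y := by
  have hB := h.B_pos
  have hB1 := h.one_le
  have hy0 := hy.1
  obtain ⟨h1, h2⟩ := h.morseRatio_mem hy
  obtain ⟨h3, h4⟩ := h.sqrt_mem
  have ht := h.morse_taylor hy
  have hd := h.abs_morseRatio_sub_le hy
  have ha := h.upper₁ 0 ⟨le_rfl, h.r_pos.le⟩
  have hc2 := h.sqrt_sq
  generalize morseRatio Φ y = σ at *
  generalize Real.sqrt (G 0) = c at *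
  rw [← hc2]
  have hBinv : 0 < 1 / B := by positivity
  have hc0 : 0 < c := by linarith
  have hσ0 : 0 < σ := by linarith
  -- The first summand is small because σ is close to c, the second by the expansion of σ².
  have e : (σ - c) / (y * σ) - G₁ 0 / (3 * c ^ 2) =
      -(G₁ 0 * (σ - c) * (σ + 2 * c)) * (1 / (3 * c ^ 2 * σ * (σ + c))) +
      (σ ^ 2 - c ^ 2 - 2 / 3 * G₁ 0 * y) / y * (1 / (σ * (σ + c))) := by
    field_simp
    ring
  have i1 : 1 / (3 * c ^ 2 * σ * (σ + c)) ≤ B ^ 4 / 6 := by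
    have : 1 / (3 * c ^ 2 * σ * (σ + c)) ≤ 1 / (3 * (1 / B) ^ 2 * (1 / B) * (1 / B + 1 / B)) := by
      gcongr
    refine this.trans (le_of_eq ?_)
    field_simp
    norm_num
  have i2 : 1 / (σ * (σ + c)) ≤ B ^ 2 / 2 := by
    have : 1 / (σ * (σ + c)) ≤ 1 / ((1 / B) * (1 / B + 1 / B)) := by gcongr
    refine this.trans (le_of_eq ?_)
    field_simp
    norm_num
  have b1 : |-(G₁ 0 * (σ - c) * (σ + 2 * c)) * (1 / (3 * c ^ 2 * σ * (σ + c)))| ≤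
      B * (3 * B ^ 2 * y) * (B + 2 * B) * (B ^ 4 / 6) := by
    rw [abs_mul, abs_neg, abs_mul, abs_mul, abs_of_pos (by positivity : 0 < σ + 2 * c),
      abs_of_pos (by positivity : 0 < 1 / (3 * c ^ 2 * σ * (σ + c)))]
    gcongr
  have b2 : |(σ ^ 2 - c ^ 2 - 2 / 3 * G₁ 0 * y) / y * (1 / (σ * (σ + c)))| ≤
      2 * B * y ^ 2 / y * (B ^ 2 / 2) := by
    rw [abs_mul, abs_div, abs_of_pos hy0, abs_of_pos (by positivity : 0 < 1 / (σ * (σ + c)))]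
    gcongr
  have e2 : 2 * B * y ^ 2 / y * (B ^ 2 / 2) = B ^ 3 * y := by field_simp
  rw [e]
  refine (abs_add_le _ _).trans ?_
  have hB8 : B ^ 3 ≤ B ^ 8 := pow_le_pow_right₀ hB1 (by norm_num)
  have := mul_le_mul_of_nonneg_right hB8 hy0.le
  nlinarith [mul_pos (pow_pos hB 8) hy0]

end StationaryPhase

/-- The quotient rule at the scales E ~ y², E' ~ y, D ≳ y³, D' ~ y²: both terms have size y⁻². E''
and D'' are copies of E' and D' that may be written in another form. -/
theorem abs_quotient_deriv_le {B y E E' D D' E'' D'' : ℝ} (hB1 : 1 ≤ B) (hy0 : 0 < y)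
    (hE : |E| ≤ 19 * B ^ 5 * y ^ 2) (hE' : |E'| ≤ 15 * B ^ 4 * y) (hD0 : 0 < D)
    (hDinv : 1 / D ≤ B ^ 4 / y ^ 3) (hD' : |D'| ≤ 16 * B ^ 5 * y ^ 2) (h₁ : E'' = E')
    (h₂ : D'' = D') : |(E'' * D - E * D'') / D ^ 2| ≤ 400 * B ^ 18 / y ^ 2 := by
  subst h₁ h₂
  have hB : 0 < B := by linarith
  have e : (E'' * D - E * D'') / D ^ 2 = E'' * (1 / D) - E * D'' * ((1 / D) * (1 / D)) := by
    field_simp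
  rw [e]
  have hDi0 : 0 < 1 / D := by positivity
  have b1 : |E'' * (1 / D)| ≤ 15 * B ^ 4 * y * (B ^ 4 / y ^ 3) := by
    rw [abs_mul, abs_of_pos hDi0]; gcongr
  have b2 : |E * D'' * ((1 / D) * (1 / D))| ≤
      19 * B ^ 5 * y ^ 2 * (16 * B ^ 5 * y ^ 2) * (B ^ 4 / y ^ 3 * (B ^ 4 / y ^ 3)) := by
    rw [abs_mul, abs_mul, abs_of_pos (mul_pos hDi0 hDi0)]; gcongr
  have e1 : 15 * B ^ 4 * y * (B ^ 4 / y ^ 3) = 15 * B ^ 8 / y ^ 2 := by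
    field_simp
  have e2 : 19 * B ^ 5 * y ^ 2 * (16 * B ^ 5 * y ^ 2) * (B ^ 4 / y ^ 3 * (B ^ 4 / y ^ 3)) =
      304 * B ^ 18 / y ^ 2 := by
    field_simp; norm_num
  refine (abs_sub _ _).trans ((add_le_add b1 b2).trans ?_)
  rw [e1, e2, ← add_div]
  gcongr
  have : B ^ 8 ≤ B ^ 18 := pow_le_pow_right₀ hB1 (by norm_num)
  nlinarith [pow_pos hB 18]

theorem abs_denom_deriv_le {B y σ dσ g g₁ : ℝ} (hB1 : 1 ≤ B) (hy0 : 0 < y) (hy1 : y ≤ 1)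
    (hσ0 : 0 < σ) (h2 : σ ≤ B) (hG0 : 0 < g) (hGu : g ≤ B) (hG1 : |g₁| ≤ B)
    (hdσb : |dσ| ≤ 4 * B ^ 2) :
    |(3 * y ^ 2 * σ ^ 3 + y ^ 3 * (3 * σ ^ 2 * dσ)) * g + y ^ 3 * σ ^ 3 * g₁| ≤
      16 * B ^ 5 * y ^ 2 := by
  have hB : 0 < B := by linarith
  have y3 : y ^ 3 ≤ y ^ 2 := pow_le_pow_of_le_one hy0.le hy1 (by norm_num)
  have b1 : |3 * y ^ 2 * σ ^ 3 * g| ≤ 3 * y ^ 2 * B ^ 3 * B := by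
    rw [abs_of_pos (by positivity)]; gcongr
  have b2 : |y ^ 3 * (3 * σ ^ 2 * dσ) * g| ≤ y ^ 2 * (3 * B ^ 2 * (4 * B ^ 2)) * B := by
    rw [abs_mul, abs_mul, abs_mul, abs_of_pos hG0, abs_of_pos (by positivity : 0 < y ^ 3),
      abs_of_pos (by positivity : 0 < 3 * σ ^ 2)]
    gcongr
  have b3 : |y ^ 3 * σ ^ 3 * g₁| ≤ y ^ 2 * B ^ 3 * B := by
    rw [abs_mul, abs_of_pos (by positivity : 0 < y ^ 3 * σ ^ 3)]
    gcongr
  have e : (3 * y ^ 2 * σ ^ 3 + y ^ 3 * (3 * σ ^ 2 * dσ)) * g + y ^ 3 * σ ^ 3 * g₁ =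
      3 * y ^ 2 * σ ^ 3 * g + y ^ 3 * (3 * σ ^ 2 * dσ) * g + y ^ 3 * σ ^ 3 * g₁ := by ring
  rw [e]
  refine (abs_add_three _ _ _).trans ?_
  have p4 : B ^ 4 * y ^ 2 ≤ B ^ 5 * y ^ 2 := by
    gcongr ?_ * y ^ 2; exact pow_le_pow_right₀ hB1 (by norm_num)
  nlinarith

namespace StationaryPhase

variable {r B : ℝ} {Φ G G₁ G₂ : ℝ → ℝ}

theorem morseRatio_pos (h : StationaryPhase r B Φ G G₁ G₂) {y : ℝ} (hy : y ∈ Set.Ioc 0 r) :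
    0 < morseRatio Φ y :=
  lt_of_lt_of_le (by have := h.B_pos; positivity) (h.morseRatio_mem hy).1

theorem G_pos (h : StationaryPhase r B Φ G G₁ G₂) {y : ℝ} (hy : y ∈ Set.Icc 0 r) : 0 < G y :=
  lt_of_lt_of_le (by have := h.B_pos; positivity) (h.lower y hy)

/-- The function `1 / y - c / s(y)`. -/
theorem hasDerivAt_defect (h : StationaryPhase r B Φ G G₁ G₂) {y : ℝ} (hy : y ∈ Set.Ioc 0 r) :
    HasDerivAt (fun y => (morseRatio Φ y - Real.sqrt (G 0)) / (y * morseRatio Φ y))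
      ((Real.sqrt (G 0) * G y - morseRatio Φ y ^ 3) / (y ^ 2 * morseRatio Φ y ^ 3)) y := by
  have hσ := (h.morseRatio_pos hy).ne'
  have hy0 := hy.1.ne'
  have hd := h.hasDerivAt_morseRatio hy
  refine ((hd.sub_const _).div ((hasDerivAt_id y).mul hd) (mul_ne_zero hy0 hσ)).congr_deriv ?_
  simp only [id, Pi.mul_apply]
  field_simp
  ring

/-- The derivative of the amplitude defect over `y G(y)`, contribution of the phase. -/
theorem hasDerivAt_quotient (h : StationaryPhase r B Φ G G₁ G₂) {y : ℝ} (hy : y ∈ Set.Ioc 0 r) :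
    ∃ d, HasDerivAt (fun y => (Real.sqrt (G 0) * G y - morseRatio Φ y ^ 3) /
      (y ^ 3 * morseRatio Φ y ^ 3 * G y)) d y ∧ |d| ≤ 400 * B ^ 18 / y ^ 2 := by
  have hB := h.B_pos
  have hB1 := h.one_le
  have hy1 : y ≤ 1 := hy.2.trans h.r_le
  have hy0 := hy.1
  have hσ0 := h.morseRatio_pos hy
  have hG0 := h.G_pos (mem_Icc hy)
  have hGl := h.lower y (mem_Icc hy)
  have hGu := h.upper y (mem_Icc hy)
  have hG1 := h.upper₁ y (mem_Icc hy)
  obtain ⟨h1, h2⟩ := h.morseRatio_mem hy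
  obtain ⟨h3, h4⟩ := h.sqrt_mem
  have hE := h.abs_cubic_le hy
  have hd := h.abs_morseRatio_sub_le hy
  have hdiff := h.abs_sub_morseRatio_sq_le hy
  have ha := h.upper₁ 0 ⟨le_rfl, h.r_pos.le⟩
  have ht1 := h.taylor_fst (mem_Icc hy)
  have hder := h.hasDerivAt_morseRatio hy
  have hGd := h.fst y (mem_Icc hy)
  set dσ := (G y - morseRatio Φ y ^ 2) / (y * morseRatio Φ y) with hdσ
  have hmain := ((hGd.const_mul (Real.sqrt (G 0))).sub (hder.pow 3)).div
    ((((hasDerivAt_id y).pow 3).mul (hder.pow 3)).mul hGd) (by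
      simp only [id, Pi.mul_apply, Pi.pow_apply]; positivity)
  refine ⟨_, hmain, ?_⟩
  simp only [id, Pi.mul_apply, Pi.pow_apply, Pi.sub_apply]
  generalize morseRatio Φ y = σ at *
  generalize Real.sqrt (G 0) = c at *
  have hBinv : 0 < 1 / B := by positivity
  have hc0 : 0 < c := by linarith
  have hdiff' : |G y - σ ^ 2| ≤ 4 * B * y := by
    have e : G y - σ ^ 2 = (G y - σ ^ 2 - G₁ 0 / 3 * y) + G₁ 0 / 3 * y := by ring
    rw [e]
    refine (abs_add_le _ _).trans ?_
    have : |G₁ 0 / 3 * y| ≤ B / 3 * y := by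
      rw [abs_mul, abs_div, abs_of_pos hy0, abs_of_pos (by norm_num : (0 : ℝ) < 3)]
      gcongr
    have : B * y ^ 2 ≤ B * y := by nlinarith [mul_pos hB hy0]
    nlinarith [mul_pos hB hy0]
  have hdσb : |dσ| ≤ 4 * B ^ 2 := by
    rw [hdσ, abs_div, abs_of_pos (by positivity : 0 < y * σ), div_le_iff₀ (by positivity)]
    refine hdiff'.trans ?_
    have : 4 * B ^ 2 * (y * (1 / B)) ≤ 4 * B ^ 2 * (y * σ) := by gcongr
    refine le_trans (le_of_eq ?_) this
    field_simp
  set E := c * G y - σ ^ 3 with hEdef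
  set E' := c * G₁ y - 3 * σ ^ 2 * dσ with hE'def
  have hE' : |E'| ≤ 15 * B ^ 4 * y := by
    -- Inserting yσσ' = G - σ² exposes the cancellation: 3σ(G - σ²)/y is σG₁(0) up to O(y), and
    -- cG₁(y) differs from it by O(y).
    have e : E' = c * (G₁ y - G₁ 0) - G₁ 0 * (σ - c) - 3 * σ * (G y - σ ^ 2 - G₁ 0 / 3 * y) / y := by
      rw [hE'def, hdσ]; field_simp; ring
    rw [e]
    have b1 : |c * (G₁ y - G₁ 0)| ≤ B * (B * y) := by
      rw [abs_mul, abs_of_pos hc0]; gcongr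
    have b2 : |G₁ 0 * (σ - c)| ≤ B * (3 * B ^ 2 * y) := by
      rw [abs_mul]; gcongr
    have b3 : |3 * σ * (G y - σ ^ 2 - G₁ 0 / 3 * y) / y| ≤ 3 * B * (3 * B * y ^ 2) / y := by
      rw [abs_div, abs_mul, abs_of_pos hy0, abs_of_pos (by positivity : 0 < 3 * σ)]
      gcongr
    have e3 : 3 * B * (3 * B * y ^ 2) / y = 9 * B ^ 2 * y := by field_simp; norm_num
    have := abs_sub (c * (G₁ y - G₁ 0) - G₁ 0 * (σ - c))
      (3 * σ * (G y - σ ^ 2 - G₁ 0 / 3 * y) / y)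
    have := abs_sub (c * (G₁ y - G₁ 0)) (G₁ 0 * (σ - c))
    have p2 : B ^ 2 * y ≤ B ^ 4 * y := by
      gcongr ?_ * y; exact pow_le_pow_right₀ hB1 (by norm_num)
    have p3 : B ^ 3 * y ≤ B ^ 4 * y := by
      gcongr ?_ * y; exact pow_le_pow_right₀ hB1 (by norm_num)
    nlinarith
  set D := y ^ 3 * σ ^ 3 * G y with hDdef
  set D' := (3 * y ^ 2 * σ ^ 3 + y ^ 3 * (3 * σ ^ 2 * dσ)) * G y + y ^ 3 * σ ^ 3 * G₁ y with hD'def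
  have hD0 : 0 < D := by positivity
  have hD : y ^ 3 / B ^ 4 ≤ D := by
    have : y ^ 3 * (1 / B) ^ 3 * (1 / B) ≤ D := by
      rw [hDdef]; gcongr
    refine le_trans (le_of_eq ?_) this
    field_simp
  have hDinv : 1 / D ≤ B ^ 4 / y ^ 3 := by
    rw [div_le_div_iff₀ hD0 (by positivity)]
    have := mul_le_mul_of_nonneg_left hD (show 0 ≤ B ^ 4 by positivity)
    rw [mul_div_cancel₀ _ (by positivity : B ^ 4 ≠ 0)] at this
    linarith
  have hD' : |D'| ≤ 16 * B ^ 5 * y ^ 2 :=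
    abs_denom_deriv_le hB1 hy0 hy1 hσ0 h2 hG0 hGu hG1 hdσb
  refine abs_quotient_deriv_le hB1 hy0 hE hE' hD0 hDinv hD' ?_ ?_
  · rw [hE'def]; norm_num
  · rw [hD'def]; norm_num

end StationaryPhase

/-! ### Comparison with the Fresnel integral and the stationary phase formula. -/

/-- The incomplete Fresnel integral. -/
noncomputable def fresnel (Λ s : ℝ) : ℂ :=
  ∫ x in (0)..s, Complex.exp (-(Complex.I * Λ * (x ^ 2 / 2)))

theorem hasDerivAt_fresnel (Λ s : ℝ) :
    HasDerivAt (fresnel Λ) (Complex.exp (-(Complex.I * Λ * (s ^ 2 / 2)))) s := by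
  have hc : Continuous fun x : ℝ => Complex.exp (-(Complex.I * Λ * ((x : ℂ) ^ 2 / 2))) := by
    fun_prop
  exact intervalIntegral.integral_hasDerivAt_right (hc.intervalIntegrable _ _)
    (hc.stronglyMeasurableAtFilter _ _)
    hc.continuousAt

namespace StationaryPhase

variable {r B : ℝ} {Φ G G₁ G₂ k k₁ k₂ : ℝ → ℝ}

theorem hasDerivAt_fresnel_radius (h : StationaryPhase r B Φ G G₁ G₂) (Λ : ℝ) {y : ℝ}
    (hy : y ∈ Set.Ioc 0 r) :
    HasDerivAt (fun y => fresnel Λ (Real.sqrt (2 * Φ y)))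
      (((G y / morseRatio Φ y : ℝ) : ℂ) * Complex.exp (Complex.I * ((-(Λ * Φ y) : ℝ) : ℂ))) y := by
  refine ((hasDerivAt_fresnel Λ _).scomp y (h.hasDerivAt_radius hy)).congr_deriv ?_
  rw [Complex.real_smul]
  congr 2
  have : ((Real.sqrt (2 * Φ y) : ℝ) : ℂ) ^ 2 = 2 * Φ y := by
    rw [← Complex.ofReal_pow, Real.sq_sqrt (by linarith [h.phase_pos hy])]; push_cast; ring
  rw [this]; push_cast; ring

theorem hasDerivAt_exp_phase (h : StationaryPhase r B Φ G G₁ G₂) (Λ : ℝ) {y : ℝ}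
    (hy : y ∈ Set.Icc 0 r) :
    HasDerivAt (fun y => Complex.exp (Complex.I * ((-(Λ * Φ y) : ℝ) : ℂ)))
      (-(Complex.I * Λ) * (((y * G y : ℝ) : ℂ) *
        Complex.exp (Complex.I * ((-(Λ * Φ y) : ℝ) : ℂ)))) y := by
  refine ((((h.phase y hy).const_mul Λ).neg.ofReal_comp.const_mul Complex.I).cexp).congr_deriv ?_
  simp only [Pi.neg_apply]
  push_cast; ring

/-- The part of the half-line integral over `[ρ, r]` with the leading terms removed. -/
theorem norm_outer_le (h : StationaryPhase r B Φ G G₁ G₂)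
    (hk : ∀ y ∈ Set.Icc 0 r, HasDerivAt k (k₁ y) y)
    (hk₁ : ∀ y ∈ Set.Icc 0 r, HasDerivAt k₁ (k₂ y) y)
    (hb₁ : ∀ y ∈ Set.Icc 0 r, |k₁ y| ≤ B) (hb₂ : ∀ y ∈ Set.Icc 0 r, |k₂ y| ≤ B)
    {Λ ρ : ℝ} (hρ : 0 < ρ) (hρr : ρ ≤ r) (hΛ : Λ * ρ ^ 2 = 1) {H : ℝ → ℝ} {h₀ : ℝ}
    (hH : ∀ y, H y = (morseRatio Φ y - Real.sqrt (G 0)) / (y * morseRatio Φ y) + k y)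
    (hHρ : |H ρ - h₀| ≤ 4 * B ^ 8 * ρ) :
    ‖(∫ y in ρ..r, (((H y - h₀) * (y * G y) : ℝ) : ℂ) *
        Complex.exp (Complex.I * ((-(Λ * Φ y) : ℝ) : ℂ))) -
      Complex.I / Λ * (((H r - h₀ : ℝ) : ℂ) * Complex.exp (Complex.I * ((-(Λ * Φ r) : ℝ) : ℂ)))‖ ≤
      450 * B ^ 18 * ρ ^ 3 := by
  have hB := h.B_pos
  have hB1 := h.one_le
  have hΛ0 : 0 < Λ := pos_of_mul_pos_left (hΛ ▸ one_pos) (sq_nonneg ρ)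
  have hΛc : (Λ : ℂ) ≠ 0 := by exact_mod_cast hΛ0.ne'
  have hΛinv : 1 / Λ = ρ ^ 2 := by field_simp; linarith
  have hmem : ∀ y ∈ Set.Icc ρ r, y ∈ Set.Ioc 0 r := fun y hy => ⟨hρ.trans_le hy.1, hy.2⟩
  have hu : Set.uIcc ρ r = Set.Icc ρ r := Set.uIcc_of_le hρr
  -- the derivative of `H` and its quotient by `y G`
  set E : ℝ → ℝ := fun y => Real.sqrt (G 0) * G y - morseRatio Φ y ^ 3 with hE
  set H' : ℝ → ℝ := fun y => E y / (y ^ 2 * morseRatio Φ y ^ 3) + k₁ y with hH'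
  have hHd : ∀ y ∈ Set.Icc ρ r, HasDerivAt (fun y => H y - h₀) (H' y) y := fun y hy => by
    have := ((h.hasDerivAt_defect (hmem y hy)).add (hk y (mem_Icc (hmem y hy)))).sub_const h₀
    refine this.congr_of_eventuallyEq (.of_forall fun z => ?_)
    simp only [hH, Pi.add_apply]
  have hGc : ContinuousOn G (Set.Icc ρ r) := fun y hy =>
    (h.fst y (mem_Icc (hmem y hy))).continuousAt.continuousWithinAt
  have hσc : ContinuousOn (morseRatio Φ) (Set.Icc ρ r) := fun y hy =>
    (h.hasDerivAt_morseRatio (hmem y hy)).continuousAt.continuousWithinAt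
  have hk1c : ContinuousOn k₁ (Set.Icc ρ r) := fun y hy =>
    (hk₁ y (mem_Icc (hmem y hy))).continuousAt.continuousWithinAt
  have hH'c : ContinuousOn H' (Set.Icc ρ r) := by
    refine ContinuousOn.add (ContinuousOn.div ?_ ?_ fun y hy => ?_) hk1c
    · exact (continuousOn_const.mul hGc).sub (hσc.pow 3)
    · exact (continuousOn_id.pow 2).mul (hσc.pow 3)
    · have := h.morseRatio_pos (hmem y hy)
      have := (hmem y hy).1
      positivity
  have hΨ : ∀ y ∈ Set.Icc ρ r, HasDerivAt (fun y => -(Λ * Φ y)) (-(Λ * (y * G y))) y := fun y hy =>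
    ((h.phase y (mem_Icc (hmem y hy))).const_mul Λ).neg
  have hΨc : ContinuousOn (fun y => -(Λ * (y * G y))) (Set.Icc ρ r) :=
    (continuousOn_const.mul (continuousOn_id.mul hGc)).neg
  have hparts := integral_mul_deriv_phase (a := ρ) (b := r) (g := fun y => H y - h₀) (g' := H')
    (Ψ := fun y => -(Λ * Φ y)) (by rwa [hu]) (by rwa [hu])
    (by rwa [hu]) (by rwa [hu] : ContinuousOn (fun y => -(Λ * (y * G y))) (Set.uIcc ρ r))
  -- the remaining integral
  set χ : ℝ → ℝ := fun y => E y / (y ^ 3 * morseRatio Φ y ^ 3 * G y) + k₁ y / (y * G y) with hχ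
  have hχd : ∀ y ∈ Set.Icc ρ r, ∃ d, HasDerivAt χ d y ∧ |d| ≤ 403 * B ^ 18 / y ^ 2 := fun y hy => by
    have hyI := mem_Icc (hmem y hy)
    have hy0 := (hmem y hy).1
    have hy1 : y ≤ 1 := hy.2.trans h.r_le
    have hG0 := h.G_pos hyI
    obtain ⟨d, hd, hdle⟩ := h.hasDerivAt_quotient (hmem y hy)
    have hkq := (hk₁ y hyI).div ((hasDerivAt_id y).mul (h.fst y hyI)) (mul_pos hy0 hG0).ne'
    refine ⟨_, hd.add hkq, (abs_add_le _ _).trans ?_⟩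
    simp only [id, Pi.mul_apply]
    have hGinv : 1 / G y ≤ B := by
      rw [div_le_iff₀ hG0]
      have := mul_le_mul_of_nonneg_left (h.lower y hyI) hB.le
      rwa [mul_one_div_cancel hB.ne'] at this
    have hGi0 : 0 < 1 / G y := by positivity
    have e : (k₂ y * (y * G y) - k₁ y * (1 * G y + y * G₁ y)) / (y * G y) ^ 2 =
        (k₂ y * (1 / G y) * y - k₁ y * (1 / G y) - k₁ y * G₁ y * (1 / G y * (1 / G y)) * y) /
          y ^ 2 := by
      field_simp
      ring
    have b1 : |k₂ y * (1 / G y) * y| ≤ B * B * 1 := by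
      rw [abs_mul, abs_mul, abs_of_pos hGi0, abs_of_pos hy0]
      have := hb₂ y hyI
      gcongr
    have b2 : |k₁ y * (1 / G y)| ≤ B * B := by
      rw [abs_mul, abs_of_pos hGi0]
      have := hb₁ y hyI
      gcongr
    have b3 : |k₁ y * G₁ y * (1 / G y * (1 / G y)) * y| ≤ B * B * (B * B) * 1 := by
      rw [abs_mul, abs_mul, abs_mul, abs_of_pos hy0, abs_of_pos (mul_pos hGi0 hGi0)]
      have := hb₁ y hyI
      have := h.upper₁ y hyI
      gcongr
    have hB2 : B * B ≤ B ^ 18 := by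
      rw [← sq]; exact pow_le_pow_right₀ hB1 (by norm_num)
    have hB4 : B * B * (B * B) ≤ B ^ 18 := by
      rw [show B * B * (B * B) = B ^ 4 by ring]; exact pow_le_pow_right₀ hB1 (by norm_num)
    have b : |(k₂ y * (y * G y) - k₁ y * (1 * G y + y * G₁ y)) / (y * G y) ^ 2| ≤
        3 * B ^ 18 / y ^ 2 := by
      rw [e, abs_div, abs_of_pos (pow_pos hy0 2)]
      gcongr
      refine (abs_sub _ _).trans ?_
      have := abs_sub (k₂ y * (1 / G y) * y) (k₁ y * (1 / G y))
      linarith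
    calc _ ≤ 400 * B ^ 18 / y ^ 2 + 3 * B ^ 18 / y ^ 2 := add_le_add hdle b
      _ = _ := by ring
  choose! χ' hχ'd hχ'le using hχd
  have hχle : ∀ y ∈ Set.Icc ρ r, |χ y| ≤ 20 * B ^ 18 / y := fun y hy => by
    have hyI := mem_Icc (hmem y hy)
    have hy0 := (hmem y hy).1
    have hG0 := h.G_pos hyI
    have hσ0 := h.morseRatio_pos (hmem y hy)
    have hGinv : 1 / G y ≤ B := by
      rw [div_le_iff₀ hG0]
      have := mul_le_mul_of_nonneg_left (h.lower y hyI) hB.le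
      rwa [mul_one_div_cancel hB.ne'] at this
    have hσinv : 1 / morseRatio Φ y ≤ B := by
      rw [div_le_iff₀ hσ0]
      have := mul_le_mul_of_nonneg_left (h.morseRatio_mem (hmem y hy)).1 hB.le
      rwa [mul_one_div_cancel hB.ne'] at this
    have e : χ y = E y * (1 / morseRatio Φ y) ^ 3 * (1 / G y) / y ^ 3 + k₁ y * (1 / G y) / y := by
      simp only [hχ]; field_simp
    have b1 : |E y * (1 / morseRatio Φ y) ^ 3 * (1 / G y) / y ^ 3| ≤
        19 * B ^ 5 * y ^ 2 * B ^ 3 * B / y ^ 3 := by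
      rw [abs_div, abs_mul, abs_mul, abs_of_pos (by positivity : 0 < y ^ 3),
        abs_of_pos (by positivity : 0 < 1 / G y),
        abs_of_pos (by positivity : 0 < (1 / morseRatio Φ y) ^ 3)]
      have := h.abs_cubic_le (hmem y hy)
      gcongr
    have b2 : |k₁ y * (1 / G y) / y| ≤ B * B / y := by
      rw [abs_div, abs_mul, abs_of_pos hy0, abs_of_pos (by positivity : 0 < 1 / G y)]
      have := hb₁ y hyI
      gcongr
    have e1 : 19 * B ^ 5 * y ^ 2 * B ^ 3 * B / y ^ 3 = 19 * B ^ 9 / y := by field_simp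
    rw [e]
    refine (abs_add_le _ _).trans ((add_le_add b1 b2).trans ?_)
    rw [e1, ← add_div]
    gcongr
    have : B ^ 9 ≤ B ^ 18 := pow_le_pow_right₀ hB1 (by norm_num)
    have : B * B ≤ B ^ 18 := by
      rw [← sq]; exact pow_le_pow_right₀ hB1 (by norm_num)
    linarith
  have hrest := norm_integral_mul_deriv_phase_le (g := χ) (g' := χ') (Ψ := fun y => -(Λ * Φ y))
    (β := fun y => 403 * B ^ 18 * (-y⁻¹)) (β' := fun y => 403 * B ^ 18 / y ^ 2) hρr
    hχ'd hΨ hΨc (fun y hy => by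
      have hy0 := (hmem y hy).1.ne'
      refine (((hasDerivAt_inv hy0).neg).const_mul _).congr_deriv ?_
      field_simp) hχ'le
  have hrest' : (∫ y in ρ..r, ((χ y * -(Λ * (y * G y)) : ℝ) : ℂ) *
        Complex.exp (Complex.I * ((-(Λ * Φ y) : ℝ) : ℂ))) =
      -Λ * ∫ y in ρ..r, (H' y : ℂ) * Complex.exp (Complex.I * ((-(Λ * Φ y) : ℝ) : ℂ)) := by
    rw [← intervalIntegral.integral_const_mul]
    refine intervalIntegral.integral_congr fun y hy => ?_
    rw [hu] at hy
    have hy0 := (hmem y hy).1.ne'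
    have hG0 := (h.G_pos (mem_Icc (hmem y hy))).ne'
    have hσ0 := (h.morseRatio_pos (hmem y hy)).ne'
    have e : χ y * -(Λ * (y * G y)) = -Λ * H' y := by
      simp only [hχ, hH']; field_simp
    rw [e]; push_cast; ring
  have hleft : (∫ y in ρ..r, (((H y - h₀) * -(Λ * (y * G y)) : ℝ) : ℂ) *
        Complex.exp (Complex.I * ((-(Λ * Φ y) : ℝ) : ℂ))) =
      -Λ * ∫ y in ρ..r, (((H y - h₀) * (y * G y) : ℝ) : ℂ) *
        Complex.exp (Complex.I * ((-(Λ * Φ y) : ℝ) : ℂ)) := by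
    rw [← intervalIntegral.integral_const_mul]
    refine intervalIntegral.integral_congr fun y hy => ?_
    push_cast; ring
  rw [hrest'] at hrest
  rw [hleft] at hparts
  set J := ∫ y in ρ..r, (((H y - h₀) * (y * G y) : ℝ) : ℂ) *
        Complex.exp (Complex.I * ((-(Λ * Φ y) : ℝ) : ℂ))
  set K := ∫ y in ρ..r, (H' y : ℂ) * Complex.exp (Complex.I * ((-(Λ * Φ y) : ℝ) : ℂ))
  set e₁ := Complex.exp (Complex.I * ((-(Λ * Φ r) : ℝ) : ℂ))
  set e₀ := Complex.exp (Complex.I * ((-(Λ * Φ ρ) : ℝ) : ℂ)) with he₀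
  have hJ : J - Complex.I / Λ * (((H r - h₀ : ℝ) : ℂ) * e₁) =
      -(Complex.I / Λ * (((H ρ - h₀ : ℝ) : ℂ) * e₀)) + Complex.I / Λ ^ 2 * (-Λ * K) := by
    field_simp
    linear_combination (-1 : ℂ) * hparts
  rw [hJ]
  refine (norm_add_le _ _).trans ?_
  rw [norm_neg, norm_mul, norm_mul, norm_mul (Complex.I / (Λ : ℂ) ^ 2), norm_div, norm_div,
    Complex.norm_I, norm_pow, Complex.norm_real, Complex.norm_real, he₀, norm_exp_I_mul,
    Real.norm_eq_abs, Real.norm_eq_abs, abs_of_pos hΛ0, mul_one, ← one_div_pow, hΛinv]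
  have c1 : ρ ^ 2 * |H ρ - h₀| ≤ ρ ^ 2 * (4 * B ^ 8 * ρ) := by gcongr
  have hr0 := h.r_pos
  -- The endpoint values of χ and its variation are all O(1/ρ). Division by Λ² = ρ⁻⁴ then leaves
  -- O(ρ³).
  have c2 : ‖-(Λ : ℂ) * K‖ ≤ 443 * B ^ 18 / ρ := by
    refine hrest.trans ?_
    have d1 := hχle ρ (Set.left_mem_Icc.2 hρr)
    have d2 := hχle r (Set.right_mem_Icc.2 hρr)
    have d3 : 20 * B ^ 18 / r ≤ 20 * B ^ 18 / ρ := by gcongr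
    have d4 : 0 ≤ 403 * B ^ 18 * r⁻¹ := by positivity
    have d5 : 443 * B ^ 18 / ρ = 20 * B ^ 18 / ρ + 20 * B ^ 18 / ρ + 403 * B ^ 18 * ρ⁻¹ := by
      field_simp; norm_num
    rw [d5]
    linarith
  have c3 : (ρ ^ 2) ^ 2 * ‖-(Λ : ℂ) * K‖ ≤ (ρ ^ 2) ^ 2 * (443 * B ^ 18 / ρ) := by gcongr
  have c4 : (ρ ^ 2) ^ 2 * (443 * B ^ 18 / ρ) = 443 * B ^ 18 * ρ ^ 3 := by field_simp
  have c5 : B ^ 8 * ρ ^ 3 ≤ B ^ 18 * ρ ^ 3 := by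
    gcongr ?_ * ρ ^ 3
    exact pow_le_pow_right₀ hB1 (by norm_num)
  have c6 : 0 < B ^ 18 * ρ ^ 3 := by positivity
  nlinarith

end StationaryPhase

namespace StationaryPhase

variable {r B : ℝ} {Φ G G₁ G₂ k k₁ k₂ : ℝ → ℝ}

theorem hasDerivWithinAt_integral_Icc {f : ℝ → ℂ} {a b y : ℝ} (hf : ContinuousOn f (Set.Icc a b))
    (hy : y ∈ Set.Icc a b) :
    HasDerivWithinAt (fun y => ∫ x in a..y, f x) (f y) (Set.Icc a b) y := by
  have : Fact (y ∈ Set.Icc a b) := ⟨hy⟩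
  exact intervalIntegral.integral_hasDerivWithinAt_right
    ((hf.mono (by rw [Set.uIcc_of_le hy.1]; exact Set.Icc_subset_Icc_right hy.2)).intervalIntegrable)
    (hf.stronglyMeasurableAtFilter_nhdsWithin measurableSet_Icc y) (hf y hy)

/-- Asymptotics of a half-line oscillatory integral with a stationary point at its endpoint. -/
theorem half_line (h : StationaryPhase r B Φ G G₁ G₂)
    (hk : ∀ y ∈ Set.Icc 0 r, HasDerivAt k (k₁ y) y)
    (hk₁ : ∀ y ∈ Set.Icc 0 r, HasDerivAt k₁ (k₂ y) y)
    (hb₁ : ∀ y ∈ Set.Icc 0 r, |k₁ y| ≤ B) (hb₂ : ∀ y ∈ Set.Icc 0 r, |k₂ y| ≤ B)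
    {Λ ρ : ℝ} (hρ : 0 < ρ) (hρr : ρ ≤ r) (hΛ : Λ * ρ ^ 2 = 1) :
    ‖(∫ y in (0)..r, (((1 + y * k y) * G y : ℝ) : ℂ) *
        Complex.exp (Complex.I * ((-(Λ * Φ y) : ℝ) : ℂ))) -
      (Real.sqrt (G 0) * (Real.sqrt (2 * Real.pi / Λ) / 2 *
          Complex.exp (-(Complex.I * (Real.pi / 4)))) +
        Complex.I / Λ * (((1 / r + k r : ℝ) : ℂ) * Complex.exp (Complex.I * ((-(Λ * Φ r) : ℝ) : ℂ)) -
          ((k 0 + G₁ 0 / (3 * G 0) : ℝ) : ℂ)))‖ ≤ 500 * B ^ 18 / r ^ 2 * ρ ^ 3 := by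
  have hB := h.B_pos
  have hB1 := h.one_le
  have hr0 := h.r_pos
  have hr1 := h.r_le
  have hΛ0 : 0 < Λ := pos_of_mul_pos_left (hΛ ▸ one_pos) (sq_nonneg ρ)
  have hΛc : (Λ : ℂ) ≠ 0 := by exact_mod_cast hΛ0.ne'
  have hΛinv : 1 / Λ = ρ ^ 2 := by field_simp; linarith
  set c := Real.sqrt (G 0) with hc
  set h₀ := k 0 + G₁ 0 / (3 * G 0) with hh₀
  -- H is 1/y - c/s(y) + k(y) with s = √(2Φ): the integrand minus the derivative of c times the
  -- Fresnel integral at s(y) equals H yG times the exponential. Its limit at 0 is h₀, and h₀ yG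
  -- times the exponential integrates exactly.
  set H : ℝ → ℝ := fun y => (morseRatio Φ y - c) / (y * morseRatio Φ y) + k y with hH
  set e : ℝ → ℂ := fun y => Complex.exp (Complex.I * ((-(Λ * Φ y) : ℝ) : ℂ)) with he
  have he1 : ∀ y, ‖e y‖ = 1 := fun y => norm_exp_I_mul _
  set A : ℝ → ℂ := fun y => (((1 + y * k y) * G y : ℝ) : ℂ) * e y with hA
  set s : ℝ → ℝ := fun y => Real.sqrt (2 * Φ y) with hs
  have hGc : ContinuousOn G (Set.Icc 0 r) := fun y hy => (h.fst y hy).continuousAt.continuousWithinAt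
  have hkc : ContinuousOn k (Set.Icc 0 r) := fun y hy => (hk y hy).continuousAt.continuousWithinAt
  have hΦc : ContinuousOn Φ (Set.Icc 0 r) := fun y hy =>
    (h.phase y hy).continuousAt.continuousWithinAt
  have hec : ContinuousOn e (Set.Icc 0 r) := fun y hy =>
    (h.hasDerivAt_exp_phase Λ hy).continuousAt.continuousWithinAt
  have hAc : ContinuousOn A (Set.Icc 0 r) :=
    (Complex.continuous_ofReal.comp_continuousOn
      ((continuousOn_const.add (continuousOn_id.mul hkc)).mul hGc)).mul hec
  have hHle : ∀ y ∈ Set.Ioc 0 r, |H y - h₀| ≤ 4 * B ^ 8 * y := fun y hy => by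
    have h1 := h.abs_morse_defect_le hy
    have h2 := abs_sub_le_of_hasDerivAt hy.1.le
      (fun x hx => hk x ⟨hx.1, hx.2.trans hy.2⟩) (fun x hx => hb₁ x ⟨hx.1, hx.2.trans hy.2⟩)
    have e1 : H y - h₀ = ((morseRatio Φ y - c) / (y * morseRatio Φ y) - G₁ 0 / (3 * G 0)) +
        (k y - k 0) := by simp only [hH, hh₀]; ring
    rw [e1]
    refine (abs_add_le _ _).trans ((add_le_add h1 h2).trans ?_)
    have : B ≤ B ^ 8 := le_self_pow₀ hB1 (by norm_num)
    have := mul_le_mul_of_nonneg_right this hy.1.le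
    linarith
  -- the integrand minus the leading terms
  set W : ℝ → ℂ := fun y => (∫ x in (0)..y, A x) - c * fresnel Λ (s y) -
    h₀ * (Complex.I / Λ) * (e y - 1) with hW
  have hWd : ∀ y ∈ Set.Ioc 0 r, HasDerivWithinAt W
      ((((H y - h₀) * (y * G y) : ℝ) : ℂ) * e y) (Set.Icc 0 r) y := fun y hy => by
    have hyI := mem_Icc hy
    have d1 := hasDerivWithinAt_integral_Icc hAc hyI
    have d2 := ((h.hasDerivAt_fresnel_radius Λ hy).const_mul (c : ℂ)).hasDerivWithinAt
      (s := Set.Icc 0 r)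
    have d3 := (((h.hasDerivAt_exp_phase Λ hyI).sub_const 1).const_mul
      (h₀ * (Complex.I / Λ))).hasDerivWithinAt (s := Set.Icc 0 r)
    refine ((d1.sub d2).sub d3).congr_deriv ?_
    have hy0 : (y : ℂ) ≠ 0 := by exact_mod_cast hy.1.ne'
    have hσ0 : (morseRatio Φ y : ℂ) ≠ 0 := by exact_mod_cast (h.morseRatio_pos hy).ne'
    simp only [hA, hH, he]
    push_cast
    field_simp
    rw [Complex.I_sq]
    ring
  have hs0 : s 0 = 0 := by simp [hs, h.zero]
  have hW0 : W 0 = 0 := by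
    simp [hW, hs0, he, h.zero, fresnel]
  have hsc : ContinuousOn s (Set.Icc 0 r) := (continuousOn_const.mul hΦc).sqrt
  have hFc : Continuous (fresnel Λ) :=
    continuous_iff_continuousAt.2 fun x => (hasDerivAt_fresnel Λ x).continuousAt
  have hWc : ContinuousOn W (Set.Icc 0 r) := by
    refine ContinuousOn.sub (ContinuousOn.sub (fun y hy => ?_) ?_) ?_
    · exact (hasDerivWithinAt_integral_Icc hAc hy).continuousWithinAt
    · exact continuousOn_const.mul (hFc.comp_continuousOn hsc)
    · exact continuousOn_const.mul (hec.sub continuousOn_const)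
  -- the inner part
  have hin : ‖W ρ‖ ≤ 4 * B ^ 9 * ρ ^ 3 := by
    -- W is differentiated only for y > 0, since the Morse ratio is singular in form at 0; the
    -- estimate is made on [a, ρ] and continuity of W lets a ↘ 0.
    have hlim : Tendsto (fun a => ‖W ρ - W a‖) (𝓝[>] 0) (𝓝 ‖W ρ - W 0‖) := by
      have hW0c : Tendsto W (𝓝[>] 0) (𝓝 (W 0)) := by
        refine (hWc 0 ⟨le_rfl, hr0.le⟩).tendsto.mono_left ?_
        rw [← nhdsWithin_Ioc_eq_nhdsGT hr0]
        exact nhdsWithin_mono _ Set.Ioc_subset_Icc_self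
      exact (tendsto_const_nhds.sub hW0c).norm
    rw [hW0, sub_zero] at hlim
    refine le_of_tendsto hlim ?_
    filter_upwards [Ioo_mem_nhdsGT hρ] with a ha
    have hm : ∀ y ∈ Set.Icc a ρ, y ∈ Set.Ioc 0 r := fun y hy =>
      ⟨ha.1.trans_le hy.1, hy.2.trans hρr⟩
    have := (convex_Icc a ρ).norm_image_sub_le_of_norm_hasDerivWithin_le (C := 4 * B ^ 9 * ρ ^ 2)
      (fun y hy => (hWd y (hm y hy)).mono (fun z hz => mem_Icc (hm z hz)))
      (fun y hy => by
        have hy0 := (hm y hy).1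
        rw [norm_mul, he1, mul_one, Complex.norm_real, Real.norm_eq_abs, abs_mul, abs_mul,
          abs_of_pos hy0, abs_of_pos (h.G_pos (mem_Icc (hm y hy)))]
        have h1 := hHle y (hm y hy)
        have h2 := h.upper y (mem_Icc (hm y hy))
        have hG0 := h.G_pos (mem_Icc (hm y hy))
        calc |H y - h₀| * (y * G y) ≤ 4 * B ^ 8 * ρ * (ρ * B) := by
              gcongr
              · exact h1.trans (by gcongr; exact hy.2)
              · exact hy.2
          _ = 4 * B ^ 9 * ρ ^ 2 := by ring)
      (Set.left_mem_Icc.2 ha.2.le) (Set.right_mem_Icc.2 ha.2.le)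
    refine this.trans ?_
    rw [Real.norm_eq_abs, abs_of_pos (sub_pos.2 ha.2)]
    calc 4 * B ^ 9 * ρ ^ 2 * (ρ - a) ≤ 4 * B ^ 9 * ρ ^ 2 * ρ := by gcongr; linarith [ha.1]
      _ = _ := by ring
  -- the outer part
  have hout := h.norm_outer_le hk hk₁ hb₁ hb₂ hρ hρr hΛ (H := H) (fun y => rfl)
    (hHle ρ ⟨hρ, hρr⟩)
  have hmρ : ∀ y ∈ Set.Icc ρ r, y ∈ Set.Ioc 0 r := fun y hy => ⟨hρ.trans_le hy.1, hy.2⟩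
  have hWr : W r - W ρ = ∫ y in ρ..r, (((H y - h₀) * (y * G y) : ℝ) : ℂ) * e y := by
    symm
    refine intervalIntegral.integral_eq_sub_of_hasDerivAt_of_le hρr
      (hWc.mono fun y hy => mem_Icc (hmρ y hy)) (fun y hy => ?_) ?_
    · exact (hWd y (hmρ y (Set.Ioo_subset_Icc_self hy))).hasDerivAt
        (Icc_mem_nhds (hρ.trans hy.1) hy.2)
    · refine ContinuousOn.intervalIntegrable ?_
      rw [Set.uIcc_of_le hρr]
      have hsub : Set.Icc ρ r ⊆ Set.Icc 0 r := fun y hy => mem_Icc (hmρ y hy)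
      have hσc : ContinuousOn (morseRatio Φ) (Set.Icc ρ r) := fun y hy =>
        (h.hasDerivAt_morseRatio (hmρ y hy)).continuousAt.continuousWithinAt
      have hHc : ContinuousOn H (Set.Icc ρ r) := by
        refine ContinuousOn.add (ContinuousOn.div (hσc.sub continuousOn_const)
          (continuousOn_id.mul hσc) fun y hy => ?_) (hkc.mono hsub)
        exact (mul_pos (hmρ y hy).1 (h.morseRatio_pos (hmρ y hy))).ne'
      exact (Complex.continuous_ofReal.comp_continuousOn ((hHc.sub continuousOn_const).mul
        (continuousOn_id.mul (hGc.mono hsub)))).mul (hec.mono hsub)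
  rw [← hWr] at hout
  -- the Fresnel integral
  have hrm : r ∈ Set.Ioc 0 r := ⟨hr0, le_rfl⟩
  have hσr := h.morseRatio_pos hrm
  have hsr : s r = morseRatio Φ r * r := by simp only [hs, morseRatio]; field_simp
  have hsr0 : 0 < s r := by rw [hsr]; positivity
  have hfr := norm_fresnel_sub_le hΛ0 hsr0
  have hes : Complex.exp (-(Complex.I * Λ * ((s r : ℂ) ^ 2 / 2))) = e r := by
    have : ((s r : ℝ) : ℂ) ^ 2 = 2 * Φ r := by
      rw [← Complex.ofReal_pow, Real.sq_sqrt (by linarith [h.phase_pos hrm])]; push_cast; ring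
    rw [this]; simp only [he]; congr 1; push_cast; ring
  rw [hes] at hfr
  change ‖fresnel Λ (s r) - _ - _‖ ≤ _ at hfr
  have hfinal : (∫ y in (0)..r, A y) - (c * (Real.sqrt (2 * Real.pi / Λ) / 2 *
          Complex.exp (-(Complex.I * (Real.pi / 4)))) +
        Complex.I / Λ * (((1 / r + k r : ℝ) : ℂ) * e r - (h₀ : ℂ))) =
      W ρ + (W r - W ρ - Complex.I / Λ * (((H r - h₀ : ℝ) : ℂ) * e r)) +
      c * (fresnel Λ (s r) - Real.sqrt (2 * Real.pi / Λ) / 2 *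
        Complex.exp (-(Complex.I * (Real.pi / 4))) - Complex.I / Λ * e r / (s r)) := by
    have hWrdef : W r = (∫ y in (0)..r, A y) - c * fresnel Λ (s r) -
      h₀ * (Complex.I / Λ) * (e r - 1) := rfl
    -- The part -c/s(r) cancels the endpoint term of the Fresnel integral, so the result at r no
    -- longer involves the Morse coordinate.
    have hHr : H r = 1 / r - c / s r + k r := by
      simp only [hH]; rw [hsr]; field_simp
    rw [hWrdef, hHr]
    have : (s r : ℂ) ≠ 0 := by exact_mod_cast hsr0.ne'
    have : (r : ℂ) ≠ 0 := by exact_mod_cast hr0.ne'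
    push_cast
    field_simp
    ring
  rw [hfinal]
  have hcle := h.sqrt_mem.2
  have hc0 : 0 ≤ c := Real.sqrt_nonneg _
  have hfr2 : ‖(c : ℂ) * (fresnel Λ (s r) - Real.sqrt (2 * Real.pi / Λ) / 2 *
        Complex.exp (-(Complex.I * (Real.pi / 4))) - Complex.I / Λ * e r / (s r))‖ ≤
      2 * B ^ 4 / r ^ 2 * ρ ^ 3 := by
    rw [norm_mul, Complex.norm_real, Real.norm_eq_abs, abs_of_nonneg hc0]
    have hsl : r / B ≤ s r := by
      rw [hsr, div_eq_inv_mul, ← one_div]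
      exact mul_le_mul_of_nonneg_right (h.morseRatio_mem hrm).1 hr0.le
    have h1 : 2 / (Λ ^ 2 * s r ^ 3) ≤ 2 / (Λ ^ 2 * (r / B) ^ 3) := by gcongr
    have h2 : 2 / (Λ ^ 2 * (r / B) ^ 3) = 2 * B ^ 3 / r ^ 3 * (ρ ^ 2) ^ 2 := by
      rw [← hΛinv]; field_simp
    calc _ ≤ B * (2 * B ^ 3 / r ^ 3 * (ρ ^ 2) ^ 2) := by
          rw [← h2]
          exact mul_le_mul hcle (hfr.trans h1) (norm_nonneg _) hB.le
      _ = 2 * B ^ 4 / r ^ 2 * ρ ^ 3 * (ρ / r) := by field_simp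
      -- The Fresnel remainder is of order ρ⁴; one factor is spent on ρ/r ≤ 1.
      _ ≤ 2 * B ^ 4 / r ^ 2 * ρ ^ 3 * 1 := by
          gcongr
          rw [div_le_one hr0]; exact hρr
      _ = _ := by ring
  refine (norm_add_le _ _).trans ?_
  have htri := norm_add_le (W ρ) (W r - W ρ - Complex.I / Λ * (((H r - h₀ : ℝ) : ℂ) * e r))
  have p1 : B ^ 9 * ρ ^ 3 ≤ B ^ 18 / r ^ 2 * ρ ^ 3 := by
    refine mul_le_mul_of_nonneg_right ?_ (by positivity)
    rw [le_div_iff₀ (by positivity)]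
    exact (mul_le_mul (pow_le_pow_right₀ hB1 (by norm_num)) (pow_le_one₀ hr0.le hr1)
      (by positivity) (by positivity)).trans (mul_one (B ^ 18)).le
  have p2 : B ^ 18 * ρ ^ 3 ≤ B ^ 18 / r ^ 2 * ρ ^ 3 := by
    refine mul_le_mul_of_nonneg_right ?_ (by positivity)
    rw [le_div_iff₀ (by positivity)]
    exact mul_le_of_le_one_right (by positivity) (pow_le_one₀ hr0.le hr1)
  have p3 : B ^ 4 / r ^ 2 * ρ ^ 3 ≤ B ^ 18 / r ^ 2 * ρ ^ 3 := by
    gcongr ?_ / r ^ 2 * ρ ^ 3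
    exact pow_le_pow_right₀ hB1 (by norm_num)
  have p4 : 0 ≤ B ^ 18 / r ^ 2 * ρ ^ 3 := by positivity
  have q1 : 500 * B ^ 18 / r ^ 2 * ρ ^ 3 = 500 * (B ^ 18 / r ^ 2 * ρ ^ 3) := by ring
  have q2 : 2 * B ^ 4 / r ^ 2 * ρ ^ 3 = 2 * (B ^ 4 / r ^ 2 * ρ ^ 3) := by ring
  rw [q1]
  rw [q2] at hfr2
  linarith

/-- Asymptotics of an oscillatory integral with an interior stationary point. -/
theorem two_sided (h : StationaryPhase r B Φ G G₁ G₂)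
    (h' : StationaryPhase r B (fun y => Φ (-y)) (fun y => G (-y)) (fun y => -G₁ (-y))
      (fun y => G₂ (-y)))
    (hk : ∀ y ∈ Set.Icc (-r) r, HasDerivAt k (k₁ y) y)
    (hk₁ : ∀ y ∈ Set.Icc (-r) r, HasDerivAt k₁ (k₂ y) y)
    (hb₁ : ∀ y ∈ Set.Icc (-r) r, |k₁ y| ≤ B) (hb₂ : ∀ y ∈ Set.Icc (-r) r, |k₂ y| ≤ B)
    {Λ ρ : ℝ} (hρ : 0 < ρ) (hρr : ρ ≤ r) (hΛ : Λ * ρ ^ 2 = 1) :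
    ‖(∫ y in (-r)..r, (((1 + y * k y) * G y : ℝ) : ℂ) *
        Complex.exp (Complex.I * ((-(Λ * Φ y) : ℝ) : ℂ))) -
      (Real.sqrt (G 0) * (Real.sqrt (2 * Real.pi / Λ) *
          Complex.exp (-(Complex.I * (Real.pi / 4)))) +
        Complex.I / Λ * (((1 / r + k r : ℝ) : ℂ) * Complex.exp (Complex.I * ((-(Λ * Φ r) : ℝ) : ℂ)) +
          ((1 / r - k (-r) : ℝ) : ℂ) * Complex.exp (Complex.I * ((-(Λ * Φ (-r)) : ℝ) : ℂ))))‖ ≤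
      1000 * B ^ 18 / r ^ 2 * ρ ^ 3 := by
  have hr0 := h.r_pos
  have hm : ∀ y ∈ Set.Icc 0 r, y ∈ Set.Icc (-r) r := fun y hy => ⟨by linarith [hy.1], hy.2⟩
  have hm' : ∀ y ∈ Set.Icc 0 r, -y ∈ Set.Icc (-r) r := fun y hy =>
    ⟨by linarith [hy.2], by linarith [hy.1]⟩
  have hp := h.half_line (fun y hy => hk y (hm y hy)) (fun y hy => hk₁ y (hm y hy))
    (fun y hy => hb₁ y (hm y hy)) (fun y hy => hb₂ y (hm y hy)) hρ hρr hΛ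
  -- Reflection replaces k by -k(-y) and G₁ by -G₁(-y), so the constant k(0) + G₁(0)/(3G(0)) changes
  -- sign and cancels between the halves. Without this the error would only be O(1/Λ).
  have hn := h'.half_line (k := fun y => -k (-y)) (k₁ := fun y => k₁ (-y))
    (k₂ := fun y => -k₂ (-y))
    (fun y hy => by
      have := ((hk (-y) (hm' y hy)).scomp y (hasDerivAt_neg y)).neg
      exact this.congr_deriv (by simp))
    (fun y hy => by
      have := ((hk₁ (-y) (hm' y hy)).scomp y (hasDerivAt_neg y))
      exact this.congr_deriv (by simp))
    (fun y hy => hb₁ _ (hm' y hy)) (fun y hy => by rw [abs_neg]; exact hb₂ _ (hm' y hy)) hρ hρr hΛ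
  have hrefl : (∫ y in (0)..r, (((1 + y * -k (-y)) * G (-y) : ℝ) : ℂ) *
        Complex.exp (Complex.I * ((-(Λ * Φ (-y)) : ℝ) : ℂ))) =
      ∫ y in (-r)..0, (((1 + y * k y) * G y : ℝ) : ℂ) *
        Complex.exp (Complex.I * ((-(Λ * Φ y) : ℝ) : ℂ)) := by
    have := intervalIntegral.integral_comp_neg (a := 0) (b := r)
      (fun y => (((1 + y * k y) * G y : ℝ) : ℂ) *
        Complex.exp (Complex.I * ((-(Λ * Φ y) : ℝ) : ℂ)))
    rw [neg_zero] at this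
    rw [← this]
    refine intervalIntegral.integral_congr fun y _ => ?_
    simp only [mul_neg, neg_mul]
  rw [hrefl] at hn
  simp only [neg_zero] at hn
  have hcont : ∀ {G G₁ Φ : ℝ → ℝ} {y : ℝ}, y ∈ Set.Icc (-r) r → HasDerivAt G (G₁ y) y →
      HasDerivAt Φ (y * G y) y →
      ContinuousAt (fun y => (((1 + y * k y) * G y : ℝ) : ℂ) *
        Complex.exp (Complex.I * ((-(Λ * Φ y) : ℝ) : ℂ))) y := fun hy h1 h2 => by
    have c1 := (hk _ hy).continuousAt
    have c2 := h1.continuousAt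
    have c3 := h2.continuousAt
    fun_prop
  have hcp : ContinuousOn (fun y => (((1 + y * k y) * G y : ℝ) : ℂ) *
        Complex.exp (Complex.I * ((-(Λ * Φ y) : ℝ) : ℂ))) (Set.uIcc 0 r) := fun y hy => by
    rw [Set.uIcc_of_le hr0.le] at hy
    exact (hcont (hm y hy) (h.fst y hy) (h.phase y hy)).continuousWithinAt
  have hcn : ContinuousOn (fun y => (((1 + y * k y) * G y : ℝ) : ℂ) *
        Complex.exp (Complex.I * ((-(Λ * Φ y) : ℝ) : ℂ))) (Set.uIcc (-r) 0) := fun y hy => by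
    rw [Set.uIcc_of_le (neg_nonpos.2 hr0.le)] at hy
    have hy' : -y ∈ Set.Icc 0 r := ⟨by linarith [hy.2], by linarith [hy.1]⟩
    have d1 := (h'.fst (-y) hy').scomp y (hasDerivAt_neg y)
    have d2 := (h'.phase (-y) hy').scomp y (hasDerivAt_neg y)
    simp only [Function.comp_def, neg_neg] at d1 d2
    refine (hcont (G₁ := G₁) ⟨hy.1, hy.2.trans hr0.le⟩ (d1.congr_deriv (by simp))
      (d2.congr_deriv (by simp))).continuousWithinAt
  rw [← intervalIntegral.integral_add_adjacent_intervals hcn.intervalIntegrable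
    hcp.intervalIntegrable]
  refine le_trans (le_of_eq ?_) ((norm_add_le _ _).trans ((add_le_add hn hp).trans
    (le_of_eq (by ring : 500 * B ^ 18 / r ^ 2 * ρ ^ 3 + 500 * B ^ 18 / r ^ 2 * ρ ^ 3 = _))))
  congr 1
  push_cast
  ring

end StationaryPhase

/-! ### Lattice dispersion relation and relative rapidity. -/

/-- The denominator `√(μ² + sin² p)` of the lattice propagator. -/
noncomputable def latticeEnergy (μ p : ℝ) : ℝ := Real.sqrt (μ ^ 2 + Real.sin p ^ 2)

/-- The lattice dispersion relation. -/
noncomputable def latticeFrequency (μ p : ℝ) : ℝ := Real.arccos (Real.cos p / Real.sqrt (1 + μ ^ 2))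

/-- The phase of a plane wave at the lattice point `(j, l)`. -/
noncomputable def latticePhase (μ j l p : ℝ) : ℝ := p * j - latticeFrequency μ p * l

/-- The hyperbolic sine of the rapidity of the momentum `p` relative to the velocity `v`, with
`a = (1 - v²)^{-1/2}`. -/
noncomputable def relSinh (μ v a p : ℝ) : ℝ := a * (Real.sin p - v * latticeEnergy μ p) / μ

theorem latticeEnergy_sq (μ p : ℝ) : latticeEnergy μ p ^ 2 = μ ^ 2 + Real.sin p ^ 2 :=
  Real.sq_sqrt (by positivity)

theorem latticeEnergy_pos {μ : ℝ} (hμ : 0 < μ) (p : ℝ) : 0 < latticeEnergy μ p :=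
  Real.sqrt_pos.2 (by positivity)

theorem abs_sin_lt_latticeEnergy {μ : ℝ} (hμ : 0 < μ) (p : ℝ) :
    |Real.sin p| < latticeEnergy μ p := by
  rw [← Real.sqrt_sq_eq_abs]
  exact Real.sqrt_lt_sqrt (sq_nonneg _) (by linarith [pow_pos hμ 2])

theorem continuous_latticeEnergy (μ : ℝ) : Continuous (latticeEnergy μ) := by
  unfold latticeEnergy; fun_prop

theorem continuous_latticeFrequency (μ : ℝ) : Continuous (latticeFrequency μ) := by
  unfold latticeFrequency
  exact Real.continuous_arccos.comp (by fun_prop)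

theorem continuous_latticePhase (μ j l : ℝ) : Continuous (latticePhase μ j l) := by
  have := continuous_latticeFrequency μ
  unfold latticePhase; fun_prop

theorem hasDerivAt_latticeEnergy {μ : ℝ} (hμ : 0 < μ) (p : ℝ) :
    HasDerivAt (latticeEnergy μ) (Real.sin p * Real.cos p / latticeEnergy μ p) p := by
  have h : HasDerivAt (fun p => μ ^ 2 + Real.sin p ^ 2) (2 * Real.sin p * Real.cos p) p := by
    exact (((Real.hasDerivAt_sin p).pow 2).const_add (μ ^ 2)).congr_deriv (by push_cast; ring)
  refine (h.sqrt (by positivity)).congr_deriv ?_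
  rw [latticeEnergy]
  have : Real.sqrt (μ ^ 2 + Real.sin p ^ 2) ≠ 0 := (latticeEnergy_pos hμ p).ne'
  field_simp

theorem sqrt_one_sub_cos_div_sq {μ : ℝ} (p : ℝ) :
    Real.sqrt (1 - (Real.cos p / Real.sqrt (1 + μ ^ 2)) ^ 2) =
      latticeEnergy μ p / Real.sqrt (1 + μ ^ 2) := by
  have hn : 0 < 1 + μ ^ 2 := by positivity
  rw [div_pow, Real.sq_sqrt hn.le, latticeEnergy, ← Real.sqrt_div' _ hn.le]
  congr 1
  field_simp
  linarith [Real.sin_sq_add_cos_sq p]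

theorem abs_cos_div_lt_one {μ : ℝ} (hμ : 0 < μ) (p : ℝ) :
    |Real.cos p / Real.sqrt (1 + μ ^ 2)| < 1 := by
  have hn : 1 < Real.sqrt (1 + μ ^ 2) := by
    rw [Real.lt_sqrt (by norm_num)]; nlinarith
  rw [abs_div, abs_of_pos (by linarith : 0 < Real.sqrt (1 + μ ^ 2)), div_lt_one (by linarith)]
  exact (Real.abs_cos_le_one p).trans_lt hn

theorem hasDerivAt_latticeFrequency {μ : ℝ} (hμ : 0 < μ) (p : ℝ) :
    HasDerivAt (latticeFrequency μ) (Real.sin p / latticeEnergy μ p) p := by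
  have h1 := abs_lt.1 (abs_cos_div_lt_one hμ p)
  refine ((Real.hasDerivAt_arccos h1.1.ne' h1.2.ne).comp p
    ((Real.hasDerivAt_cos p).div_const (Real.sqrt (1 + μ ^ 2)))).congr_deriv ?_
  rw [sqrt_one_sub_cos_div_sq]
  have := (latticeEnergy_pos hμ p).ne'
  have : Real.sqrt (1 + μ ^ 2) ≠ 0 := (Real.sqrt_pos.2 (by positivity)).ne'
  field_simp

section

variable {μ v a : ℝ}

/-- The group velocity is sin p / D, and sin p - vD = μy/a; the stationary points are the zeros of y
= `relSinh`, and Λ = lμ/a is the large parameter. -/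
theorem hasDerivAt_latticePhase (hμ : 0 < μ) (hav : a ^ 2 * (1 - v ^ 2) = 1) (l p : ℝ) :
    HasDerivAt (latticePhase μ (v * l) l)
      (-(l * μ / a * relSinh μ v a p / latticeEnergy μ p)) p := by
  have ha : a ≠ 0 := fun h => by simp [h] at hav
  refine (((hasDerivAt_id p).mul_const (v * l)).sub
    ((hasDerivAt_latticeFrequency hμ p).mul_const l)).congr_deriv ?_
  have := (latticeEnergy_pos hμ p).ne'
  rw [relSinh]
  field_simp
  ring

/-- With sin p = μ sinh η and D = μ cosh η, a Lorentz boost by v subtracts rapidities; this is cosh²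
= 1 + sinh² for the difference. -/
theorem one_add_relSinh_sq (hμ : 0 < μ) (hav : a ^ 2 * (1 - v ^ 2) = 1) (p : ℝ) :
    1 + relSinh μ v a p ^ 2 = (a * (latticeEnergy μ p - v * Real.sin p) / μ) ^ 2 := by
  have h := latticeEnergy_sq μ p
  rw [relSinh]
  field_simp
  linear_combination (-(latticeEnergy μ p ^ 2) + Real.sin p ^ 2) * hav - h

theorem latticeEnergy_sub_pos (hμ : 0 < μ) (hav : a ^ 2 * (1 - v ^ 2) = 1) (p : ℝ) :
    0 < latticeEnergy μ p - v * Real.sin p := by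
  have hv : |v| < 1 := by
    rw [← sq_lt_one_iff_abs_lt_one]
    by_contra h
    push Not at h
    nlinarith [sq_nonneg a]
  have h1 := abs_sin_lt_latticeEnergy hμ p
  have h2 : v * Real.sin p ≤ |v| * |Real.sin p| := by rw [← abs_mul]; exact le_abs_self _
  nlinarith [abs_nonneg v, abs_nonneg (Real.sin p)]

theorem sqrt_one_add_relSinh_sq (hμ : 0 < μ) (ha : 0 < a) (hav : a ^ 2 * (1 - v ^ 2) = 1) (p : ℝ) :
    Real.sqrt (1 + relSinh μ v a p ^ 2) = a * (latticeEnergy μ p - v * Real.sin p) / μ := by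
  have := latticeEnergy_sub_pos hμ hav p
  rw [one_add_relSinh_sq hμ hav, Real.sqrt_sq (by positivity)]

theorem hasDerivAt_relSinh (hμ : 0 < μ) (ha : 0 < a) (hav : a ^ 2 * (1 - v ^ 2) = 1) (p : ℝ) :
    HasDerivAt (relSinh μ v a)
      (Real.cos p * Real.sqrt (1 + relSinh μ v a p ^ 2) / latticeEnergy μ p) p := by
  refine ((((Real.hasDerivAt_sin p).sub ((hasDerivAt_latticeEnergy hμ p).const_mul v)).const_mul
    a).div_const μ).congr_deriv ?_
  have := (latticeEnergy_pos hμ p).ne'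
  rw [sqrt_one_add_relSinh_sq hμ ha hav]
  field_simp

/-! ### Momenta away from the stationary point. -/

/-- The amplitude profiles admitted in the asymptotic analysis. -/
structure Profile (k k₁ k₂ : ℝ → ℝ) : Prop where
  fst : ∀ y, HasDerivAt k (k₁ y) y
  snd : ∀ y, HasDerivAt k₁ (k₂ y) y
  bound₁ : ∀ y, |k₁ y| ≤ 1 / (1 + y ^ 2)
  bound₂ : ∀ y, |k₂ y| ≤ 2 / (1 + y ^ 2)

theorem hasDerivAt_sqrt_one_add_sq (y : ℝ) :
    HasDerivAt (fun y => Real.sqrt (1 + y ^ 2)) (y / Real.sqrt (1 + y ^ 2)) y := by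
  have h : HasDerivAt (fun y : ℝ => 1 + y ^ 2) (2 * y) y :=
    ((hasDerivAt_pow 2 y).const_add 1).congr_deriv (by norm_num)
  refine (h.sqrt (by positivity)).congr_deriv ?_
  have : Real.sqrt (1 + y ^ 2) ≠ 0 := (Real.sqrt_pos.2 (by positivity)).ne'
  field_simp

/-- This is the coefficient for the second integration by parts: the derivative of 1/y + k(y)
divided by the phase derivative, apart from cos p and Λ. Its own derivative is O(1/y²), integrable
in y however large y becomes, which gives uniformity as μ → 0. -/
theorem far_amplitude {k k₁ k₂ : ℝ → ℝ} (hk : Profile k k₁ k₂) {r y : ℝ} (hr : 0 < r) (hr1 : r ≤ 1)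
    (hy : r ≤ |y|) :
    |(-1 / y ^ 2 + k₁ y) * Real.sqrt (1 + y ^ 2) / y| ≤ 4 / r ^ 3 ∧
    ∃ d, HasDerivAt (fun y => (-1 / y ^ 2 + k₁ y) * Real.sqrt (1 + y ^ 2) / y) d y ∧
      |d| ≤ 10 / r ^ 2 * (1 / y ^ 2) := by
  have hy0 : 0 < |y| := hr.trans_le hy
  have hyne : y ≠ 0 := abs_pos.1 hy0
  have hy2 : 0 < y ^ 2 := by positivity
  have hry : r ^ 2 ≤ y ^ 2 := by rw [← sq_abs y]; exact pow_le_pow_left₀ hr.le hy 2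
  set q := Real.sqrt (1 + y ^ 2) with hq
  have hq0 : 0 < q := Real.sqrt_pos.2 (by positivity)
  have hq2 : q ^ 2 = 1 + y ^ 2 := Real.sq_sqrt (by positivity)
  have hq1 : 1 ≤ q := by
    rw [hq, Real.one_le_sqrt]; linarith
  have hqy : q / |y| ≤ 2 / r := by
    rw [div_le_div_iff₀ hy0 hr]
    have : q ^ 2 * r ^ 2 ≤ (2 * |y|) ^ 2 := by
      have h1 : r ^ 2 ≤ 1 := pow_le_one₀ hr.le hr1
      rw [hq2, mul_pow, sq_abs]; nlinarith [mul_le_mul_of_nonneg_left h1 hy2.le]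
    nlinarith [abs_le_of_sq_le_sq' (by rwa [← mul_pow] at this) (by positivity)]
  have hinv : 1 / (1 + y ^ 2) ≤ 1 / y ^ 2 := by gcongr; linarith
  have hk1 := hk.bound₁ y
  have hk2 := hk.bound₂ y
  have hψ : |-1 / y ^ 2 + k₁ y| ≤ 2 * (1 / y ^ 2) := by
    refine (abs_add_le _ _).trans ?_
    have : |-1 / y ^ 2| = 1 / y ^ 2 := by rw [abs_div, abs_neg, abs_one, abs_of_pos hy2]
    rw [this]; linarith
  constructor
  · rw [mul_div_assoc, abs_mul, abs_div, abs_of_pos hq0]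
    calc _ ≤ 2 * (1 / y ^ 2) * (2 / r) := by gcongr
      _ ≤ 2 * (1 / r ^ 2) * (2 / r) := by gcongr
      _ = _ := by field_simp; norm_num
  · have hd := ((((hasDerivAt_const y (-1 : ℝ)).div (hasDerivAt_pow 2 y) hy2.ne').add
      (hk.snd y)).mul (hasDerivAt_sqrt_one_add_sq y)).div (hasDerivAt_id y) hyne
    refine ⟨_, hd, ?_⟩
    simp only [id, Pi.add_apply, Pi.mul_apply, Pi.div_apply]
    rw [← hq]
    have e : (((0 * y ^ 2 - -1 * (((2 : ℕ) : ℝ) * y ^ (2 - 1))) / (y ^ 2) ^ 2 + k₂ y) * q +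
        (-1 / y ^ 2 + k₁ y) * (y / q)) * y - (-1 / y ^ 2 + k₁ y) * q * 1 =
        (2 / y ^ 3 + k₂ y) * q * y - (-1 / y ^ 2 + k₁ y) * (1 / q) := by
      have : y ^ 2 = q ^ 2 - 1 := by linarith
      have h1 : (-1 / y ^ 2 + k₁ y) * (y / q) * y - (-1 / y ^ 2 + k₁ y) * q =
          - ((-1 / y ^ 2 + k₁ y) * (1 / q)) := by
        generalize (-1 / y ^ 2 + k₁ y) = ψ
        field_simp
        linear_combination -ψ * hq2
      have h2 : (0 * y ^ 2 - -1 * (((2 : ℕ) : ℝ) * y ^ (2 - 1))) / (y ^ 2) ^ 2 = 2 / y ^ 3 := by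
        push_cast; field_simp; norm_num
      rw [h2]
      linear_combination h1
    rw [e]
    have e2 : ((2 / y ^ 3 + k₂ y) * q * y - (-1 / y ^ 2 + k₁ y) * (1 / q)) / y ^ 2 =
        (2 / y ^ 3 + k₂ y) * (q / y) - (-1 / y ^ 2 + k₁ y) * (1 / q) * (1 / y ^ 2) := by
      field_simp
    rw [e2]
    have hψ' : |2 / y ^ 3 + k₂ y| ≤ 4 / r * (1 / y ^ 2) := by
      refine (abs_add_le _ _).trans ?_
      have h1 : |2 / y ^ 3| ≤ 2 / r * (1 / y ^ 2) := by
        rw [abs_div, abs_two, abs_pow, show |y| ^ 3 = |y| * y ^ 2 by rw [← sq_abs y]; ring]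
        rw [show 2 / (|y| * y ^ 2) = 2 / |y| * (1 / y ^ 2) by field_simp]
        gcongr
      have h2 : 2 / (1 + y ^ 2) ≤ 2 / r * (1 / y ^ 2) := by
        calc 2 / (1 + y ^ 2) = 2 * (1 / (1 + y ^ 2)) := by ring
          _ ≤ 2 * (1 / y ^ 2) := by gcongr
          _ ≤ 2 / r * (1 / y ^ 2) := by
              gcongr
              rw [le_div_iff₀ hr]; linarith
      calc _ ≤ 2 / r * (1 / y ^ 2) + 2 / r * (1 / y ^ 2) := add_le_add h1 (hk2.trans h2)
        _ = _ := by ring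
    have b1 : |(2 / y ^ 3 + k₂ y) * (q / y)| ≤ 4 / r * (1 / y ^ 2) * (2 / r) := by
      rw [abs_mul, abs_div, abs_of_pos hq0]
      gcongr
    have b2 : |(-1 / y ^ 2 + k₁ y) * (1 / q) * (1 / y ^ 2)| ≤
        2 * (1 / y ^ 2) * 1 * (1 / r ^ 2) := by
      rw [abs_mul, abs_mul, abs_of_pos (by positivity : 0 < 1 / q),
        abs_of_pos (by positivity : 0 < 1 / y ^ 2)]
      gcongr
      rw [div_le_one hq0]; exact hq1
    refine (abs_sub _ _).trans ((add_le_add b1 b2).trans (le_of_eq ?_))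
    field_simp
    norm_num

/-- The contribution of an interval of momenta away from the stationary point. -/
theorem norm_far_le {k k₁ k₂ : ℝ → ℝ} (hk : Profile k k₁ k₂) (hμ : 0 < μ) (ha : 0 < a)
    (hav : a ^ 2 * (1 - v ^ 2) = 1) {l r b c : ℝ} (hl : 0 < l) (hr : 0 < r) (hr1 : r ≤ 1)
    (hbc : b ≤ c) (hb : -(Real.pi / 2) ≤ b) (hc : c ≤ Real.pi / 2)
    (hy : ∀ p ∈ Set.Icc b c, r ≤ |relSinh μ v a p|) :
    ‖(∫ p in b..c, (((1 + relSinh μ v a p * k (relSinh μ v a p)) / latticeEnergy μ p : ℝ) : ℂ) *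
        Complex.exp (Complex.I * (latticePhase μ (v * l) l p : ℝ))) -
      Complex.I / (l * μ / a : ℝ) *
        (((1 / relSinh μ v a c + k (relSinh μ v a c) : ℝ) : ℂ) *
            Complex.exp (Complex.I * (latticePhase μ (v * l) l c : ℝ)) -
          ((1 / relSinh μ v a b + k (relSinh μ v a b) : ℝ) : ℂ) *
            Complex.exp (Complex.I * (latticePhase μ (v * l) l b : ℝ)))‖ ≤
      50 / r ^ 3 * (1 / (l * μ / a)) ^ 2 := by
  set Λ := l * μ / a with hΛdef
  have hΛ : 0 < Λ := by positivity
  have hΛc : (Λ : ℂ) ≠ 0 := by exact_mod_cast hΛ.ne'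
  set Y := relSinh μ v a with hY
  set D := latticeEnergy μ with hD
  set φ := latticePhase μ (v * l) l with hφ
  have hD0 : ∀ p, 0 < D p := latticeEnergy_pos hμ
  have hYne : ∀ p ∈ Set.Icc b c, Y p ≠ 0 := fun p hp => abs_pos.1 (hr.trans_le (hy p hp))
  have hYd : ∀ p, HasDerivAt Y (Real.cos p * Real.sqrt (1 + Y p ^ 2) / D p) p :=
    hasDerivAt_relSinh hμ ha hav
  have hYc : Continuous Y := continuous_iff_continuousAt.2 fun p => (hYd p).continuousAt
  have hDc : Continuous D := continuous_latticeEnergy μ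
  have hk1c : Continuous k₁ := continuous_iff_continuousAt.2 fun p => (hk.snd p).continuousAt
  have hφd : ∀ p, HasDerivAt φ (-(Λ * Y p / D p)) p := hasDerivAt_latticePhase hμ hav l
  set ψ : ℝ → ℝ := fun y => -1 / y ^ 2 + k₁ y with hψ
  set g' : ℝ → ℝ := fun p => ψ (Y p) * (Real.cos p * Real.sqrt (1 + Y p ^ 2) / D p) with hg'
  have hu : Set.uIcc b c = Set.Icc b c := Set.uIcc_of_le hbc
  have hgd : ∀ p ∈ Set.Icc b c, HasDerivAt (fun p => 1 / Y p + k (Y p)) (g' p) p := fun p hp => by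
    have h1 : HasDerivAt (fun y => 1 / y + k y) (ψ (Y p)) (Y p) := by
      refine ((((hasDerivAt_const (Y p) (1 : ℝ)).div (hasDerivAt_id _) (hYne p hp)).add
        (hk.fst (Y p)))).congr_deriv ?_
      simp only [hψ, id]; ring
    exact h1.comp p (hYd p)
  have hφ'c : ContinuousOn (fun p => -(Λ * Y p / D p)) (Set.Icc b c) :=
    ((continuous_const.mul hYc).div hDc fun p => (hD0 p).ne').neg.continuousOn
  have hg'c : ContinuousOn g' (Set.Icc b c) := by
    refine ContinuousOn.mul (ContinuousOn.add (ContinuousOn.div continuousOn_const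
      (hYc.pow 2).continuousOn fun p hp => pow_ne_zero 2 (hYne p hp))
      (hk1c.comp hYc).continuousOn) ?_
    exact (((Real.continuous_cos.mul (continuous_const.add (hYc.pow 2)).sqrt).div hDc
      fun p => (hD0 p).ne')).continuousOn
  have hparts := integral_mul_deriv_phase (a := b) (b := c) (g := fun p => 1 / Y p + k (Y p))
    (g' := g') (Ψ := φ) (Ψ' := fun p => -(Λ * Y p / D p)) (by rwa [hu]) (fun p _ => hφd p)
    (by rwa [hu]) (by rwa [hu])
  have hleft : (∫ p in b..c, (((1 / Y p + k (Y p)) * -(Λ * Y p / D p) : ℝ) : ℂ) *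
        Complex.exp (Complex.I * (φ p : ℝ))) =
      -Λ * ∫ p in b..c, (((1 + Y p * k (Y p)) / D p : ℝ) : ℂ) *
        Complex.exp (Complex.I * (φ p : ℝ)) := by
    rw [← intervalIntegral.integral_const_mul]
    refine intervalIntegral.integral_congr fun p hp => ?_
    rw [hu] at hp
    have := hYne p hp
    have := (hD0 p).ne'
    have e : (1 / Y p + k (Y p)) * -(Λ * Y p / D p) = -Λ * ((1 + Y p * k (Y p)) / D p) := by
      field_simp
    rw [e]; push_cast; ring
  rw [hleft] at hparts
  -- second integration by parts
  set χ : ℝ → ℝ := fun y => ψ y * Real.sqrt (1 + y ^ 2) / y with hχ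
  have hfar := fun p hp => far_amplitude hk hr hr1 (hy p hp)
  have hχ0 : ∀ p ∈ Set.Icc b c, |χ (Y p)| ≤ 4 / r ^ 3 := fun p hp => (hfar p hp).1
  have hχ1 : ∀ p ∈ Set.Icc b c, ∃ d, HasDerivAt χ d (Y p) ∧ |d| ≤ 10 / r ^ 2 * (1 / Y p ^ 2) :=
    fun p hp => (hfar p hp).2
  choose! d hd hdle using hχ1
  have hcos : ∀ p ∈ Set.Icc b c, 0 ≤ Real.cos p := fun p hp =>
    Real.cos_nonneg_of_mem_Icc ⟨hb.trans hp.1, hp.2.trans hc⟩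
  -- The majorant is a primitive of 10 y'/(r² y²) + 4/r³. Its increment is bounded through |1/y| ≤
  -- 1/r and the length of the interval, independently of μ.
  have hrest := norm_integral_mul_deriv_phase_le (a := b) (b := c)
    (g := fun p => χ (Y p) * Real.cos p)
    (g' := fun p => d p * (Real.cos p * Real.sqrt (1 + Y p ^ 2) / D p) * Real.cos p +
      χ (Y p) * -Real.sin p) (Ψ := φ) (Ψ' := fun p => -(Λ * Y p / D p))
    (β := fun p => 10 / r ^ 2 * (-(Y p)⁻¹) + 4 / r ^ 3 * p)
    (β' := fun p => 10 / r ^ 2 * ((Real.cos p * Real.sqrt (1 + Y p ^ 2) / D p) / Y p ^ 2) +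
      4 / r ^ 3) hbc
    (fun p hp => ((hd p hp).comp p (hYd p)).mul (Real.hasDerivAt_cos p))
    (fun p _ => hφd p) hφ'c
    (fun p hp => by
      refine ((((hYd p).inv (hYne p hp)).neg.const_mul (10 / r ^ 2)).add
        ((hasDerivAt_id p).const_mul (4 / r ^ 3))).congr_deriv ?_
      ring)
    (fun p hp => by
      have hc0 := hcos p hp
      have hc1 := Real.cos_le_one p
      have hY' : 0 ≤ Real.cos p * Real.sqrt (1 + Y p ^ 2) / D p := by
        have := hD0 p; positivity
      refine (abs_add_le _ _).trans (add_le_add ?_ ?_)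
      · rw [abs_mul, abs_mul, abs_of_nonneg hc0, abs_of_nonneg hY']
        calc _ ≤ 10 / r ^ 2 * (1 / Y p ^ 2) * (Real.cos p * Real.sqrt (1 + Y p ^ 2) / D p) * 1 := by
              gcongr
              exact hdle p hp
          _ = _ := by ring
      · rw [abs_mul, abs_neg]
        calc _ ≤ 4 / r ^ 3 * 1 := by
              gcongr
              · exact hχ0 p hp
              · exact Real.abs_sin_le_one p
          _ = _ := mul_one _)
  have hright : (∫ p in b..c, ((χ (Y p) * Real.cos p * -(Λ * Y p / D p) : ℝ) : ℂ) *
        Complex.exp (Complex.I * (φ p : ℝ))) =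
      -Λ * ∫ p in b..c, (g' p : ℂ) * Complex.exp (Complex.I * (φ p : ℝ)) := by
    rw [← intervalIntegral.integral_const_mul]
    refine intervalIntegral.integral_congr fun p hp => ?_
    rw [hu] at hp
    have := hYne p hp
    have := (hD0 p).ne'
    have e : χ (Y p) * Real.cos p * -(Λ * Y p / D p) = -Λ * g' p := by
      simp only [hχ, hg']; field_simp
    rw [e]; push_cast; ring
  rw [hright] at hrest
  set J := ∫ p in b..c, (((1 + Y p * k (Y p)) / D p : ℝ) : ℂ) *
        Complex.exp (Complex.I * (φ p : ℝ))
  set K := ∫ p in b..c, (g' p : ℂ) * Complex.exp (Complex.I * (φ p : ℝ))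
  have hJ : J - Complex.I / Λ * (((1 / Y c + k (Y c) : ℝ) : ℂ) *
            Complex.exp (Complex.I * (φ c : ℝ)) -
          ((1 / Y b + k (Y b) : ℝ) : ℂ) * Complex.exp (Complex.I * (φ b : ℝ))) =
      Complex.I * (1 / Λ) ^ 2 * (-Λ * K) := by
    field_simp
    linear_combination (-1 : ℂ) * hparts
  rw [hJ, norm_mul, norm_mul, Complex.norm_I, one_mul, norm_pow, norm_div, norm_one,
    Complex.norm_real, Real.norm_eq_abs, abs_of_pos hΛ, mul_comm]
  refine mul_le_mul_of_nonneg_right (hrest.trans ?_) (by positivity)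
  have hbm := Set.left_mem_Icc.2 hbc
  have hcm := Set.right_mem_Icc.2 hbc
  have n1 : ∀ p ∈ Set.Icc b c, |χ (Y p) * Real.cos p| ≤ 4 / r ^ 3 := fun p hp => by
    rw [abs_mul]
    exact (mul_le_of_le_one_right (abs_nonneg _) (Real.abs_cos_le_one p)).trans (hχ0 p hp)
  have n2 : ∀ p ∈ Set.Icc b c, |(Y p)⁻¹| ≤ 1 / r := fun p hp => by
    rw [abs_inv, ← one_div]
    exact one_div_le_one_div_of_le hr (hy p hp)
  have m1 := n1 b hbm
  have m2 := n1 c hcm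
  have m3 := (abs_le.1 (n2 b hbm)).2
  have m4 := (abs_le.1 (n2 c hcm)).1
  have hpi := Real.pi_le_four
  have t1 : 10 / r ^ 2 * ((Y b)⁻¹ - (Y c)⁻¹) ≤ 10 / r ^ 2 * (1 / r + 1 / r) := by
    gcongr; linarith
  have t2 : 4 / r ^ 3 * (c - b) ≤ 4 / r ^ 3 * 4 := by gcongr; linarith
  have t3 : 10 / r ^ 2 * (1 / r + 1 / r) = 20 / r ^ 3 := by field_simp; norm_num
  have t4 : 50 / r ^ 3 = 4 / r ^ 3 + 4 / r ^ 3 + (20 / r ^ 3 + 4 / r ^ 3 * 4) + 6 / r ^ 3 := by ring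
  have t5 : 0 < 6 / r ^ 3 := by positivity
  linarith

end

/-! ### The coordinate y as a parameter for the momentum. -/

/-- The hyperbolic sine of a rapidity with hyperbolic sine `y`, shifted by the rapidity of the
velocity `v`, where `a = (1 - v²)^{-1/2}`. -/
noncomputable def boostSinh (v a y : ℝ) : ℝ := v * a * Real.sqrt (1 + y ^ 2) + a * y

/-- The hyperbolic cosine of a rapidity with hyperbolic sine `y`, shifted by the rapidity of the
velocity `v`, where `a = (1 - v²)^{-1/2}`. -/
noncomputable def boostCosh (v a y : ℝ) : ℝ := v * a * y + a * Real.sqrt (1 + y ^ 2)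

/-- The momentum in `[-π/2, π/2]` whose rapidity relative to the velocity `v` has hyperbolic
sine `y`. -/
noncomputable def boostMomentum (μ v a y : ℝ) : ℝ := Real.arcsin (μ * boostSinh v a y)

/-- The square of the denominator in `dp / √(μ² + sin² p) = dy / √(boostDenom y)`. -/
noncomputable def boostDenom (μ v a y : ℝ) : ℝ := (1 - (μ * boostSinh v a y) ^ 2) * (1 + y ^ 2)

/-- The derivative of `boostDenom`. -/
noncomputable def boostDenom₁ (μ v a y : ℝ) : ℝ :=
  2 * y * (1 - (μ * boostSinh v a y) ^ 2) -
    2 * ((μ * boostSinh v a y) * (μ * boostCosh v a y) * Real.sqrt (1 + y ^ 2))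

/-- The second derivative of `boostDenom`. -/
noncomputable def boostDenom₂ (μ v a y : ℝ) : ℝ :=
  2 * (1 - (μ * boostSinh v a y) ^ 2) -
    4 * (y * (μ * boostSinh v a y) * (μ * boostCosh v a y) / Real.sqrt (1 + y ^ 2)) -
    2 * ((μ * boostCosh v a y) ^ 2 + (μ * boostSinh v a y) ^ 2 +
      (μ * boostSinh v a y) * (μ * boostCosh v a y) * y / Real.sqrt (1 + y ^ 2))

/-- The amplitude of the lattice propagator in the coordinate `y`. -/
noncomputable def boostAmplitude (μ v a y : ℝ) : ℝ := (Real.sqrt (boostDenom μ v a y))⁻¹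

/-- The derivative of `boostAmplitude`. -/
noncomputable def boostAmplitude₁ (μ v a y : ℝ) : ℝ :=
  -(boostDenom₁ μ v a y / 2) * boostAmplitude μ v a y ^ 3

/-- The second derivative of `boostAmplitude`. -/
noncomputable def boostAmplitude₂ (μ v a y : ℝ) : ℝ :=
  -(boostDenom₂ μ v a y / 2) * boostAmplitude μ v a y ^ 3 +
    -(boostDenom₁ μ v a y / 2) * (3 * boostAmplitude μ v a y ^ 2 * boostAmplitude₁ μ v a y)

theorem sqrt_one_add_sq_pos (y : ℝ) : 0 < Real.sqrt (1 + y ^ 2) := Real.sqrt_pos.2 (by positivity)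

theorem sq_sqrt_one_add_sq (y : ℝ) : Real.sqrt (1 + y ^ 2) ^ 2 = 1 + y ^ 2 :=
  Real.sq_sqrt (by positivity)

theorem abs_lt_sqrt_one_add_sq (y : ℝ) : |y| < Real.sqrt (1 + y ^ 2) := by
  rw [← Real.sqrt_sq_eq_abs]
  exact Real.sqrt_lt_sqrt (sq_nonneg y) (by linarith)

theorem one_le_sqrt_one_add_sq (y : ℝ) : 1 ≤ Real.sqrt (1 + y ^ 2) := by
  rw [Real.one_le_sqrt]; linarith [sq_nonneg y]

section

variable {μ v a y : ℝ}

theorem abs_lt_one_of_boost (hav : a ^ 2 * (1 - v ^ 2) = 1) : |v| < 1 := by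
  rw [← sq_lt_one_iff_abs_lt_one]
  by_contra h
  push Not at h
  nlinarith [sq_nonneg a]

theorem boostCosh_sq (hav : a ^ 2 * (1 - v ^ 2) = 1) (y : ℝ) :
    boostCosh v a y ^ 2 = 1 + boostSinh v a y ^ 2 := by
  have h := sq_sqrt_one_add_sq y
  rw [boostCosh, boostSinh]
  linear_combination a ^ 2 * (1 - v ^ 2) * h + hav

theorem boostCosh_pos (ha : 0 < a) (hav : a ^ 2 * (1 - v ^ 2) = 1) (y : ℝ) :
    0 < boostCosh v a y := by
  have hv := abs_lt_one_of_boost hav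
  have h1 := abs_lt_sqrt_one_add_sq y
  have h2 : -(|v| * |y|) ≤ v * y := by rw [← abs_mul]; exact neg_abs_le _
  have h3 : |v| * |y| ≤ 1 * |y| := by gcongr
  have : 0 < v * y + Real.sqrt (1 + y ^ 2) := by linarith
  rw [boostCosh]
  nlinarith

theorem hasDerivAt_boostSinh (v a y : ℝ) :
    HasDerivAt (boostSinh v a) (boostCosh v a y / Real.sqrt (1 + y ^ 2)) y := by
  refine (((hasDerivAt_sqrt_one_add_sq y).const_mul (v * a)).add
    ((hasDerivAt_id y).const_mul a)).congr_deriv ?_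
  have := (sqrt_one_add_sq_pos y).ne'
  rw [boostCosh]; field_simp

theorem hasDerivAt_boostCosh (v a y : ℝ) :
    HasDerivAt (boostCosh v a) (boostSinh v a y / Real.sqrt (1 + y ^ 2)) y := by
  refine (((hasDerivAt_id y).const_mul (v * a)).add
    ((hasDerivAt_sqrt_one_add_sq y).const_mul a)).congr_deriv ?_
  have := (sqrt_one_add_sq_pos y).ne'
  rw [boostSinh]; field_simp

theorem hasDerivAt_boostDenom (μ v a y : ℝ) :
    HasDerivAt (boostDenom μ v a) (boostDenom₁ μ v a y) y := by
  refine (((((hasDerivAt_boostSinh v a y).const_mul μ).fun_pow 2).const_sub 1).mul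
    ((hasDerivAt_pow 2 y).const_add 1)).congr_deriv ?_
  have h0 := (sqrt_one_add_sq_pos y).ne'
  have h := sq_sqrt_one_add_sq y
  rw [boostDenom₁]
  generalize Real.sqrt (1 + y ^ 2) = q at *
  push_cast
  rw [← h]
  field_simp
  ring

theorem hasDerivAt_boostDenom₁ (μ v a y : ℝ) :
    HasDerivAt (boostDenom₁ μ v a) (boostDenom₂ μ v a y) y := by
  have hw := (hasDerivAt_boostSinh v a y).const_mul μ
  have hu := (hasDerivAt_boostCosh v a y).const_mul μ
  refine ((((hasDerivAt_id y).const_mul 2).mul ((hw.fun_pow 2).const_sub 1)).sub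
    (((hw.mul hu).mul (hasDerivAt_sqrt_one_add_sq y)).const_mul 2)).congr_deriv ?_
  have h0 := (sqrt_one_add_sq_pos y).ne'
  rw [boostDenom₂]
  simp only [id, Pi.mul_apply]
  push_cast
  field_simp
  ring

theorem hasDerivAt_boostAmplitude (hQ : 0 < boostDenom μ v a y) :
    HasDerivAt (boostAmplitude μ v a) (boostAmplitude₁ μ v a y) y := by
  have h0 : Real.sqrt (boostDenom μ v a y) ≠ 0 := (Real.sqrt_pos.2 hQ).ne'
  refine (((hasDerivAt_boostDenom μ v a y).sqrt hQ.ne').inv h0).congr_deriv ?_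
  rw [boostAmplitude₁, boostAmplitude]
  field_simp

theorem hasDerivAt_boostAmplitude₁ (hQ : 0 < boostDenom μ v a y) :
    HasDerivAt (boostAmplitude₁ μ v a) (boostAmplitude₂ μ v a y) y := by
  refine ((((hasDerivAt_boostDenom₁ μ v a y).div_const 2).neg).mul
    ((hasDerivAt_boostAmplitude hQ).fun_pow 3)).congr_deriv ?_
  rw [boostAmplitude₂]
  simp

theorem boostAmplitude_eq (y : ℝ) : boostAmplitude μ v a y =
    1 / (Real.sqrt (1 - (μ * boostSinh v a y) ^ 2) * Real.sqrt (1 + y ^ 2)) := by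
  rw [boostAmplitude, boostDenom, Real.sqrt_mul' _ (by positivity), one_div]

theorem sin_boostMomentum (h : |μ * boostSinh v a y| ≤ 1) :
    Real.sin (boostMomentum μ v a y) = μ * boostSinh v a y :=
  Real.sin_arcsin (abs_le.1 h).1 (abs_le.1 h).2

theorem latticeEnergy_boostMomentum (hμ : 0 < μ) (ha : 0 < a) (hav : a ^ 2 * (1 - v ^ 2) = 1)
    (h : |μ * boostSinh v a y| ≤ 1) :
    latticeEnergy μ (boostMomentum μ v a y) = μ * boostCosh v a y := by
  have := boostCosh_pos ha hav y
  rw [latticeEnergy, sin_boostMomentum h, ← Real.sqrt_sq (by positivity : 0 ≤ μ * boostCosh v a y)]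
  congr 1
  rw [mul_pow μ (boostCosh v a y), boostCosh_sq hav]; ring

/-- Boosting by v and back is the identity, by a²(1 - v²) = 1. -/
theorem relSinh_boostMomentum (hμ : 0 < μ) (ha : 0 < a) (hav : a ^ 2 * (1 - v ^ 2) = 1)
    (h : |μ * boostSinh v a y| ≤ 1) : relSinh μ v a (boostMomentum μ v a y) = y := by
  rw [relSinh, latticeEnergy_boostMomentum hμ ha hav h, sin_boostMomentum h, boostSinh, boostCosh]
  field_simp
  linear_combination y * hav

/-- From cos p dp = μ cosh η dη and dη = dy / √(1+y²), that is dp = D G dy. -/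
theorem hasDerivAt_boostMomentum (hμ : 0 < μ) (ha : 0 < a) (hav : a ^ 2 * (1 - v ^ 2) = 1)
    (h : |μ * boostSinh v a y| < 1) :
    HasDerivAt (boostMomentum μ v a)
      (latticeEnergy μ (boostMomentum μ v a y) * boostAmplitude μ v a y) y := by
  have h1 := abs_lt.1 h
  refine ((Real.hasDerivAt_arcsin h1.1.ne' h1.2.ne).comp y
    ((hasDerivAt_boostSinh v a y).const_mul μ)).congr_deriv ?_
  rw [latticeEnergy_boostMomentum hμ ha hav h.le, boostAmplitude_eq]
  have : Real.sqrt (1 - (μ * boostSinh v a y) ^ 2) ≠ 0 :=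
    (Real.sqrt_pos.2 (by have := (sq_lt_one_iff_abs_lt_one _).2 h; linarith)).ne'
  have := (sqrt_one_add_sq_pos y).ne'
  field_simp

/-- The phase in the coordinate `y`, normalized by its large parameter. -/
noncomputable def boostPhase (μ v a l y : ℝ) : ℝ :=
  (latticePhase μ (v * l) l (boostMomentum μ v a 0) -
    latticePhase μ (v * l) l (boostMomentum μ v a y)) / (l * μ / a)

/-- The Jacobian D G cancels the 1/D in the phase derivative, leaving yG as `StationaryPhase`
requires. -/
theorem hasDerivAt_boostPhase (hμ : 0 < μ) (ha : 0 < a) (hav : a ^ 2 * (1 - v ^ 2) = 1)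
    {l : ℝ} (hl : 0 < l) (h : |μ * boostSinh v a y| < 1) :
    HasDerivAt (boostPhase μ v a l) (y * boostAmplitude μ v a y) y := by
  refine ((((hasDerivAt_latticePhase hμ hav l (boostMomentum μ v a y)).comp y
    (hasDerivAt_boostMomentum hμ ha hav h)).const_sub _).div_const (l * μ / a)).congr_deriv ?_
  rw [relSinh_boostMomentum hμ ha hav h.le]
  have := (latticeEnergy_pos hμ (boostMomentum μ v a y)).ne'
  field_simp

/-! ### Bounds depending on Δ only. -/

/-- The velocity `v` is bounded away from the maximal group velocity, quantitatively in `Δ`. -/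
structure Subluminal (μ v a Δ : ℝ) : Prop where
  mass_pos : 0 < μ
  mass_le : μ ≤ 1
  pos : 0 < a
  boost : a ^ 2 * (1 - v ^ 2) = 1
  gap_pos : 0 < Δ
  gap_lt : Δ < 1
  boost_le : a * Δ ≤ 1
  gap_le : Δ ≤ 1 - (μ * (v * a)) ^ 2

namespace Subluminal

variable {Δ : ℝ}

/-- At y = 0 the gap gives |μva| ≤ 1 - Δ/2. Moving y changes μ sinh by at most 2a|y|, and the radius
Δ²/8 is chosen so that aΔ ≤ 1 bounds this by Δ/4. Thus p stays away from ±π/2, where G blows up. -/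
theorem abs_boostSinh_le (h : Subluminal μ v a Δ) (hy : |y| ≤ Δ ^ 2 / 8) :
    |μ * boostSinh v a y| ≤ 1 - Δ / 4 := by
  have hΔ := h.gap_pos
  have hΔ1 := h.gap_lt
  have ha := h.pos
  have hμ := h.mass_pos
  have h0 : |μ * (v * a)| ≤ 1 - Δ / 2 := by
    apply abs_le_of_sq_le_sq _ (by linarith)
    nlinarith [h.gap_le]
  have hv := (abs_lt_one_of_boost h.boost).le
  have hq : Real.sqrt (1 + y ^ 2) - 1 ≤ |y| := by
    rw [sub_le_iff_le_add, Real.sqrt_le_left (by positivity), ← sq_abs y]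
    nlinarith [abs_nonneg y]
  have hq1 := one_le_sqrt_one_add_sq y
  have e : μ * boostSinh v a y =
      μ * (v * a) + μ * (a * (v * (Real.sqrt (1 + y ^ 2) - 1) + y)) := by rw [boostSinh]; ring
  have h2 : |v * (Real.sqrt (1 + y ^ 2) - 1) + y| ≤ 2 * (Δ ^ 2 / 8) := by
    refine (abs_add_le _ _).trans ?_
    rw [abs_mul, abs_of_nonneg (by linarith : 0 ≤ Real.sqrt (1 + y ^ 2) - 1)]
    nlinarith [abs_nonneg v, abs_nonneg y]
  have h3 : |μ * (a * (v * (Real.sqrt (1 + y ^ 2) - 1) + y))| ≤ Δ / 4 := by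
    rw [abs_mul, abs_mul, abs_of_pos hμ, abs_of_pos ha]
    calc _ ≤ 1 * (a * (2 * (Δ ^ 2 / 8))) := by
          gcongr; exact h.mass_le
      _ = (a * Δ) * (Δ / 4) := by ring
      _ ≤ 1 * (Δ / 4) := by gcongr; exact h.boost_le
      _ = _ := one_mul _
  rw [e]
  linarith [abs_add_le (μ * (v * a)) (μ * (a * (v * (Real.sqrt (1 + y ^ 2) - 1) + y)))]

theorem abs_boostSinh_lt (h : Subluminal μ v a Δ) (hy : |y| ≤ Δ ^ 2 / 8) :
    |μ * boostSinh v a y| < 1 := by linarith [h.abs_boostSinh_le hy, h.gap_pos]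

theorem boostDenom_bounds (h : Subluminal μ v a Δ) (hy : |y| ≤ Δ ^ 2 / 8) :
    Δ / 4 ≤ boostDenom μ v a y ∧ boostDenom μ v a y ≤ 2 := by
  have hΔ := h.gap_pos
  have hΔ1 := h.gap_lt
  have h1 := h.abs_boostSinh_le hy
  have h2 : (μ * boostSinh v a y) ^ 2 ≤ (1 - Δ / 4) ^ 2 := by
    rw [← sq_abs]; exact pow_le_pow_left₀ (abs_nonneg _) h1 2
  have h3 : Δ / 4 ≤ 1 - (μ * boostSinh v a y) ^ 2 := by nlinarith
  have h4 : y ^ 2 ≤ 1 := by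
    rw [← sq_abs]
    exact pow_le_one₀ (abs_nonneg _) (hy.trans (by nlinarith))
  rw [boostDenom]
  constructor
  · nlinarith [sq_nonneg y]
  · nlinarith [sq_nonneg y, sq_nonneg (μ * boostSinh v a y)]

theorem abs_boostDenom₁_le (h : Subluminal μ v a Δ) (hy : |y| ≤ Δ ^ 2 / 8) :
    |boostDenom₁ μ v a y| ≤ 9 ∧ |boostDenom₂ μ v a y| ≤ 14 := by
  have hw := (h.abs_boostSinh_lt hy).le
  have hw2 : (μ * boostSinh v a y) ^ 2 ≤ 1 := (sq_le_one_iff_abs_le_one _).2 hw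
  -- Although a may be large, (μ cosh)² = μ² + (μ sinh)² is at most 2.
  have hu2 : (μ * boostCosh v a y) ^ 2 ≤ 2 := by
    rw [mul_pow, boostCosh_sq h.boost]
    nlinarith [h.mass_le, h.mass_pos]
  have hu : |μ * boostCosh v a y| ≤ 2 := by
    apply abs_le_of_sq_le_sq _ (by norm_num); linarith
  have hy1 : |y| ≤ 1 / 8 := hy.trans (by nlinarith [h.gap_pos, h.gap_lt])
  have hq2 : Real.sqrt (1 + y ^ 2) ≤ 5 / 4 := by
    rw [Real.sqrt_le_left (by norm_num), ← sq_abs y]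
    nlinarith [abs_nonneg y]
  have hyq : |y / Real.sqrt (1 + y ^ 2)| ≤ 1 / 8 := by
    rw [abs_div, abs_of_pos (sqrt_one_add_sq_pos y)]
    exact (div_le_self (abs_nonneg y) (one_le_sqrt_one_add_sq y)).trans hy1
  have hq0 := sqrt_one_add_sq_pos y
  rw [boostDenom₁, boostDenom₂]
  generalize μ * boostSinh v a y = w at *
  generalize μ * boostCosh v a y = u at *
  have hwu : |w * u| ≤ 2 := by
    rw [abs_mul]
    calc _ ≤ (1 : ℝ) * 2 := by gcongr
      _ = 2 := by norm_num
  have hd : |1 - w ^ 2| ≤ 1 := abs_le.2 ⟨by linarith [sq_nonneg w], by linarith [sq_nonneg w]⟩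
  constructor
  · have t1 : |2 * y * (1 - w ^ 2)| ≤ 1 / 4 := by
      rw [abs_mul, abs_mul, abs_two]
      nlinarith [abs_nonneg y, abs_nonneg (1 - w ^ 2)]
    have t2 : |2 * (w * u * Real.sqrt (1 + y ^ 2))| ≤ 2 * (2 * (5 / 4)) := by
      rw [abs_mul, abs_two, abs_mul, abs_of_pos hq0]
      gcongr
    linarith [abs_sub (2 * y * (1 - w ^ 2)) (2 * (w * u * Real.sqrt (1 + y ^ 2)))]
  · have t : |w * u * (y / Real.sqrt (1 + y ^ 2))| ≤ 2 * (1 / 8) := by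
      rw [abs_mul]; gcongr
    have e : 2 * (1 - w ^ 2) - 4 * (y * w * u / Real.sqrt (1 + y ^ 2)) -
        2 * (u ^ 2 + w ^ 2 + w * u * y / Real.sqrt (1 + y ^ 2)) =
        2 * (1 - w ^ 2) - 6 * (w * u * (y / Real.sqrt (1 + y ^ 2))) - 2 * (u ^ 2 + w ^ 2) := by
      ring
    rw [e]
    have := abs_le.1 t
    have := abs_le.1 hd
    rw [abs_le]
    constructor <;> linarith [sq_nonneg w, sq_nonneg u]

theorem boostAmplitude_bounds (h : Subluminal μ v a Δ) (hy : |y| ≤ Δ ^ 2 / 8) :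
    1 / 2 ≤ boostAmplitude μ v a y ∧ boostAmplitude μ v a y ≤ 2 / Δ := by
  have hΔ := h.gap_pos
  obtain ⟨h1, h2⟩ := h.boostDenom_bounds hy
  have hs : Real.sqrt (boostDenom μ v a y) ≤ 2 := by
    rw [Real.sqrt_le_left (by norm_num)]; linarith
  have hs' : Δ / 2 ≤ Real.sqrt (boostDenom μ v a y) := by
    apply Real.le_sqrt_of_sq_le
    nlinarith [h.gap_lt]
  rw [boostAmplitude]
  constructor
  · rw [one_div]; exact inv_anti₀ (by linarith) hs
  · rw [show 2 / Δ = (Δ / 2)⁻¹ by rw [inv_div]]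
    exact inv_anti₀ (by linarith) hs'

theorem boostAmplitude₁_bounds (h : Subluminal μ v a Δ) (hy : |y| ≤ Δ ^ 2 / 8) :
    |boostAmplitude₁ μ v a y| ≤ 36 / Δ ^ 3 ∧ |boostAmplitude₂ μ v a y| ≤ 2000 / Δ ^ 5 := by
  have hΔ := h.gap_pos
  obtain ⟨g1, g2⟩ := h.boostAmplitude_bounds hy
  obtain ⟨q1, q2⟩ := h.abs_boostDenom₁_le hy
  have g0 : 0 < boostAmplitude μ v a y := by linarith
  have f1 : |-(boostDenom₁ μ v a y / 2)| ≤ 9 / 2 := by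
    rw [abs_neg, abs_div, abs_two]; linarith
  have f2 : |-(boostDenom₂ μ v a y / 2)| ≤ 7 := by
    rw [abs_neg, abs_div, abs_two]; linarith
  have b1 : |boostAmplitude₁ μ v a y| ≤ 36 / Δ ^ 3 := by
    rw [boostAmplitude₁, abs_mul, abs_pow, abs_of_pos g0]
    calc _ ≤ 9 / 2 * (2 / Δ) ^ 3 := by gcongr
      _ = _ := by field_simp; norm_num
  refine ⟨b1, ?_⟩
  rw [boostAmplitude₂]
  have t1 : |-(boostDenom₂ μ v a y / 2) * boostAmplitude μ v a y ^ 3| ≤ 7 * (2 / Δ) ^ 3 := by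
    rw [abs_mul, abs_pow, abs_of_pos g0]
    gcongr
  have t2 : |-(boostDenom₁ μ v a y / 2) *
      (3 * boostAmplitude μ v a y ^ 2 * boostAmplitude₁ μ v a y)| ≤
      9 / 2 * (3 * (2 / Δ) ^ 2 * (36 / Δ ^ 3)) := by
    rw [abs_mul, abs_mul, abs_mul, abs_pow, abs_of_pos g0, abs_of_pos (by norm_num : (0 : ℝ) < 3)]
    gcongr
  refine (abs_add_le _ _).trans ((add_le_add t1 t2).trans ?_)
  have e : 7 * (2 / Δ) ^ 3 = 56 * Δ ^ 2 / Δ ^ 5 := by field_simp; norm_num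
  have e2 : 9 / 2 * (3 * (2 / Δ) ^ 2 * (36 / Δ ^ 3)) = 1944 / Δ ^ 5 := by field_simp; norm_num
  rw [e, e2, ← add_div]
  gcongr
  nlinarith [h.gap_lt, pow_le_one₀ hΔ.le h.gap_lt.le (n := 2)]

/-- The constant 2000/Δ⁵ comes from the second derivative of G and dominates the other bounds. The
reflected phase satisfies the same bounds because they are symmetric in y. -/
theorem stationaryPhase (h : Subluminal μ v a Δ) {l : ℝ} (hl : 0 < l) :
    StationaryPhase (Δ ^ 2 / 8) (2000 / Δ ^ 5) (boostPhase μ v a l) (boostAmplitude μ v a)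
      (boostAmplitude₁ μ v a) (boostAmplitude₂ μ v a) ∧
    StationaryPhase (Δ ^ 2 / 8) (2000 / Δ ^ 5) (fun y => boostPhase μ v a l (-y))
      (fun y => boostAmplitude μ v a (-y)) (fun y => -boostAmplitude₁ μ v a (-y))
      (fun y => boostAmplitude₂ μ v a (-y)) := by
  have hΔ := h.gap_pos
  have hΔ1 := h.gap_lt
  have p5 : Δ ^ 5 ≤ 1 := pow_le_one₀ hΔ.le hΔ1.le
  have one_le : 1 ≤ 2000 / Δ ^ 5 := by
    rw [le_div_iff₀ (by positivity)]; linarith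
  have r_pos : 0 < Δ ^ 2 / 8 := by positivity
  have r_le : Δ ^ 2 / 8 ≤ 1 := by nlinarith
  have zero : boostPhase μ v a l 0 = 0 := by rw [boostPhase, sub_self, zero_div]
  have lo : 1 / (2000 / Δ ^ 5) ≤ 1 / 2 := by
    rw [one_div_div]; linarith
  have hi : 2 / Δ ≤ 2000 / Δ ^ 5 := by
    rw [div_le_div_iff₀ hΔ (by positivity)]
    nlinarith [pow_le_one₀ hΔ.le hΔ1.le (n := 4)]
  have hi₁ : 36 / Δ ^ 3 ≤ 2000 / Δ ^ 5 := by
    rw [div_le_div_iff₀ (by positivity) (by positivity)]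
    have : Δ ^ 5 ≤ Δ ^ 3 := pow_le_pow_of_le_one hΔ.le hΔ1.le (by norm_num)
    nlinarith
  have hQ : ∀ {y}, |y| ≤ Δ ^ 2 / 8 → 0 < boostDenom μ v a y := fun hy => by
    linarith [(h.boostDenom_bounds hy).1]
  have hm : ∀ {y}, y ∈ Set.Icc 0 (Δ ^ 2 / 8) → |y| ≤ Δ ^ 2 / 8 := fun hy => by
    rw [abs_of_nonneg hy.1]; exact hy.2
  have hm' : ∀ {y}, y ∈ Set.Icc 0 (Δ ^ 2 / 8) → |-y| ≤ Δ ^ 2 / 8 := fun hy => by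
    rw [abs_neg]; exact hm hy
  refine ⟨⟨one_le, r_pos, r_le, zero, fun y hy => hasDerivAt_boostPhase h.mass_pos h.pos h.boost hl
      (h.abs_boostSinh_lt (hm hy)), fun y hy => hasDerivAt_boostAmplitude (hQ (hm hy)),
      fun y hy => hasDerivAt_boostAmplitude₁ (hQ (hm hy)),
      fun y hy => lo.trans (h.boostAmplitude_bounds (hm hy)).1,
      fun y hy => (h.boostAmplitude_bounds (hm hy)).2.trans hi,
      fun y hy => (h.boostAmplitude₁_bounds (hm hy)).1.trans hi₁,
      fun y hy => (h.boostAmplitude₁_bounds (hm hy)).2⟩,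
    ⟨one_le, r_pos, r_le, by simpa using zero, fun y hy => ?_, fun y hy => ?_, fun y hy => ?_,
      fun y hy => lo.trans (h.boostAmplitude_bounds (hm' hy)).1,
      fun y hy => (h.boostAmplitude_bounds (hm' hy)).2.trans hi,
      fun y hy => by rw [abs_neg]; exact (h.boostAmplitude₁_bounds (hm' hy)).1.trans hi₁,
      fun y hy => (h.boostAmplitude₁_bounds (hm' hy)).2⟩⟩
  · exact ((hasDerivAt_boostPhase h.mass_pos h.pos h.boost hl
      (h.abs_boostSinh_lt (hm' hy))).scomp y (hasDerivAt_neg y)).congr_deriv (by simp)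
  · exact ((hasDerivAt_boostAmplitude (hQ (hm' hy))).scomp y (hasDerivAt_neg y)).congr_deriv
      (by simp)
  · exact ((hasDerivAt_boostAmplitude₁ (hQ (hm' hy))).scomp y (hasDerivAt_neg y)).neg.congr_deriv
      (by simp)

end Subluminal

end

/-! ### The oscillatory integral over half a period. -/

section

variable {μ v a : ℝ}

theorem monotoneOn_relSinh (hμ : 0 < μ) (ha : 0 < a) (hav : a ^ 2 * (1 - v ^ 2) = 1) :
    MonotoneOn (relSinh μ v a) (Set.Icc (-(Real.pi / 2)) (Real.pi / 2)) := by
  have hd := hasDerivAt_relSinh hμ ha hav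
  refine monotoneOn_of_deriv_nonneg (convex_Icc _ _)
    (fun p _ => (hd p).continuousAt.continuousWithinAt)
    (fun p _ => (hd p).differentiableAt.differentiableWithinAt) fun p hp => ?_
  rw [(hd p).deriv]
  have := latticeEnergy_pos hμ p
  have := Real.cos_nonneg_of_mem_Icc (interior_subset hp)
  positivity

theorem continuous_relSinh (μ v a : ℝ) : Continuous (relSinh μ v a) := by
  have := continuous_latticeEnergy μ
  unfold relSinh
  fun_prop

/-- The asymptotics of the oscillatory integral over half a period of momenta: the contributions of
the stationary point and of the endpoints. -/
theorem Subluminal.norm_integral_sub_le {Δ : ℝ} (h : Subluminal μ v a Δ) {k k₁ k₂ : ℝ → ℝ}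
    (hk : Profile k k₁ k₂) {l ρ : ℝ} (hl : 0 < l) (hρ : 0 < ρ) (hρr : ρ ≤ Δ ^ 2 / 8)
    (hΛ : l * μ / a * ρ ^ 2 = 1) :
    ‖(∫ p in (-(Real.pi / 2))..(Real.pi / 2),
        (((1 + relSinh μ v a p * k (relSinh μ v a p)) / latticeEnergy μ p : ℝ) : ℂ) *
          Complex.exp (Complex.I * (latticePhase μ (v * l) l p : ℝ))) -
      (Complex.exp (Complex.I * (latticePhase μ (v * l) l (Real.arcsin (μ * (v * a))) : ℝ)) *
        (Real.sqrt (boostAmplitude μ v a 0) * (Real.sqrt (2 * Real.pi / (l * μ / a)) *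
          Complex.exp (-(Complex.I * (Real.pi / 4))))) +
      Complex.I / (l * μ / a : ℝ) *
        (((1 / relSinh μ v a (Real.pi / 2) + k (relSinh μ v a (Real.pi / 2)) : ℝ) : ℂ) *
            Complex.exp (Complex.I * (latticePhase μ (v * l) l (Real.pi / 2) : ℝ)) -
          ((1 / relSinh μ v a (-(Real.pi / 2)) + k (relSinh μ v a (-(Real.pi / 2))) : ℝ) : ℂ) *
            Complex.exp (Complex.I * (latticePhase μ (v * l) l (-(Real.pi / 2)) : ℝ))))‖ ≤
      (1000 * (2000 / Δ ^ 5) ^ 18 / (Δ ^ 2 / 8) ^ 2 + 100 / (Δ ^ 2 / 8) ^ 3) * ρ ^ 3 := by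
  obtain ⟨h₁, h₂⟩ := h.stationaryPhase hl
  have hμ := h.mass_pos
  have ha := h.pos
  have hav := h.boost
  have hr0 := h₁.r_pos
  have hr1 := h₁.r_le
  have hB := h₁.one_le
  have hΔ := h.gap_pos
  have hΔ1 := h.gap_lt
  have hB2 : 2 ≤ 2000 / Δ ^ 5 := by
    rw [le_div_iff₀ (by positivity)]; linarith [pow_le_one₀ hΔ.le hΔ1.le (n := 5)]
  have hbd : ∀ y : ℝ, 1 / (1 + y ^ 2) ≤ 1 := fun y => by
    rw [div_le_one (by positivity)]; linarith [sq_nonneg y]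
  have near := h₁.two_sided h₂ (k := k) (k₁ := k₁) (k₂ := k₂) (fun y _ => hk.fst y)
    (fun y _ => hk.snd y) (fun y _ => ((hk.bound₁ y).trans (hbd y)).trans hB)
    (fun y _ => (hk.bound₂ y).trans (by
      have := hbd y
      rw [show 2 / (1 + y ^ 2) = 2 * (1 / (1 + y ^ 2)) by ring]; linarith)) hρ hρr hΛ
  set r := Δ ^ 2 / 8 with hr
  set Λ := l * μ / a with hΛd
  set B := 2000 / Δ ^ 5
  have hΛ0 : 0 < Λ := by positivity
  set P := boostMomentum μ v a with hP
  set Y := relSinh μ v a with hY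
  set D := latticeEnergy μ with hD
  set φ := latticePhase μ (v * l) l with hφ
  set f : ℝ → ℂ := fun p => (((1 + Y p * k (Y p)) / D p : ℝ) : ℂ) *
    Complex.exp (Complex.I * (φ p : ℝ)) with hf
  have hkc : Continuous k := continuous_iff_continuousAt.2 fun y => (hk.fst y).continuousAt
  have hYc : Continuous Y := continuous_relSinh μ v a
  have hDc : Continuous D := continuous_latticeEnergy μ
  have hD0 : ∀ p, 0 < D p := latticeEnergy_pos hμ
  have hφc : Continuous φ := continuous_latticePhase _ _ _
  have hkY := hkc.comp hYc
  have hfc : Continuous f := by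
    have : Continuous fun p => (1 + Y p * k (Y p)) / D p :=
      (continuous_const.add (hYc.mul hkY)).div hDc fun p => (hD0 p).ne'
    fun_prop
  have habs : ∀ y ∈ Set.uIcc (-r) r, |y| ≤ r := fun y hy => by
    rw [Set.uIcc_of_le (by linarith)] at hy; exact abs_le.2 hy
  have hlt : ∀ y, |y| ≤ r → |μ * boostSinh v a y| < 1 := fun y hy => h.abs_boostSinh_lt hy
  have hPd : ∀ y ∈ Set.uIcc (-r) r,
      HasDerivAt P (D (P y) * boostAmplitude μ v a y) y := fun y hy =>
    hasDerivAt_boostMomentum hμ ha hav (hlt y (habs y hy))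
  have hPc : ContinuousOn P (Set.uIcc (-r) r) := fun y hy =>
    (hPd y hy).continuousAt.continuousWithinAt
  have hGc : ContinuousOn (boostAmplitude μ v a) (Set.uIcc (-r) r) := fun y hy =>
    (hasDerivAt_boostAmplitude (by
      linarith [(h.boostDenom_bounds (habs y hy)).1])).continuousAt.continuousWithinAt
  have hsub := intervalIntegral.integral_deriv_smul_comp hPd
    ((hDc.comp_continuousOn hPc).mul hGc) hfc
  have hYP : ∀ y, |y| ≤ r → Y (P y) = y := fun y hy =>
    relSinh_boostMomentum hμ ha hav (hlt y hy).le
  have hphase : ∀ y, Complex.exp (Complex.I * (φ (P y) : ℝ)) = Complex.exp (Complex.I *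
      (φ (P 0) : ℝ)) * Complex.exp (Complex.I * ((-(Λ * boostPhase μ v a l y) : ℝ) : ℂ)) :=
    fun y => by
      rw [← Complex.exp_add, ← mul_add, ← Complex.ofReal_add]
      congr 4
      rw [boostPhase, ← hφ, ← hP, ← hΛd]
      field_simp
      ring
  -- The substitution p = P(y), with the value of the phase at the stationary point factored out.
  have hchange : (∫ y in (-r)..r, (((1 + y * k y) * boostAmplitude μ v a y : ℝ) : ℂ) *
      Complex.exp (Complex.I * ((-(Λ * boostPhase μ v a l y) : ℝ) : ℂ))) * Complex.exp (Complex.I *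
      (φ (P 0) : ℝ)) = ∫ p in (P (-r))..(P r), f p := by
    rw [← hsub, ← intervalIntegral.integral_mul_const]
    refine intervalIntegral.integral_congr fun y hy => ?_
    have hD' := (hD0 (P y)).ne'
    have hDc' : ((D (P y) : ℝ) : ℂ) ≠ 0 := by exact_mod_cast hD'
    simp only [hf, Function.comp, hphase y, hYP y (habs y hy), Complex.real_smul]
    push_cast
    field_simp
  have hpi := Real.pi_pos
  have hmono := monotoneOn_relSinh hμ ha hav
  have hPm : ∀ y, P y ∈ Set.Icc (-(Real.pi / 2)) (Real.pi / 2) := fun y =>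
    Real.arcsin_mem_Icc _
  have hYr : Y (P r) = r := hYP r (abs_of_pos hr0).le
  have hYr' : Y (P (-r)) = -r := hYP (-r) (by rw [abs_neg, abs_of_pos hr0])
  have hright := norm_far_le hk hμ ha hav hl hr0 hr1 (hPm r).2 (hPm r).1 le_rfl fun p hp => by
    have := hmono (hPm r) ⟨(hPm r).1.trans hp.1, hp.2⟩ hp.1
    rw [← hY, hYr] at this
    exact this.trans (le_abs_self _)
  have hleft := norm_far_le hk hμ ha hav hl hr0 hr1 (hPm (-r)).1 le_rfl (hPm (-r)).2 fun p hp => by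
    have := hmono ⟨hp.1, hp.2.trans (hPm (-r)).2⟩ (hPm (-r)) hp.2
    rw [← hY, hYr'] at this
    exact le_trans (by linarith) (neg_le_abs _)
  rw [← hY, ← hφ, ← hD, ← hΛd] at hright hleft
  change ‖(∫ p in (P r)..(Real.pi / 2), f p) - _‖ ≤ _ at hright
  change ‖(∫ p in (-(Real.pi / 2))..(P (-r)), f p) - _‖ ≤ _ at hleft
  rw [hYr] at hright
  rw [hYr'] at hleft
  have hP0 : P 0 = Real.arcsin (μ * (v * a)) := by
    rw [hP, boostMomentum, boostSinh]; simp
  have hfi := fun b c => hfc.intervalIntegrable (μ := MeasureTheory.volume) b c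
  rw [← intervalIntegral.integral_add_adjacent_intervals (hfi _ (P (-r))) (hfi _ _),
    ← intervalIntegral.integral_add_adjacent_intervals (hfi (P (-r)) (P r)) (hfi _ _), ← hchange,
    ← hP0]
  rw [hphase r] at hright
  rw [hphase (-r)] at hleft
  have hE : ‖Complex.exp (Complex.I * (φ (P 0) : ℝ))‖ = 1 := norm_exp_I_mul _
  have near' := mul_le_mul_of_nonneg_right near (norm_nonneg (Complex.exp (Complex.I *
    (φ (P 0) : ℝ))))
  rw [← norm_mul, hE, mul_one] at near'
  have hΛρ : 1 / Λ = ρ ^ 2 := by field_simp; linarith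
  have hρ1 : ρ ≤ 1 := hρr.trans hr1
  have hρ4 : (1 / Λ) ^ 2 ≤ ρ ^ 3 := by
    -- The far pieces have error Λ⁻² = ρ⁴, better than needed.
    rw [hΛρ, ← pow_mul]; exact pow_le_pow_of_le_one hρ.le hρ1 (by norm_num)
  have hc : 50 / r ^ 3 * (1 / Λ) ^ 2 ≤ 50 / r ^ 3 * ρ ^ 3 := by gcongr
  -- The boundary terms at y = ±r of the near piece cancel those of the two far pieces; only the
  -- terms at ±π/2 survive.
  refine le_trans (le_of_eq ?_) ((norm_add₃_le).trans ((add_le_add (add_le_add near'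
    (hright.trans hc)) (hleft.trans hc)).trans (le_of_eq (by ring))))
  congr 1
  push_cast
  ring

end

/-! ### The symbols at δ = 0 and the Fourier integrals. -/

theorem stepNorm_zero (μ : ℝ) : stepNorm μ 0 = Real.sqrt (1 + μ ^ 2) := by
  simp [stepNorm]

/-- The square determines the root up to sign, and positivity of the real part selects the branch.
-/
theorem sineRoot_zero {μ : ℝ} (hμ : 0 < μ) (p : ℝ) :
    sineRoot μ 0 p = ((latticeEnergy μ p / Real.sqrt (1 + μ ^ 2) : ℝ) : ℂ) := by
  have hpos := sineRoot_re_pos hμ (δ := 0) ⟨le_rfl, one_pos⟩ p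
  have h2 : 0 < latticeEnergy μ p / Real.sqrt (1 + μ ^ 2) :=
    div_pos (latticeEnergy_pos hμ p) (Real.sqrt_pos.2 (by positivity))
  have hsq : sineRoot μ 0 p ^ 2 = ((latticeEnergy μ p / Real.sqrt (1 + μ ^ 2) : ℝ) : ℂ) ^ 2 := by
    have hx : 0 ≤ 1 - (Real.cos p / Real.sqrt (1 + μ ^ 2)) ^ 2 := by
      have := (sq_lt_one_iff_abs_lt_one _).2 (abs_cos_div_lt_one hμ p)
      linarith
    rw [sineRoot_sq, ← sqrt_one_sub_cos_div_sq, ← Complex.ofReal_pow, Real.sq_sqrt hx, halfTrace,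
      stepNorm_zero]
    push_cast
    simp
  rcases sq_eq_sq_iff_eq_or_eq_neg.1 hsq with h | h
  · exact h
  · rw [h, Complex.neg_re, Complex.ofReal_re] at hpos
    linarith

/-- λ = C - iR with C = cos ω and R = sin ω. -/
theorem smallEigenvalue_zero {μ : ℝ} (hμ : 0 < μ) (p : ℝ) :
    smallEigenvalue μ 0 p = Complex.exp (-(Complex.I * (latticeFrequency μ p : ℝ))) := by
  have h1 := abs_lt.1 (abs_cos_div_lt_one hμ p)
  have hc : Real.cos (latticeFrequency μ p) = Real.cos p / Real.sqrt (1 + μ ^ 2) :=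
    Real.cos_arccos h1.1.le h1.2.le
  have hs : Real.sin (latticeFrequency μ p) = latticeEnergy μ p / Real.sqrt (1 + μ ^ 2) := by
    rw [latticeFrequency, Real.sin_arccos, sqrt_one_sub_cos_div_sq]
  rw [smallEigenvalue, sineRoot_zero hμ, halfTrace, stepNorm_zero, ← hs,
    show -(Complex.I * (latticeFrequency μ p : ℝ)) =
      ((-latticeFrequency μ p : ℝ) : ℂ) * Complex.I by push_cast; ring, Complex.exp_mul_I,
    ← Complex.ofReal_cos, ← Complex.ofReal_sin, Real.cos_neg, Real.sin_neg, hc]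
  push_cast
  ring

theorem smallEigenvalue_zero_pow_mul_exp {μ : ℝ} (hμ : 0 < μ) (j : ℤ) {l : ℤ} (hl : 0 ≤ l)
    (p : ℝ) : smallEigenvalue μ 0 p ^ l.natAbs * Complex.exp (Complex.I * p * j) =
      Complex.exp (Complex.I * (latticePhase μ j l p : ℝ)) := by
  have : ((l.natAbs : ℕ) : ℂ) = (l : ℂ) := by
    rw [← Int.cast_natCast, Int.natAbs_of_nonneg hl]
  rw [smallEigenvalue_zero hμ, ← Complex.exp_nat_mul, ← Complex.exp_add, this, latticePhase]
  congr 1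
  push_cast
  ring

theorem latticePropagator₁_eq_integral {m ε : ℝ} (hm : 0 < m) (hε : 0 < ε) (j : ℤ) {l : ℤ}
    (hl : 0 ≤ l) : latticePropagator₁ j l m ε = Complex.I * ((m * ε : ℝ) : ℂ) / (2 * Real.pi) *
      ∫ p in (-Real.pi)..Real.pi, ((1 / latticeEnergy (m * ε) p : ℝ) : ℂ) *
        Complex.exp (Complex.I * (latticePhase (m * ε) j l p : ℝ)) := by
  have hμ := mul_pos hm hε
  rw [latticePropagator₁_eq hm hε, invFourier, div_eq_mul_one_div (Complex.I * _),
    mul_comm (Complex.I * _), mul_assoc (1 / (2 * (Real.pi : ℂ))),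
    ← intervalIntegral.integral_const_mul (Complex.I * ((m * ε : ℝ) : ℂ))]
  congr 1
  refine intervalIntegral.integral_congr fun p _ => ?_
  have hD : (latticeEnergy (m * ε) p : ℂ) ≠ 0 := by exact_mod_cast (latticeEnergy_pos hμ p).ne'
  have hn : (Real.sqrt (1 + (m * ε) ^ 2) : ℂ) ≠ 0 := by
    exact_mod_cast (Real.sqrt_pos.2 (by positivity : 0 < 1 + (m * ε) ^ 2)).ne'
  rw [symbol₁, sineRoot_zero hμ, stepNorm_zero, ← smallEigenvalue_zero_pow_mul_exp hμ j hl]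
  generalize Real.sqrt (1 + (m * ε) ^ 2) = n at *
  push_cast
  field_simp
  ring

theorem latticePropagator₂_eq_integral {m ε : ℝ} (hm : 0 < m) (hε : 0 < ε) (j : ℤ) {l : ℤ}
    (hl : 0 ≤ l) : latticePropagator₂ j l m ε = 1 / (2 * Real.pi) *
      ∫ p in (-Real.pi)..Real.pi, ((1 + Real.sin p / latticeEnergy (m * ε) p : ℝ) : ℂ) *
        Complex.exp (Complex.I * (latticePhase (m * ε) j l p : ℝ)) := by
  have hμ := mul_pos hm hε
  rw [latticePropagator₂_eq hm hε, invFourier]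
  refine congrArg _ (intervalIntegral.integral_congr fun p _ => ?_)
  have hD : (latticeEnergy (m * ε) p : ℂ) ≠ 0 := by exact_mod_cast (latticeEnergy_pos hμ p).ne'
  have hn : (Real.sqrt (1 + (m * ε) ^ 2) : ℂ) ≠ 0 := by
    exact_mod_cast (Real.sqrt_pos.2 (by positivity : 0 < 1 + (m * ε) ^ 2)).ne'
  rw [symbol₂, sineRoot_zero hμ, stepNorm_zero, ← smallEigenvalue_zero_pow_mul_exp hμ j hl,
    if_pos hl]
  generalize Real.sqrt (1 + (m * ε) ^ 2) = n at *
  push_cast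
  field_simp
  ring

/-! ### Folding the period of momenta. -/

theorem latticeFrequency_pi_sub (μ p : ℝ) :
    latticeFrequency μ (Real.pi - p) = Real.pi - latticeFrequency μ p := by
  rw [latticeFrequency, Real.cos_pi_sub, neg_div, Real.arccos_neg, latticeFrequency]

theorem latticeEnergy_pi_sub (μ p : ℝ) : latticeEnergy μ (Real.pi - p) = latticeEnergy μ p := by
  rw [latticeEnergy, Real.sin_pi_sub, latticeEnergy]

theorem relSinh_pi_sub (μ v a p : ℝ) : relSinh μ v a (Real.pi - p) = relSinh μ v a p := by
  rw [relSinh, Real.sin_pi_sub, latticeEnergy_pi_sub, relSinh]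

theorem latticeFrequency_add_two_pi (μ p : ℝ) :
    latticeFrequency μ (p + 2 * Real.pi) = latticeFrequency μ p := by
  rw [latticeFrequency, Real.cos_add_two_pi, latticeFrequency]

theorem latticeEnergy_add_two_pi (μ p : ℝ) :
    latticeEnergy μ (p + 2 * Real.pi) = latticeEnergy μ p := by
  rw [latticeEnergy, Real.sin_add_two_pi, latticeEnergy]

theorem relSinh_add_two_pi (μ v a p : ℝ) :
    relSinh μ v a (p + 2 * Real.pi) = relSinh μ v a p := by
  rw [relSinh, Real.sin_add_two_pi, latticeEnergy_add_two_pi, relSinh]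

/-- Since ω(π - p) = π - ω(p), the phase at π - p is (j - l)π minus the phase at p. -/
theorem exp_latticePhase_pi_sub (μ : ℝ) (j l : ℤ) (p : ℝ) :
    Complex.exp (Complex.I * (latticePhase μ j l (Real.pi - p) : ℝ)) =
      (-1) ^ (j - l) * (starRingEnd ℂ) (Complex.exp (Complex.I * (latticePhase μ j l p : ℝ))) := by
  rw [← Complex.exp_conj, ← Complex.exp_pi_mul_I, ← Complex.exp_int_mul, ← Complex.exp_add]
  congr 1
  rw [latticePhase, latticeFrequency_pi_sub, latticePhase, map_mul, Complex.conj_I,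
    Complex.conj_ofReal]
  push_cast
  ring

theorem exp_latticePhase_add_two_pi (μ : ℝ) (j l : ℤ) (p : ℝ) :
    Complex.exp (Complex.I * (latticePhase μ j l (p + 2 * Real.pi) : ℝ)) =
      Complex.exp (Complex.I * (latticePhase μ j l p : ℝ)) := by
  rw [Complex.exp_eq_exp_iff_exists_int]
  refine ⟨j, ?_⟩
  rw [latticePhase, latticeFrequency_add_two_pi, latticePhase]
  push_cast
  ring

/-- Folding the period of momenta to half a period. -/
theorem integral_fold (μ : ℝ) (j l : ℤ) {c : ℝ → ℝ} (hc : Continuous c)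
    (hper : ∀ p, c (p + 2 * Real.pi) = c p) (hsymm : ∀ p, c (Real.pi - p) = c p) :
    (∫ p in (-Real.pi)..Real.pi, (c p : ℂ) *
      Complex.exp (Complex.I * (latticePhase μ j l p : ℝ))) =
    (∫ p in (-(Real.pi / 2))..(Real.pi / 2), (c p : ℂ) *
      Complex.exp (Complex.I * (latticePhase μ j l p : ℝ))) +
    (-1) ^ (j - l) * (starRingEnd ℂ) (∫ p in (-(Real.pi / 2))..(Real.pi / 2), (c p : ℂ) *
      Complex.exp (Complex.I * (latticePhase μ j l p : ℝ))) := by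
  set f : ℝ → ℂ := fun p => (c p : ℂ) *
      Complex.exp (Complex.I * (latticePhase μ j l p : ℝ)) with hf
  have hfc : Continuous f := by
    have := continuous_latticePhase μ j l
    fun_prop
  have hfper : Function.Periodic f (2 * Real.pi) := fun p => by
    simp only [hf, hper, exp_latticePhase_add_two_pi]
  -- The period is moved to [-π/2, 3π/2], whose right half is the reflection of its left half under
  -- p ↦ π - p.
  have h1 := hfper.intervalIntegral_add_eq (-Real.pi) (-(Real.pi / 2))
  rw [show -Real.pi + 2 * Real.pi = Real.pi by ring,
    show -(Real.pi / 2) + 2 * Real.pi = Real.pi - -(Real.pi / 2) by ring] at h1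
  have h2 := intervalIntegral.integral_comp_sub_left (a := -(Real.pi / 2)) (b := Real.pi / 2) f
    Real.pi
  rw [show Real.pi - Real.pi / 2 = Real.pi / 2 by ring] at h2
  have hi := fun b c => hfc.intervalIntegrable (μ := MeasureTheory.volume) b c
  rw [h1, ← intervalIntegral.integral_add_adjacent_intervals (hi _ (Real.pi / 2)) (hi _ _), ← h2]
  congr 1
  have h3 : (starRingEnd ℂ) (∫ p in (-(Real.pi / 2))..(Real.pi / 2), f p) =
      ∫ p in (-(Real.pi / 2))..(Real.pi / 2), (starRingEnd ℂ) (f p) := by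
    rw [intervalIntegral.intervalIntegral_eq_integral_uIoc,
      intervalIntegral.intervalIntegral_eq_integral_uIoc, integral_conj]
    split_ifs <;> simp
  rw [h3, ← intervalIntegral.integral_const_mul]
  refine intervalIntegral.integral_congr fun p _ => ?_
  simp only [hf, hsymm, exp_latticePhase_pi_sub, map_mul, Complex.conj_ofReal]
  ring

theorem latticePhase_pi_div_two (μ j l : ℝ) :
    latticePhase μ j l (Real.pi / 2) = (j - l) / 2 * Real.pi := by
  rw [latticePhase, latticeFrequency, Real.cos_pi_div_two, zero_div, Real.arccos_zero]; ring

theorem latticePhase_neg_pi_div_two (μ j l : ℝ) :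
    latticePhase μ j l (-(Real.pi / 2)) = (-j - l) / 2 * Real.pi := by
  rw [latticePhase, latticeFrequency, Real.cos_neg, Real.cos_pi_div_two, zero_div,
    Real.arccos_zero]; ring

theorem sin_half_mul_pi {j : ℤ} (h : Even j) : Real.sin ((j : ℝ) / 2 * Real.pi) = 0 := by
  obtain ⟨i, rfl⟩ := h
  rw [show ((i + i : ℤ) : ℝ) / 2 = i by push_cast; ring, Real.sin_int_mul_pi]

theorem cos_half_mul_pi {j : ℤ} (h : Odd j) : Real.cos ((j : ℝ) / 2 * Real.pi) = 0 := by
  obtain ⟨i, rfl⟩ := h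
  rw [Real.cos_eq_zero_iff]
  exact ⟨i, by push_cast; ring⟩

/-- The asymptotics of the oscillatory integral over a period of momenta; the contributions of the
endpoints of the half period cancel. -/
theorem Subluminal.norm_integral_period_sub_le {μ v a Δ : ℝ} (h : Subluminal μ v a Δ)
    {k k₁ k₂ : ℝ → ℝ} (hk : Profile k k₁ k₂) {j l : ℤ} {ρ : ℝ} (hl : 0 < (l : ℝ)) (hv : v * l = j)
    (hρ : 0 < ρ) (hρr : ρ ≤ Δ ^ 2 / 8) (hΛ : l * μ / a * ρ ^ 2 = 1) {A ϑ : ℝ}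
    (hA : A = Real.sqrt (boostAmplitude μ v a 0) * Real.sqrt (2 * Real.pi / (l * μ / a)))
    (hϑ : latticePhase μ j l (Real.arcsin (μ * (v * a))) = -ϑ) :
    (Even (j + l) →
      ‖(∫ p in (-Real.pi)..Real.pi,
        (((1 + relSinh μ v a p * k (relSinh μ v a p)) / latticeEnergy μ p : ℝ) : ℂ) *
          Complex.exp (Complex.I * (latticePhase μ j l p : ℝ))) -
        ((2 * (A * Real.cos (ϑ + Real.pi / 4)) : ℝ) : ℂ)‖ ≤
      2 * ((1000 * (2000 / Δ ^ 5) ^ 18 / (Δ ^ 2 / 8) ^ 2 + 100 / (Δ ^ 2 / 8) ^ 3) * ρ ^ 3)) ∧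
    (Odd (j + l) →
      ‖(∫ p in (-Real.pi)..Real.pi,
        (((1 + relSinh μ v a p * k (relSinh μ v a p)) / latticeEnergy μ p : ℝ) : ℂ) *
          Complex.exp (Complex.I * (latticePhase μ j l p : ℝ))) +
        Complex.I * ((2 * (A * Real.sin (ϑ + Real.pi / 4)) : ℝ) : ℂ)‖ ≤
      2 * ((1000 * (2000 / Δ ^ 5) ^ 18 / (Δ ^ 2 / 8) ^ 2 + 100 / (Δ ^ 2 / 8) ^ 3) * ρ ^ 3)) := by
  have hmain := h.norm_integral_sub_le hk hl hρ hρr hΛ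
  rw [hv, hϑ] at hmain
  generalize (1000 * (2000 / Δ ^ 5) ^ 18 / (Δ ^ 2 / 8) ^ 2 + 100 / (Δ ^ 2 / 8) ^ 3) * ρ ^ 3 = err
    at *
  have hkc : Continuous k := continuous_iff_continuousAt.2 fun y => (hk.fst y).continuousAt
  have hYc := continuous_relSinh μ v a
  have hcc : Continuous fun p => (1 + relSinh μ v a p * k (relSinh μ v a p)) / latticeEnergy μ p :=
    (continuous_const.add (hYc.mul (hkc.comp hYc))).div (continuous_latticeEnergy μ)
      fun p => (latticeEnergy_pos h.mass_pos p).ne'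
  have hfold := integral_fold μ j l hcc
    (fun p => by simp only [relSinh_add_two_pi, latticeEnergy_add_two_pi])
    (fun p => by simp only [relSinh_pi_sub, latticeEnergy_pi_sub])
  rw [hfold]
  generalize (∫ p in (-(Real.pi / 2))..(Real.pi / 2),
    (((1 + relSinh μ v a p * k (relSinh μ v a p)) / latticeEnergy μ p : ℝ) : ℂ) *
          Complex.exp (Complex.I * (latticePhase μ j l p : ℝ))) = J at *
  generalize (1 / relSinh μ v a (Real.pi / 2) + k (relSinh μ v a (Real.pi / 2))) = g₁ at *
  generalize (1 / relSinh μ v a (-(Real.pi / 2)) + k (relSinh μ v a (-(Real.pi / 2)))) = g₂ at *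
  rw [latticePhase_pi_div_two, latticePhase_neg_pi_div_two] at hmain
  generalize l * μ / a = Λ at *
  have hmain' : Complex.exp (Complex.I * ((-ϑ : ℝ) : ℂ)) *
      (Real.sqrt (boostAmplitude μ v a 0) * (Real.sqrt (2 * Real.pi / Λ) *
          Complex.exp (-(Complex.I * (Real.pi / 4))))) =
      (A : ℂ) * Complex.exp (((-(ϑ + Real.pi / 4) : ℝ) : ℂ) * Complex.I) := by
    rw [hA, show ((-(ϑ + Real.pi / 4) : ℝ) : ℂ) * Complex.I =
      Complex.I * ((-ϑ : ℝ) : ℂ) + -(Complex.I * (Real.pi / 4)) by push_cast; ring, Complex.exp_add]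
    push_cast; ring
  rw [hmain', mul_comm Complex.I (((((j : ℝ) - l) / 2 * Real.pi : ℝ)) : ℂ),
    mul_comm Complex.I ((((-(j : ℝ) - l) / 2 * Real.pi : ℝ)) : ℂ)] at hmain
  have e₁ : ((j : ℝ) - l) / 2 * Real.pi = ((j - l : ℤ) : ℝ) / 2 * Real.pi := by push_cast; ring
  have e₂ : (-(j : ℝ) - l) / 2 * Real.pi = ((-j - l : ℤ) : ℝ) / 2 * Real.pi := by push_cast; ring
  rw [e₁, e₂] at hmain
  constructor
  · intro hjl
    have o₁ : Even (j - l) := by rw [Int.even_sub, ← Int.even_add]; exact hjl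
    have o₂ : Even (-j - l) := by rw [← neg_add']; exact hjl.neg
    -- The folded integral is twice the real part. For even parity the exponentials at ±π/2 are
    -- real, and the factor i/Λ makes both endpoint terms purely imaginary.
    have hre := (Complex.abs_re_le_norm _).trans hmain
    rw [o₁.neg_one_zpow, one_mul, Complex.add_conj, ← Complex.ofReal_sub, Complex.norm_real,
      Real.norm_eq_abs, ← mul_sub, abs_mul, abs_two]
    refine mul_le_mul_of_nonneg_left (le_trans (le_of_eq ?_) hre) (by norm_num)
    congr 1
    simp only [Complex.sub_re, Complex.add_re, Complex.mul_re, Complex.exp_ofReal_mul_I_re,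
      Complex.exp_ofReal_mul_I_im, Complex.ofReal_re, Complex.ofReal_im, Complex.div_ofReal_re,
      Complex.div_ofReal_im, Complex.sub_im, Complex.mul_im, Complex.I_re, Complex.I_im,
      sin_half_mul_pi o₁, sin_half_mul_pi o₂, Real.cos_neg]
    ring
  · intro hjl
    have o₁ : Odd (j - l) := by rw [Int.odd_sub, ← Int.odd_add]; exact hjl
    have o₂ : Odd (-j - l) := by rw [← neg_add']; exact hjl.neg
    -- For odd parity the folded integral is 2i times the imaginary part; the exponentials at ±π/2
    -- are imaginary, so the endpoint terms are real.
    have him := (Complex.abs_im_le_norm _).trans hmain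
    rw [o₁.neg_one_zpow, neg_one_mul, ← sub_eq_add_neg, Complex.sub_conj, mul_comm _ Complex.I,
      ← mul_add, ← Complex.ofReal_add, norm_mul, Complex.norm_I, one_mul, Complex.norm_real,
      Real.norm_eq_abs, ← mul_add, abs_mul, abs_two]
    refine mul_le_mul_of_nonneg_left (le_trans (le_of_eq ?_) him) (by norm_num)
    congr 1
    simp only [Complex.sub_im, Complex.add_im, Complex.mul_im, Complex.exp_ofReal_mul_I_re,
      Complex.exp_ofReal_mul_I_im, Complex.ofReal_re, Complex.ofReal_im, Complex.div_ofReal_re,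
      Complex.div_ofReal_im, Complex.sub_re, Complex.mul_re, Complex.I_re, Complex.I_im,
      cos_half_mul_pi o₁, cos_half_mul_pi o₂, Real.sin_neg]
    ring

/-! ### Amplitude profiles of the two components. -/

theorem profile_zero : Profile (fun _ => 0) (fun _ => 0) (fun _ => 0) where
  fst y := hasDerivAt_const y 0
  snd y := hasDerivAt_const y 0
  bound₁ y := by rw [abs_zero]; positivity
  bound₂ y := by rw [abs_zero]; positivity

/-- The profile `k` with `1 + y k(y) = √(1 + y²) + y`. -/
noncomputable def expProfile (y : ℝ) : ℝ := 1 + y / (1 + Real.sqrt (1 + y ^ 2))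

theorem one_add_mul_expProfile (y : ℝ) : 1 + y * expProfile y = Real.sqrt (1 + y ^ 2) + y := by
  have h := sq_sqrt_one_add_sq y
  have h0 := sqrt_one_add_sq_pos y
  rw [expProfile]
  generalize Real.sqrt (1 + y ^ 2) = q at *
  field_simp
  linear_combination -h

theorem profile_expProfile : Profile expProfile
    (fun y => 1 / (Real.sqrt (1 + y ^ 2) * (1 + Real.sqrt (1 + y ^ 2))))
    (fun y => -(y / Real.sqrt (1 + y ^ 2) * (1 + 2 * Real.sqrt (1 + y ^ 2)) /
      (Real.sqrt (1 + y ^ 2) * (1 + Real.sqrt (1 + y ^ 2))) ^ 2)) where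
  fst y := by
    have h := sq_sqrt_one_add_sq y
    have h0 := sqrt_one_add_sq_pos y
    have hq := hasDerivAt_sqrt_one_add_sq y
    refine (((hasDerivAt_id y).div (hq.const_add 1) (by positivity)).const_add 1).congr_deriv ?_
    simp only [id]
    generalize Real.sqrt (1 + y ^ 2) = q at *
    field_simp
    linear_combination h
  snd y := by
    have h0 := sqrt_one_add_sq_pos y
    have hq := hasDerivAt_sqrt_one_add_sq y
    refine ((hasDerivAt_const y (1 : ℝ)).div (hq.mul (hq.const_add 1)) (by
      simp only [Pi.mul_apply]; positivity)).congr_deriv ?_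
    simp only [Pi.mul_apply]
    generalize Real.sqrt (1 + y ^ 2) = q at *
    field_simp
    ring
  bound₁ y := by
    have h := sq_sqrt_one_add_sq y
    have h0 := sqrt_one_add_sq_pos y
    rw [abs_of_pos (by positivity)]
    generalize Real.sqrt (1 + y ^ 2) = q at *
    rw [← h]
    gcongr
    nlinarith
  bound₂ y := by
    have h := sq_sqrt_one_add_sq y
    have h0 := sqrt_one_add_sq_pos y
    have h1 := abs_lt_sqrt_one_add_sq y
    rw [abs_neg, abs_div, abs_mul, abs_div, abs_of_pos h0,
      abs_of_pos (by positivity : 0 < 1 + 2 * Real.sqrt (1 + y ^ 2)), abs_of_pos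
      (by positivity : 0 < (Real.sqrt (1 + y ^ 2) * (1 + Real.sqrt (1 + y ^ 2))) ^ 2)]
    generalize Real.sqrt (1 + y ^ 2) = q at *
    rw [← h]
    have hy : |y| / q ≤ 1 := (div_le_one h0).2 h1.le
    calc |y| / q * (1 + 2 * q) / (q * (1 + q)) ^ 2 ≤ 1 * (1 + 2 * q) / (q * (1 + q)) ^ 2 := by
          gcongr
      _ ≤ 2 / q ^ 2 := by
          rw [div_le_div_iff₀ (by positivity) (by positivity)]
          have : (1 : ℝ) * (1 + 2 * q) ≤ 2 * (1 + q) ^ 2 := by nlinarith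
          calc _ ≤ 2 * (1 + q) ^ 2 * q ^ 2 := by gcongr
            _ = _ := by ring

/-! ### Translation to the variables x, t, m, ε and conclusion. -/

section

variable {μ v a : ℝ}

/-- D + sin p = μ exp(η), and exp(η) splits into exp of the rapidity of v, which is a(1 + v), times
exp of the relative rapidity, which is √(1+y²) + y. The first factor becomes √((t+x)/(t-x)). -/
theorem one_add_relSinh_mul_expProfile (hμ : 0 < μ) (ha : 0 < a) (hav : a ^ 2 * (1 - v ^ 2) = 1)
    (p : ℝ) : μ * (a * (1 + v)) *
      ((1 + relSinh μ v a p * expProfile (relSinh μ v a p)) / latticeEnergy μ p) =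
      1 + Real.sin p / latticeEnergy μ p := by
  have hD := latticeEnergy_pos hμ p
  rw [one_add_mul_expProfile, sqrt_one_add_relSinh_sq hμ ha hav, relSinh]
  field_simp
  linear_combination (latticeEnergy μ p + Real.sin p) * hav

theorem latticePhase_stationary {Δ m ε x t : ℝ} {j l : ℤ} (h : Subluminal (m * ε) v a Δ)
    (hε : 0 < ε) (hx : x = ε * j) (ht : t = ε * l) (hl : 0 < (l : ℝ)) (hv : v * l = j) :
    latticePhase (m * ε) j l (Real.arcsin (m * ε * (v * a))) = -theta x t m ε := by
  have hμ := h.mass_pos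
  have ha := h.pos
  have hav := h.boost
  have h0 : |m * ε * boostSinh v a 0| < 1 := h.abs_boostSinh_lt (by rw [abs_zero]; positivity)
  have hP : Real.arcsin (m * ε * (v * a)) = boostMomentum (m * ε) v a 0 := by
    rw [boostMomentum, boostSinh]; simp
  have ht0 : 0 < t := by rw [ht]; positivity
  have hxv : x = v * t := by rw [hx, ht, ← hv]; ring
  have hs : Real.sqrt (t ^ 2 - x ^ 2) = t / a := by
    rw [← Real.sqrt_sq (by positivity : 0 ≤ t / a)]
    congr 1
    rw [hxv]; field_simp; linear_combination hav
  have hfreq : latticeFrequency (m * ε) (boostMomentum (m * ε) v a 0) =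
      Real.arcsin (m * ε * t / Real.sqrt ((1 + m ^ 2 * ε ^ 2) * (t ^ 2 - x ^ 2))) := by
    have hcos : 0 ≤ Real.cos (boostMomentum (m * ε) v a 0) := Real.cos_arcsin_nonneg _
    rw [latticeFrequency, Real.arccos_eq_arcsin (by positivity), sqrt_one_sub_cos_div_sq,
      latticeEnergy_boostMomentum hμ ha hav h0.le, Real.sqrt_mul (by positivity), hs, mul_pow,
      boostCosh]
    congr 1
    simp only [ne_eq, OfNat.ofNat_ne_zero, not_false_eq_true, zero_pow, add_zero, Real.sqrt_one,
      mul_one, mul_zero, zero_add]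
    field_simp
  rw [latticePhase, hP, hfreq, ← hP, theta, hs,
    show m * ε * x / (t / a) = m * ε * (v * a) by rw [hxv]; field_simp,
    show t / ε = l by rw [ht]; field_simp, show x / ε = j by rw [hx]; field_simp]
  ring

/-- At the stationary point G = t/(a√W) with W = t² - (1+m²ε²)x², so the square root of G produces
the fourth root of W. -/
theorem main_amplitude {Δ m ε x t : ℝ} {l : ℤ} (h : Subluminal (m * ε) v a Δ) (hm : 0 < m)
    (hε : 0 < ε) (ht : t = ε * l) (hl : 0 < (l : ℝ)) (hxv : x = v * t) :
    m * ε / Real.pi * (Real.sqrt (boostAmplitude (m * ε) v a 0) *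
      Real.sqrt (2 * Real.pi / (l * (m * ε) / a))) =
    ε * Real.sqrt (2 * m / Real.pi) / (t ^ 2 - (1 + m ^ 2 * ε ^ 2) * x ^ 2) ^ (1 / 4 : ℝ) := by
  have ha := h.pos
  have hav := h.boost
  have ht0 : 0 < t := by rw [ht]; positivity
  have hgap := h.gap_le
  have hΔ := h.gap_pos
  have hpi := Real.pi_pos
  set W := t ^ 2 - (1 + m ^ 2 * ε ^ 2) * x ^ 2 with hW
  have hden : boostDenom (m * ε) v a 0 = a ^ 2 * W / t ^ 2 := by
    rw [boostDenom, boostSinh, hW, hxv]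
    simp only [ne_eq, OfNat.ofNat_ne_zero, not_false_eq_true, zero_pow, add_zero, Real.sqrt_one,
      mul_one, mul_zero]
    field_simp
    linear_combination -hav
  have hden0 : 0 < boostDenom (m * ε) v a 0 := by
    rw [boostDenom, boostSinh]
    simp only [ne_eq, OfNat.ofNat_ne_zero, not_false_eq_true, zero_pow, add_zero, Real.sqrt_one,
      mul_one, mul_zero]
    linarith
  have hW0 : 0 < W := by
    by_contra hneg
    have : a ^ 2 * W / t ^ 2 ≤ 0 :=
      div_nonpos_of_nonpos_of_nonneg (mul_nonpos_of_nonneg_of_nonpos (by positivity) (not_lt.1 hneg))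
        (by positivity)
    linarith
  set s := W ^ (1 / 4 : ℝ) with hs
  have hs0 : 0 < s := Real.rpow_pos_of_pos hW0 _
  have hs4 : s ^ 4 = W := by
    rw [hs, ← Real.rpow_natCast, ← Real.rpow_mul hW0.le]; norm_num
  have hG : boostAmplitude (m * ε) v a 0 = t / (a * s ^ 2) := by
    rw [boostAmplitude, hden, ← hs4, show a ^ 2 * s ^ 4 / t ^ 2 = (a * s ^ 2 / t) ^ 2 by
      field_simp, Real.sqrt_sq (by positivity), inv_div]
  rw [← Real.sqrt_mul' _ (by positivity), hG, ht]
  have e : ε * l / (a * s ^ 2) * (2 * Real.pi / (l * (m * ε) / a)) =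
      (Real.pi / (m * s)) ^ 2 * (2 * m / Real.pi) := by
    field_simp
  rw [e, Real.sqrt_mul (by positivity), Real.sqrt_sq (by positivity)]
  field_simp

theorem sqrt_add_div_sub {x t : ℝ} (ha : 0 < a) (hav : a ^ 2 * (1 - v ^ 2) = 1) (ht : 0 < t)
    (hxv : x = v * t) : Real.sqrt ((t + x) / (t - x)) = a * (1 + v) := by
  have hv := abs_lt.1 (abs_lt_one_of_boost hav)
  have h1 : 0 < 1 - v := by linarith
  have h2 : 0 < 1 + v := by linarith
  rw [← Real.sqrt_sq (by positivity : 0 ≤ a * (1 + v))]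
  congr 1
  rw [hxv, show t + v * t = t * (1 + v) by ring, show t - v * t = t * (1 - v) by ring]
  field_simp
  linear_combination -hav

/-- With n = √(1+μ²) ≥ 1 the hypothesis gives n|v| ≤ 1 - Δ. Then 1 - (μva)² = (1 - n²v²)/(1 - v²) ≥
1 - (1-Δ)² ≥ Δ, and 1 - v² ≥ Δ² gives aΔ ≤ 1. -/
theorem subluminal_of_abs_lt {Δ : ℝ} (hμ : 0 < μ) (hμ1 : μ ≤ 1) (hΔ : 0 < Δ) (hΔ1 : Δ < 1)
    (hv : |v| < 1 / Real.sqrt (1 + μ ^ 2) - Δ) :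
    Subluminal μ v (1 / Real.sqrt (1 - v ^ 2)) Δ := by
  set n := Real.sqrt (1 + μ ^ 2) with hn
  have hn1 : 1 ≤ n := one_le_sqrt_one_add_sq μ
  have hn2 : n ^ 2 = 1 + μ ^ 2 := sq_sqrt_one_add_sq μ
  have hnv : n * |v| ≤ 1 - Δ := by
    have : n * |v| < n * (1 / n - Δ) := by gcongr
    rw [mul_sub, mul_one_div_cancel (by positivity)] at this
    nlinarith
  have hnv2 : n ^ 2 * v ^ 2 ≤ (1 - Δ) ^ 2 := by
    rw [← sq_abs v, ← mul_pow]; exact pow_le_pow_left₀ (by positivity) hnv 2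
  have hv2 : v ^ 2 ≤ n ^ 2 * v ^ 2 := by nlinarith [sq_nonneg v, one_le_pow₀ hn1 (n := 2)]
  have hpos : 0 < 1 - v ^ 2 := by nlinarith
  have hsq : (1 / Real.sqrt (1 - v ^ 2)) ^ 2 = 1 / (1 - v ^ 2) := by
    rw [div_pow, Real.sq_sqrt hpos.le, one_pow]
  refine ⟨hμ, hμ1, by positivity, by rw [hsq]; field_simp, hΔ, hΔ1, ?_, ?_⟩
  · rw [one_div, inv_mul_le_one₀ (Real.sqrt_pos.2 hpos)]
    apply Real.le_sqrt_of_sq_le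
    nlinarith
  · rw [mul_pow, mul_pow, hsq]
    have : 1 - μ ^ 2 * (v ^ 2 * (1 / (1 - v ^ 2))) = (1 - n ^ 2 * v ^ 2) / (1 - v ^ 2) := by
      rw [hn2]; field_simp; ring
    rw [this, le_div_iff₀ hpos]
    nlinarith [sq_nonneg v]

/-- The error constant in the asymptotic formula. -/
noncomputable def errorConstant (Δ : ℝ) : ℝ :=
  2 / Δ ^ 4 * (1000 * (2000 / Δ ^ 5) ^ 18 / (Δ ^ 2 / 8) ^ 2 + 100 / (Δ ^ 2 / 8) ^ 3)

theorem error_scale {m ε t : ℝ} {l : ℤ} (hm : 0 < m) (hε : 0 < ε) (ht : t = ε * l)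
    (hl : 0 < (l : ℝ)) : m * ε * (1 / Real.sqrt (l * (m * ε))) ^ 3 =
      ε / (m ^ (1 / 2 : ℝ) * t ^ (3 / 2 : ℝ)) := by
  have ht0 : 0 < t := by rw [ht]; positivity
  have h1 : t ^ (3 / 2 : ℝ) = Real.sqrt t ^ 3 := by
    rw [Real.sqrt_eq_rpow, ← Real.rpow_natCast, ← Real.rpow_mul ht0.le]; norm_num
  rw [h1, ← Real.sqrt_eq_rpow, show (l : ℝ) * (m * ε) = m * t by rw [ht]; ring,
    Real.sqrt_mul hm.le]
  have hm2 := Real.sq_sqrt hm.le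
  have hs := Real.sqrt_pos.2 hm
  have hs' := Real.sqrt_pos.2 ht0
  field_simp
  linear_combination -hm2

theorem mul_norm_eq_norm_mul {c : ℝ} (hc : 0 ≤ c) (z : ℂ) : c * ‖z‖ = ‖(c : ℂ) * z‖ := by
  rw [norm_mul, Complex.norm_real, Real.norm_eq_abs, abs_of_nonneg hc]

theorem norm_I_mul (z : ℂ) : ‖Complex.I * z‖ = ‖z‖ := by
  rw [norm_mul, Complex.norm_I, one_mul]

theorem asymptotics {Δ m ε x t : ℝ} {j l : ℤ} (hm : 0 < m) (hε : 0 < ε) (hΔ : 0 < Δ)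
    (hΔ1 : Δ < 1) (hx : x = ε * j) (ht : t = ε * l)
    (hcone : |x| / t < 1 / Real.sqrt (1 + m ^ 2 * ε ^ 2) - Δ) (hmε : ε ≤ 1 / m)
    (hlarge : t > 64 / Δ ^ 5 / m) :
    (Odd (j + l) →
      ‖latticePropagator₁ j l m ε - ((ε * Real.sqrt (2 * m / Real.pi) *
        (Real.sin (theta x t m ε + Real.pi / 4) /
          (t ^ 2 - (1 + m ^ 2 * ε ^ 2) * x ^ 2) ^ (1 / 4 : ℝ)) : ℝ) : ℂ)‖
        ≤ errorConstant Δ * (ε / (m ^ (1 / 2 : ℝ) * t ^ (3 / 2 : ℝ)))) ∧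
    (Even (j + l) →
      ‖latticePropagator₁ j l m ε - Complex.I * ((ε * Real.sqrt (2 * m / Real.pi) *
        (Real.cos (theta x t m ε + Real.pi / 4) /
          (t ^ 2 - (1 + m ^ 2 * ε ^ 2) * x ^ 2) ^ (1 / 4 : ℝ)) : ℝ) : ℂ)‖
        ≤ errorConstant Δ * (ε / (m ^ (1 / 2 : ℝ) * t ^ (3 / 2 : ℝ)))) ∧
    (Even (j + l) →
      ‖latticePropagator₂ j l m ε -
        ((ε * Real.sqrt (2 * m / Real.pi) * Real.sqrt ((t + x) / (t - x)) *
        (Real.cos (theta x t m ε + Real.pi / 4) /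
          (t ^ 2 - (1 + m ^ 2 * ε ^ 2) * x ^ 2) ^ (1 / 4 : ℝ)) : ℝ) : ℂ)‖
        ≤ errorConstant Δ * (ε / (m ^ (1 / 2 : ℝ) * t ^ (3 / 2 : ℝ)))) ∧
    (Odd (j + l) →
      ‖latticePropagator₂ j l m ε -
        -Complex.I * ((ε * Real.sqrt (2 * m / Real.pi) * Real.sqrt ((t + x) / (t - x)) *
        (Real.sin (theta x t m ε + Real.pi / 4) /
          (t ^ 2 - (1 + m ^ 2 * ε ^ 2) * x ^ 2) ^ (1 / 4 : ℝ)) : ℝ) : ℂ)‖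
        ≤ errorConstant Δ * (ε / (m ^ (1 / 2 : ℝ) * t ^ (3 / 2 : ℝ)))) := by
  have hpi := Real.pi_pos
  have ht0 : 0 < t := lt_trans (by positivity) hlarge
  have hl : 0 < (l : ℝ) := by
    rw [ht] at ht0; exact pos_of_mul_pos_right ht0 hε.le
  have hl' : 0 ≤ l := by exact_mod_cast hl.le
  have hμ : 0 < m * ε := mul_pos hm hε
  have hμ1 : m * ε ≤ 1 := by rwa [mul_comm, ← le_div_iff₀ hm]
  set v : ℝ := j / l with hvdef
  have hv : v * l = j := by rw [hvdef]; field_simp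
  have hxv : x = v * t := by rw [hx, ht, ← hv]; ring
  have hcone' : |v| < 1 / Real.sqrt (1 + (m * ε) ^ 2) - Δ := by
    rw [hxv, abs_mul, abs_of_pos ht0, mul_div_cancel_right₀ _ ht0.ne'] at hcone
    rwa [mul_pow]
  have h := subluminal_of_abs_lt hμ hμ1 hΔ hΔ1 hcone'
  set a := 1 / Real.sqrt (1 - v ^ 2)
  have ha := h.pos
  have hav := h.boost
  have haΔ : a ≤ 1 / Δ := by rw [le_div_iff₀ hΔ]; exact h.boost_le
  have hθ := latticePhase_stationary h hε hx ht hl hv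
  have hamp := main_amplitude h hm hε ht hl hxv
  have hvel := sqrt_add_div_sub ha hav ht0 hxv
  have hΛ0 : 0 < l * (m * ε) / a := by positivity
  set ρ := 1 / Real.sqrt (l * (m * ε) / a) with hρdef
  have hρ0 : 0 < ρ := by positivity
  have hρ2 : l * (m * ε) / a * ρ ^ 2 = 1 := by
    rw [hρdef, div_pow, Real.sq_sqrt hΛ0.le]; field_simp
  have hlm : 64 / Δ ^ 5 < l * (m * ε) := by
    rw [gt_iff_lt, div_lt_iff₀ hm, ht] at hlarge; linarith
  have hΛ : 64 / Δ ^ 4 ≤ l * (m * ε) / a := by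
    rw [le_div_iff₀ ha]
    calc 64 / Δ ^ 4 * a ≤ 64 / Δ ^ 4 * (1 / Δ) := by gcongr
      _ = 64 / Δ ^ 5 := by field_simp
      _ ≤ _ := hlm.le
  -- The threshold 64/Δ⁵ is what makes ρ² = a/(lμ) at most Δ⁴/64, using a ≤ 1/Δ.
  have hρr : ρ ≤ Δ ^ 2 / 8 := by
    have : Real.sqrt (64 / Δ ^ 4) = 8 / Δ ^ 2 := by
      rw [show 64 / Δ ^ 4 = (8 / Δ ^ 2) ^ 2 by field_simp; norm_num,
        Real.sqrt_sq (by positivity)]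
    rw [hρdef, show Δ ^ 2 / 8 = 1 / (8 / Δ ^ 2) by field_simp, ← this]
    gcongr
  set E := 1000 * (2000 / Δ ^ 5) ^ 18 / (Δ ^ 2 / 8) ^ 2 + 100 / (Δ ^ 2 / 8) ^ 3 with hE
  have hE0 : 0 < E := by positivity
  set σ := 1 / Real.sqrt (l * (m * ε)) with hσ
  have hσ0 : 0 < σ := by positivity
  -- The factor a^(3/2) in ρ³ is absorbed into Δ⁻³.
  have hρσ : ρ ^ 3 ≤ 1 / Δ ^ 3 * σ ^ 3 := by
    have : ρ ≤ 1 / Δ * σ := by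
      apply le_of_sq_le_sq _ (by positivity)
      rw [hρdef, mul_pow, div_pow, div_pow, div_pow, Real.sq_sqrt hΛ0.le,
        Real.sq_sqrt (by positivity)]
      have : a ≤ 1 / Δ ^ 2 := haΔ.trans (by
        gcongr; nlinarith)
      calc (1 : ℝ) ^ 2 / (l * (m * ε) / a) = a * (1 / (l * (m * ε))) := by field_simp
        _ ≤ 1 / Δ ^ 2 * (1 / (l * (m * ε))) := by gcongr
        _ = _ := by ring
    calc ρ ^ 3 ≤ (1 / Δ * σ) ^ 3 := by gcongr
      _ = _ := by ring
  have hscale := error_scale hm hε ht hl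
  have hv1 := abs_lt.1 (abs_lt_one_of_boost hav)
  have hb : a * (1 + v) ≤ 2 / Δ := by
    calc a * (1 + v) ≤ 1 / Δ * 2 := by gcongr <;> linarith
      _ = _ := by ring
  have hb0 : 0 < a * (1 + v) := mul_pos ha (by linarith)
  obtain ⟨even₁, odd₁⟩ := h.norm_integral_period_sub_le profile_zero hl hv hρ0 hρr hρ2 rfl hθ
  obtain ⟨even₂, odd₂⟩ := h.norm_integral_period_sub_le profile_expProfile hl hv hρ0 hρr hρ2 rfl hθ
  -- Here c is 1 for the first component and a(1 + v) ≤ 2/Δ for the second; with Δ⁻³ from ρ³ this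
  -- explains the factor 2/Δ⁴ in `errorConstant`.
  have hbound : ∀ c, 0 ≤ c → c ≤ 2 / Δ → m * ε * c / (2 * Real.pi) * (2 * (E * ρ ^ 3)) ≤
      errorConstant Δ * (ε / (m ^ (1 / 2 : ℝ) * t ^ (3 / 2 : ℝ))) := fun c hc0 hc => by
    rw [← hscale, ← hσ]
    have hpi1 : 1 ≤ Real.pi := by linarith [Real.two_le_pi]
    calc m * ε * c / (2 * Real.pi) * (2 * (E * ρ ^ 3)) = m * ε * c * E * ρ ^ 3 / Real.pi := by
          field_simp
      _ ≤ m * ε * c * E * ρ ^ 3 := div_le_self (by positivity) hpi1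
      _ ≤ m * ε * (2 / Δ) * E * (1 / Δ ^ 3 * σ ^ 3) := by gcongr
      _ = _ := by rw [errorConstant, ← hE]; field_simp
  have hb1 := hbound 1 zero_le_one (by rw [le_div_iff₀ hΔ]; linarith)
  have hb2 := hbound _ hb0.le hb
  rw [mul_one] at hb1
  have hA₁ := latticePropagator₁_eq_integral hm hε j hl'
  have hA₂ := latticePropagator₂_eq_integral hm hε j hl'
  simp only [← one_add_relSinh_mul_expProfile hμ ha hav] at hA₂
  simp only [Complex.ofReal_mul (m * ε * (a * (1 + v))), mul_assoc ((m * ε * (a * (1 + v)) : ℝ) : ℂ),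
    intervalIntegral.integral_const_mul] at hA₂
  simp only [mul_zero, add_zero] at even₁ odd₁
  have hampl : ∀ c, ε * Real.sqrt (2 * m / Real.pi) *
      (c / (t ^ 2 - (1 + m ^ 2 * ε ^ 2) * x ^ 2) ^ (1 / 4 : ℝ)) = m * ε / (2 * Real.pi) *
      (2 * (Real.sqrt (boostAmplitude (m * ε) v a 0) *
        Real.sqrt (2 * Real.pi / (l * (m * ε) / a)) * c)) := fun c => by
    linear_combination (-c) * hamp
  generalize Real.sqrt (boostAmplitude (m * ε) v a 0) *
        Real.sqrt (2 * Real.pi / (l * (m * ε) / a)) = A at *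
  have hampl' : ∀ c, ε * Real.sqrt (2 * m / Real.pi) * Real.sqrt ((t + x) / (t - x)) *
      (c / (t ^ 2 - (1 + m ^ 2 * ε ^ 2) * x ^ 2) ^ (1 / 4 : ℝ)) =
      m * ε * (a * (1 + v)) / (2 * Real.pi) * (2 * (A * c)) := fun c => by
    rw [hvel]
    linear_combination (a * (1 + v)) * hampl c
  simp only [hampl, hampl', hA₁, hA₂]
  have hk₁ : 0 ≤ m * ε / (2 * Real.pi) := by positivity
  have hk₂ : 0 ≤ m * ε * (a * (1 + v)) / (2 * Real.pi) := by positivity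
  refine ⟨fun o => ?_, fun e => ?_, fun e => ?_, fun o => ?_⟩
  · refine le_trans (le_of_eq ?_) ((mul_le_mul_of_nonneg_left (odd₁ o) hk₁).trans hb1)
    -- The first component carries an extra factor i, which turns -i sin into sin.
    rw [mul_norm_eq_norm_mul hk₁, ← norm_I_mul (_ * _)]
    congr 1
    push_cast
    linear_combination (-(m * ε / (2 * Real.pi) *
      (2 * (A * Complex.sin (theta x t m ε + Real.pi / 4)))) : ℂ) * Complex.I_sq
  · refine le_trans (le_of_eq ?_) ((mul_le_mul_of_nonneg_left (even₁ e) hk₁).trans hb1)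
    rw [mul_norm_eq_norm_mul hk₁, ← norm_I_mul (_ * _)]
    congr 1
    push_cast
    ring
  · refine le_trans (le_of_eq ?_) ((mul_le_mul_of_nonneg_left (even₂ e) hk₂).trans hb2)
    rw [mul_norm_eq_norm_mul hk₂]
    congr 1
    push_cast
    ring
  · refine le_trans (le_of_eq ?_) ((mul_le_mul_of_nonneg_left (odd₂ o) hk₂).trans hb2)
    rw [mul_norm_eq_norm_mul hk₂]
    congr 1
    push_cast
    ring

end

end FeynmanAnticheckers

theorem mainTheorem7 :
    (∀ m ε : ℝ, 0 < m → 0 < ε → FeynmanAnticheckers.WellDefined m ε) ∧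
    ∀ Δ : ℝ, 0 < Δ → ∃ CΔ : ℝ, 0 < CΔ ∧ ∃ C : ℝ, 0 < C ∧
      ∀ m ε : ℝ, 0 < m → 0 < ε → ∀ (j l : ℤ) (x t : ℝ), x = ε * j → t = ε * l →
        |x| / t < 1 / Real.sqrt (1 + m ^ 2 * ε ^ 2) - Δ → ε ≤ 1 / m → t > CΔ / m →
        (Odd (j + l) →
          ‖FeynmanAnticheckers.latticePropagator₁ j l m ε -
            ((ε * Real.sqrt (2 * m / Real.pi) *
              (Real.sin (FeynmanAnticheckers.theta x t m ε + Real.pi / 4) /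
                (t ^ 2 - (1 + m ^ 2 * ε ^ 2) * x ^ 2) ^ (1 / 4 : ℝ)) : ℝ) : ℂ)‖
            ≤ C * (ε / (m ^ (1 / 2 : ℝ) * t ^ (3 / 2 : ℝ)))) ∧
        (Even (j + l) →
          ‖FeynmanAnticheckers.latticePropagator₁ j l m ε -
            Complex.I * ((ε * Real.sqrt (2 * m / Real.pi) *
              (Real.cos (FeynmanAnticheckers.theta x t m ε + Real.pi / 4) /
                (t ^ 2 - (1 + m ^ 2 * ε ^ 2) * x ^ 2) ^ (1 / 4 : ℝ)) : ℝ) : ℂ)‖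
            ≤ C * (ε / (m ^ (1 / 2 : ℝ) * t ^ (3 / 2 : ℝ)))) ∧
        (Even (j + l) →
          ‖FeynmanAnticheckers.latticePropagator₂ j l m ε -
            ((ε * Real.sqrt (2 * m / Real.pi) * Real.sqrt ((t + x) / (t - x)) *
              (Real.cos (FeynmanAnticheckers.theta x t m ε + Real.pi / 4) /
                (t ^ 2 - (1 + m ^ 2 * ε ^ 2) * x ^ 2) ^ (1 / 4 : ℝ)) : ℝ) : ℂ)‖
            ≤ C * (ε / (m ^ (1 / 2 : ℝ) * t ^ (3 / 2 : ℝ)))) ∧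
        (Odd (j + l) →
          ‖FeynmanAnticheckers.latticePropagator₂ j l m ε -
            -Complex.I * ((ε * Real.sqrt (2 * m / Real.pi) * Real.sqrt ((t + x) / (t - x)) *
              (Real.sin (FeynmanAnticheckers.theta x t m ε + Real.pi / 4) /
                (t ^ 2 - (1 + m ^ 2 * ε ^ 2) * x ^ 2) ^ (1 / 4 : ℝ)) : ℝ) : ℂ)‖
            ≤ C * (ε / (m ^ (1 / 2 : ℝ) * t ^ (3 / 2 : ℝ)))) := by
  refine ⟨fun m ε hm hε => FeynmanAnticheckers.wellDefined hm hε, fun Δ hΔ => ?_⟩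
  by_cases hΔ1 : Δ < 1
  · exact ⟨64 / Δ ^ 5, by positivity, FeynmanAnticheckers.errorConstant Δ, by
      unfold FeynmanAnticheckers.errorConstant; positivity, fun m ε hm hε j l x t hx ht hcone hmε
      hlarge => FeynmanAnticheckers.asymptotics hm hε hΔ hΔ1 hx ht hcone hmε hlarge⟩
  -- For Δ ≥ 1 no point satisfies the velocity condition, as 1/√(1+m²ε²) ≤ 1; any constants do.
  · refine ⟨1, one_pos, 1, one_pos, fun m ε hm hε j l x t hx ht hcone hmε hlarge => ?_⟩
    exfalso
    have ht0 : 0 < t := lt_trans (by positivity) hlarge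
    have h1 : 1 / Real.sqrt (1 + m ^ 2 * ε ^ 2) ≤ 1 := by
      rw [div_le_one (by positivity), Real.one_le_sqrt]
      linarith [mul_nonneg (sq_nonneg m) (sq_nonneg ε)]
    have h2 : 0 ≤ |x| / t := by positivity
    linarith
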